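/- **Setting.** Let $V$ be a finite-dimensional real vector space with a finite free family $(\alpha_i)_{i\in I}$ in $V^*$ and a family $(\alpha_i^\vee)_{i\in I}$ in $V$ such that $\alpha_i(\alpha_i^\vee)=2$. Put $r_i(v)=v-\alpha_i(v)\alpha_i^\vee$, $W^v=\langle r_i\rangle$, $\Phi=\{w\alpha_i\}$. Assume that $(W^v,(r_i)_{i\in I})$ is a Coxeter system, that $\Phi=\Phi^+\sqcup\Phi^-$ with $\Phi^+=\Phi\cap\bigoplus_i\mathbb R_{\ge0}\alpha_i=-\Phi^-$, that $w\alpha_i\in\Phi^+\iff\ell(wr_i)>\ell(w)$, and that $\Phi\cap\mathbb R_{>0}\alpha=\{\alpha\}$ for $\alpha\in\Phi$. Let $\Delta_{im}\subset V^*\setminus\{0\}$ be a set, disjoint from $\mathbb R\Phi$, with $\Delta_{im}=\Delta_{im}^+\cup-\Delta_{im}^+$, where $\Delta_{im}^+=\Delta_{im}\cap\bigoplus_i\mathbb R_{\ge0}\alpha_i$ is $W^v$-stable (the moderately imaginary case); put $\Delta=\Phi\cup\Delta_{im}$. The vectorial facets are the $\pm wF^v(J)$, $F^v(J)=\{v:\alpha_i(v)=0\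 (i\in J),\ \alpha_i(v)>0\ (i\notin J)\}$, for $J\subset I$, $w\in W^v$; such a facet is spherical if $\langle r_i:i\in J\rangle$ is finite, a chamber if $J=\emptyset$, a panel if $|J|=1$. The Tits cone $\mathcal T$ is the union of the $wF^v(J)$. Let $\mathbb A$ be an affine space under $V$ with a set $\mathcal M$ of hyperplanes (walls), each of direction $\ker\alpha$ for some $\alpha\in\Phi$, infinitely many for each $\alpha\in\Phi$, and stable under the group $W$ generated by the reflections $r_M$, $M\in\mathcal M$ (if $M$ has direction $\ker(w\alpha_i)$, $r_M$ fixes $M$ pointwise and has linear part $wr_iw^{-1}$). For $\alpha\in\Delta$, an admissible half-space of $\alpha$ is $\mathbb A$, or a half-space $\{\alpha\ge c\}$ (closed) or $\{\alpha>c\}$ (open) which, if $\alpha\in\Phi$, is bounded by a wall. A closed half-space $\{\alpha\ge c\}$ with $\alpha\in\Phi$, bounded by a wall $M$, is a half-apartment, and $M$ is its wall. Filters of subsets are used as generalized subsets ($F\subset F'$ means $F'\subseteq F$ as families of sets; a set contains a filter if it is an element of it; a map fixes a filter if it fixes pointwise one of its elements). The enclosure $cl(F)$ is the filter of sets containing an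 element of $F$ of the form $\bigcap_{\alpha\in\Delta}D_\alpha$ with one closed admissible half-space (or $\mathbb A$) for each $\alpha$. The facet $F(x,F^v)$ is the filter of sets containing an intersection of admissible half-spaces, one for each $\alpha\in\Delta$, open or closed, which contains a neighbourhood of $x$ in $x+F^v$. It is a chamber if $F^v$ can be taken to be a vectorial chamber, and a panel if it can be written with $F^v$ a vectorial panel and $x$ on a wall of direction $\operatorname{span}F^v$. A facet $F'$ dominates $F$ if $F\subset\overline{F'}$. A chimney is $\mathfrak r=cl(F+F^v)$ ($F$ a facet, $F^v$ a vectorial facet); it is splayed if $F^v$ is spherical, solid if the direction of its support has a finite pointwise stabilizer in $W^v$; its germ is the filter of sets containing some $cl(F+\xi+F^v)$, $\xi\in\overline{F^v}$. An affine hovel of type $\mathbb A$ is a set $\mathcal I$ covered by a set $\mathcal A$ of subsets (apartments) such that: (MA1) each $A\in\mathcal A$ carries a set of bijections $\mathbb A\to A$ forming one orbit $f_0\circ W$ (so that all the notions above make sense in $A$; an isomorphism $A\to A'$ is a bijection carrying these bijections to those of $A'$); (MA2) if $F$ is a point, the germ at $x$ of an interval $]x,y]$ with $x\neq y$ and $y-x\in\pm\mathcal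 T$, a half-line with direction in a spherical vectorial facet, or a solid chimney, of an apartment $A$, and $A'$ is an apartment containing $F$, then $A\cap A'$ contains $cl_A(F)$ and some isomorphism $A\to A'$ fixes $cl_A(F)$; (MA3) if $\mathfrak R$ is the germ of a splayed chimney and $F$ a facet or the germ of a solid chimney, some apartment contains $\mathfrak R$ and $F$; (MA4) if two apartments $A,A'$ contain $\mathfrak R$ and $F$ as in (MA3), then $A\cap A'$ contains $cl_A(\mathfrak R\cup F)$ and some isomorphism $A\to A'$ fixes it. The facets, chambers, panels, half-apartments and walls of $\mathcal I$ are those of its apartments, and a chamber dominates a panel in $\mathcal I$ if it does so in some apartment containing both. The hovel is thick if every panel is dominated by at least three chambers. **Statement.** Let $\mathcal I$ be an affine hovel. 1. Let $D$ be a half-apartment of $\mathcal I$ with wall $M=\partial D$, let $F$ be a panel contained in $M$ and $C$ a chamber of $\mathcal I$ dominating $F$. Then there is an apartment of $\mathcal I$ containing $D$ and $C$. 2. Let $D$ and $D_1$ be two half-apartments of $\mathcal I$ with the same wall $M=\partial D=\partial D_1$ and with $D\cap D_1=M$. Then $D\cup D_1$ is an apartment of $\mathcal I$. 3. If $\mathcal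 I$ is thick, every half-apartment of $\mathcal I$ is the intersection of two apartments of $\mathcal I$. -/

import Mathlib

open Set Filter Topology Module

namespace AffineHovel

/-! ### Vectorial Weyl group and roots -/

/-- A finite free family of simple roots and a family of simple coroots in a real vector space. -/
structure SimpleRootData (I V : Type*) [AddCommGroup V] [Module ℝ V] where
  root : I → Dual ℝ V
  coroot : I → V
  linearIndependent_root : LinearIndependent ℝ root
  root_coroot_two : ∀ i, root i (coroot i) = 2

namespace SimpleRootData

variable {I V : Type*} [AddCommGroup V] [Module ℝ V] (d : SimpleRootData I V)

/-- The simple reflection `v ↦ v - αᵢ(v) αᵢ^∨`. -/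
noncomputable def refl (i : I) : V ≃ₗ[ℝ] V := Module.reflection (d.root_coroot_two i)

/-- The vectorial Weyl group `W^v`. -/
def weyl : Subgroup (V ≃ₗ[ℝ] V) := Subgroup.closure (Set.range d.refl)

/-- A simple reflection, as an element of `W^v`. -/
noncomputable def reflMem (i : I) : d.weyl := ⟨d.refl i, Subgroup.subset_closure ⟨i, rfl⟩⟩

/-- The action of `GL(V)` on the dual space: `(w f)(v) = f (w⁻¹ v)`. -/
def act (w : V ≃ₗ[ℝ] V) (f : Dual ℝ V) : Dual ℝ V := f ∘ₗ (w⁻¹ : V ≃ₗ[ℝ] V).toLinearMap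

/-- The set `Φ` of real roots. -/
def realRoots : Set (Dual ℝ V) := {β | ∃ w ∈ d.weyl, ∃ i, β = act w (d.root i)}

/-- The cone of linear combinations of the simple roots with nonnegative coefficients. -/
def posCone [Fintype I] : Set (Dual ℝ V) :=
  {f | ∃ c : I → ℝ, (∀ i, 0 ≤ c i) ∧ f = ∑ i, c i • d.root i}

/-- The facet `F^v(J)` of the closed fundamental chamber. -/
def stdFacet (J : Set I) : Set V :=
  {v | (∀ i ∈ J, d.root i v = 0) ∧ ∀ i ∉ J, 0 < d.root i v}

/-- `S` is a vectorial facet of type `J`, positive (`w F^v(J)`) or negative (`- w F^v(J)`). -/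
def IsVFacetOfType (J : Set I) (S : Set V) : Prop :=
  ∃ w ∈ d.weyl, S = w '' d.stdFacet J ∨ S = (fun v => -(w v)) '' d.stdFacet J

/-- Vectorial facets, of either sign. -/
def IsVFacet (S : Set V) : Prop := ∃ J, d.IsVFacetOfType J S

/-- Spherical vectorial facets: those whose type `J` generates a finite group. -/
def IsSphericalVFacet (S : Set V) : Prop :=
  ∃ J : Set I, (Subgroup.closure (d.refl '' J) : Set (V ≃ₗ[ℝ] V)).Finite ∧ d.IsVFacetOfType J S

/-- Vectorial chambers. -/
def IsVChamber (S : Set V) : Prop := d.IsVFacetOfType ∅ S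

/-- Vectorial panels. -/
def IsVPanel (S : Set V) : Prop := ∃ i, d.IsVFacetOfType {i} S

/-- The (positive) Tits cone. -/
def titsCone : Set V := {v | ∃ w ∈ d.weyl, ∃ J, v ∈ w '' d.stdFacet J}

end SimpleRootData

/-- The vectorial data of an affine apartment: simple roots and coroots whose reflections generate
a Coxeter group `W^v` with the usual properties of the real roots, together with a moderately
imaginary set of imaginary roots. -/
structure VectorialData (I V : Type*) [Fintype I] [AddCommGroup V] [Module ℝ V]
    extends SimpleRootData I V where
  /-- the Coxeter matrix of `W^v` -/
  matrix : CoxeterMatrix I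
  /-- `W^v` is a Coxeter group with the simple reflections as its system of generators -/
  cox : CoxeterSystem matrix toSimpleRootData.weyl
  cox_simple : ∀ i, cox.simple i = toSimpleRootData.reflMem i
  /-- every real root is positive or negative -/
  root_pos_or_neg : ∀ β ∈ toSimpleRootData.realRoots,
    β ∈ toSimpleRootData.posCone ∨ -β ∈ toSimpleRootData.posCone
  /-- `w(αᵢ)` is positive if and only if `ℓ(w rᵢ) > ℓ(w)` -/
  root_pos_iff : ∀ (w : toSimpleRootData.weyl) (i : I),
    SimpleRootData.act (w : V ≃ₗ[ℝ] V) (root i) ∈ toSimpleRootData.posCone ↔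
      cox.length w < cox.length (w * cox.simple i)
  /-- `Φ ∩ ℝ⁺ β = {β}` -/
  root_reduced : ∀ β ∈ toSimpleRootData.realRoots, ∀ c : ℝ, 0 < c →
    c • β ∈ toSimpleRootData.realRoots → c = 1
  /-- the set of imaginary roots -/
  imRoots : Set (Dual ℝ V)
  imRoots_ne_zero : ∀ δ ∈ imRoots, δ ≠ 0
  imRoots_ne_smul : ∀ δ ∈ imRoots, ∀ β ∈ toSimpleRootData.realRoots, ∀ c : ℝ, δ ≠ c • β
  imRoots_neg : ∀ δ ∈ imRoots, -δ ∈ imRoots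
  imRoots_pos_or_neg : ∀ δ ∈ imRoots,
    δ ∈ toSimpleRootData.posCone ∨ -δ ∈ toSimpleRootData.posCone
  imRoots_act : ∀ δ ∈ imRoots, δ ∈ toSimpleRootData.posCone → ∀ w ∈ toSimpleRootData.weyl,
    SimpleRootData.act w δ ∈ imRoots ∧ SimpleRootData.act w δ ∈ toSimpleRootData.posCone

/-! ### The model apartment -/

section Affine

variable {V P : Type*} [NormedAddCommGroup V] [NormedSpace ℝ V] [MetricSpace P]
  [NormedAddTorsor V P]

/-- The hyperplane of direction `ker β` through `p` (for `β ≠ 0`). -/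
def wall (β : Dual ℝ V) (p : P) : Set P := {x | β (x -ᵥ p) = 0}

/-- The closed half-space where `β ≥ β(p)`. -/
def half (β : Dual ℝ V) (p : P) : Set P := {x | 0 ≤ β (x -ᵥ p)}

/-- The open half-space where `β > β(p)`. -/
def openHalf (β : Dual ℝ V) (p : P) : Set P := {x | 0 < β (x -ᵥ p)}

/-- The reflections `r_M` for `M` in a given set of walls: if `M` has direction `ker (w αᵢ)`, the
linear part of `r_M` is `w rᵢ w⁻¹`, and `r_M` fixes the points of `M`. -/
def wallReflections {I : Type*} (d : SimpleRootData I V) (walls : Set (Set P)) :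
    Set (P ≃ᵃ[ℝ] P) :=
  {s | ∃ w ∈ d.weyl, ∃ i, ∃ p : P, wall (SimpleRootData.act w (d.root i)) p ∈ walls ∧
    s.linear = w * d.refl i * w⁻¹ ∧ s p = p}

/-- The model apartment: an affine space `P` under `V` with a set of (real) walls.
The norm of `V` is only used through the topology, which does not depend on it. -/
structure Model (I V P : Type*) [Fintype I] [NormedAddCommGroup V] [NormedSpace ℝ V]
    [MetricSpace P] [NormedAddTorsor V P] extends VectorialData I V where
  walls : Set (Set P)
  exists_root_of_wall : ∀ M ∈ walls, ∃ β ∈ toSimpleRootData.realRoots, ∃ p : P, M = wall β p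
  infinite_walls : ∀ β ∈ toSimpleRootData.realRoots,
    {M ∈ walls | ∃ p : P, M = wall β p}.Infinite
  image_wall : ∀ s ∈ wallReflections toSimpleRootData walls, ∀ M ∈ walls, s '' M ∈ walls

/-- The germ at `x` of the set `Ω`. -/
def germ (x : P) (Ω : Set P) : Filter P := 𝓝[Ω] x

/-- The closure of a filter: the filter generated by the closures of its elements. -/
def adherence (F : Filter P) : Filter P := F.lift' closure

/-- The smallest affine subspace containing (i.e. belonging to) the filter. -/
def support (F : Filter P) : AffineSubspace ℝ P := sInf {E | (E : Set P) ∈ F}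

/-- The sum `F + S` of a filter of subsets of `P` and of a set of vectors. -/
def addSet (F : Filter P) (S : Set V) : Filter P := Filter.map₂ (fun x v => v +ᵥ x) F (𝓟 S)

theorem half_total (β : Dual ℝ V) (p q : P) :
    half β p ⊆ openHalf β q ∨ half β q ⊆ half β p := by
  by_cases h : 0 < β (p -ᵥ q)
  · left
    intro x hx
    have e : β (x -ᵥ q) = β (x -ᵥ p) + β (p -ᵥ q) := by rw [← map_add, vsub_add_vsub_cancel]
    simp only [half, openHalf, mem_ofPred_eq] at *
    linarith
  · right
    intro x hx
    have e : β (x -ᵥ p) = β (x -ᵥ q) - β (p -ᵥ q) := by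
      rw [← map_sub, vsub_sub_vsub_cancel_right]
    simp only [half, mem_ofPred_eq] at *
    linarith

theorem openHalf_total (β : Dual ℝ V) (p q : P) :
    openHalf β p ⊆ openHalf β q ∨ openHalf β q ⊆ openHalf β p := by
  by_cases h : 0 ≤ β (p -ᵥ q)
  · left
    intro x hx
    have e : β (x -ᵥ q) = β (x -ᵥ p) + β (p -ᵥ q) := by rw [← map_add, vsub_add_vsub_cancel]
    simp only [openHalf, mem_ofPred_eq] at *
    linarith
  · right
    intro x hx
    have e : β (x -ᵥ p) = β (x -ᵥ q) - β (p -ᵥ q) := by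
      rw [← map_sub, vsub_sub_vsub_cancel_right]
    simp only [openHalf, mem_ofPred_eq] at *
    linarith

theorem openHalf_subset_half (β : Dual ℝ V) (p : P) : openHalf β p ⊆ half β p := by
  intro x hx
  simp only [openHalf, half, mem_ofPred_eq] at *
  exact hx.le

end Affine

namespace Model

variable {I V P : Type*} [Fintype I] [NormedAddCommGroup V] [NormedSpace ℝ V]
  [MetricSpace P] [NormedAddTorsor V P] (𝔸 : Model I V P)

/-- The affine Weyl group `W`. -/
def affineWeyl : Subgroup (P ≃ᵃ[ℝ] P) :=
  Subgroup.closure (wallReflections 𝔸.toSimpleRootData 𝔸.walls)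

/-- All roots, real and imaginary. -/
def allRoots : Set (Dual ℝ V) := 𝔸.realRoots ∪ 𝔸.imRoots

/-- The hyperplane `wall β p` is a real wall or an imaginary wall. All hyperplanes whose direction
is the kernel of an imaginary root are imaginary walls. -/
def IsTrueAt (β : Dual ℝ V) (p : P) : Prop := β ∈ 𝔸.realRoots → wall β p ∈ 𝔸.walls

/-- The sets `D(β, k)` with `k ∈ Γ_β ∪ {∞}`. -/
def IsClosedPart (β : Dual ℝ V) (S : Set P) : Prop :=
  S = univ ∨ ∃ p, 𝔸.IsTrueAt β p ∧ S = half β p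

/-- The sets `D(β, k)` or `D°(β, k)` with `k ∈ Γ_β ∪ {∞}`. -/
def IsPart (β : Dual ℝ V) (S : Set P) : Prop :=
  S = univ ∨ ∃ p, 𝔸.IsTrueAt β p ∧ (S = half β p ∨ S = openHalf β p)

/-- The intersections `⋂_β D(β, k_β)`, with a single `k_β` for each root `β`. -/
def IsEnclosed (T : Set P) : Prop :=
  ∃ D : Dual ℝ V → Set P, (∀ β ∈ 𝔸.allRoots, 𝔸.IsClosedPart β (D β)) ∧ T = ⋂ β ∈ 𝔸.allRoots, D β

/-- The intersections of half-spaces `D(β, k_β)` or `D°(β, k_β)`, one for each root `β`. -/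
def IsSemiEnclosed (T : Set P) : Prop :=
  ∃ D : Dual ℝ V → Set P, (∀ β ∈ 𝔸.allRoots, 𝔸.IsPart β (D β)) ∧ T = ⋂ β ∈ 𝔸.allRoots, D β

variable {𝔸}

theorem IsClosedPart.inter {β : Dual ℝ V} {S T : Set P} (hS : 𝔸.IsClosedPart β S)
    (hT : 𝔸.IsClosedPart β T) : 𝔸.IsClosedPart β (S ∩ T) := by
  have key : S ⊆ T ∨ T ⊆ S := by
    rcases hS with rfl | ⟨p, -, rfl⟩
    · exact Or.inr (subset_univ _)
    rcases hT with rfl | ⟨q, -, rfl⟩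
    · exact Or.inl (subset_univ _)
    exact (half_total β p q).imp_left fun h => h.trans (openHalf_subset_half β q)
  rcases key with h | h
  · rwa [inter_eq_left.2 h]
  · rwa [inter_eq_right.2 h]

theorem IsPart.inter {β : Dual ℝ V} {S T : Set P} (hS : 𝔸.IsPart β S)
    (hT : 𝔸.IsPart β T) : 𝔸.IsPart β (S ∩ T) := by
  have key : S ⊆ T ∨ T ⊆ S := by
    rcases hS with rfl | ⟨p, -, hS⟩
    · exact Or.inr (subset_univ _)
    rcases hT with rfl | ⟨q, -, hT⟩
    · exact Or.inl (subset_univ _)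
    rcases hS with rfl | rfl <;> rcases hT with rfl | rfl
    · exact (half_total β p q).imp_left fun h => h.trans (openHalf_subset_half β q)
    · exact (half_total β p q).imp_right fun h => (openHalf_subset_half β q).trans h
    · exact ((half_total β q p).imp_right fun h => (openHalf_subset_half β p).trans h).symm
    · exact openHalf_total β p q
  rcases key with h | h
  · rwa [inter_eq_left.2 h]
  · rwa [inter_eq_right.2 h]

theorem IsEnclosed.inter {S T : Set P} (hS : 𝔸.IsEnclosed S) (hT : 𝔸.IsEnclosed T) :
    𝔸.IsEnclosed (S ∩ T) := by
  obtain ⟨D, hD, rfl⟩ := hS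
  obtain ⟨E, hE, rfl⟩ := hT
  exact ⟨fun β => D β ∩ E β, fun β hβ => (hD β hβ).inter (hE β hβ), by
    simp only [iInter_inter_distrib]⟩

theorem IsSemiEnclosed.inter {S T : Set P} (hS : 𝔸.IsSemiEnclosed S)
    (hT : 𝔸.IsSemiEnclosed T) : 𝔸.IsSemiEnclosed (S ∩ T) := by
  obtain ⟨D, hD, rfl⟩ := hS
  obtain ⟨E, hE, rfl⟩ := hT
  exact ⟨fun β => D β ∩ E β, fun β hβ => (hD β hβ).inter (hE β hβ), by
    simp only [iInter_inter_distrib]⟩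

theorem isEnclosed_univ : 𝔸.IsEnclosed (univ : Set P) :=
  ⟨fun _ => univ, fun _ _ => Or.inl rfl, by simp⟩

theorem isSemiEnclosed_univ : 𝔸.IsSemiEnclosed (univ : Set P) :=
  ⟨fun _ => univ, fun _ _ => Or.inl rfl, by simp⟩

variable (𝔸)

/-- The enclosure `cl(F)` of a filter: the sets containing an element of `F` of the form
`⋂_β D(β, k_β)`. -/
def cl (F : Filter P) : Filter P where
  sets := {S | ∃ T, 𝔸.IsEnclosed T ∧ T ∈ F ∧ T ⊆ S}
  univ_sets := ⟨univ, isEnclosed_univ, univ_mem, subset_univ _⟩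
  sets_of_superset := fun ⟨T, h1, h2, h3⟩ h => ⟨T, h1, h2, h3.trans h⟩
  inter_sets := fun ⟨T, h1, h2, h3⟩ ⟨T', h1', h2', h3'⟩ =>
    ⟨T ∩ T', h1.inter h1', inter_mem h2 h2', inter_subset_inter h3 h3'⟩

/-- The local facet `F^ℓ(x, F^v)`. -/
def localFacet (x : P) (S : Set V) : Filter P := germ x ((fun v => v +ᵥ x) '' S)

/-- The facet `F(x, F^v)`. -/
def facet (x : P) (S : Set V) : Filter P where
  sets := {U | ∃ T, 𝔸.IsSemiEnclosed T ∧ T ∈ localFacet x S ∧ T ⊆ U}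
  univ_sets := ⟨univ, isSemiEnclosed_univ, univ_mem, subset_univ _⟩
  sets_of_superset := fun ⟨T, h1, h2, h3⟩ h => ⟨T, h1, h2, h3.trans h⟩
  inter_sets := fun ⟨T, h1, h2, h3⟩ ⟨T', h1', h2', h3'⟩ =>
    ⟨T ∩ T', h1.inter h1', inter_mem h2 h2', inter_subset_inter h3 h3'⟩

/-- Facets of the model apartment. -/
def IsFacet (F : Filter P) : Prop := ∃ x S, 𝔸.IsVFacet S ∧ F = 𝔸.facet x S

/-- Chambers of the model apartment. -/
def IsChamber (F : Filter P) : Prop := ∃ x S, 𝔸.IsVChamber S ∧ F = 𝔸.facet x S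

/-- Panels of the model apartment: facets `F(x, F^v)` with `F^v` a vectorial panel and `x` on a
wall whose direction is the support of `F^v`. -/
def IsPanel (F : Filter P) : Prop :=
  ∃ (x : P) (S : Set V), 𝔸.IsVPanel S ∧
    (∃ β ∈ 𝔸.realRoots, wall β x ∈ 𝔸.walls ∧ Submodule.span ℝ S = LinearMap.ker β) ∧
    F = 𝔸.facet x S

/-- The chimney `cl(F + F^v)`. -/
def chimney (F : Filter P) (S : Set V) : Filter P := 𝔸.cl (addSet F S)

/-- The germ of the chimney `cl(F + F^v)`: the sets containing one of the shortened chimneys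
`cl(F + ξ + F^v)`, for `ξ` in the closure of `F^v` (they form a directed family). -/
def chimneyGerm (F : Filter P) (S : Set V) : Filter P :=
  ⨅ ξ ∈ closure S, 𝔸.chimney (F.map fun x => ξ +ᵥ x) S

/-- A chimney is solid if the direction of its support has a finite pointwise stabilizer
in `W^v`. -/
def IsSolid (r : Filter P) : Prop :=
  {w : V ≃ₗ[ℝ] V | w ∈ 𝔸.weyl ∧ ∀ v ∈ (support r).direction, w v = v}.Finite

/-- Solid chimneys. -/
def IsSolidChimney (r : Filter P) : Prop :=
  ∃ F S, 𝔸.IsFacet F ∧ 𝔸.IsVFacet S ∧ 𝔸.IsSolid (𝔸.chimney F S) ∧ r = 𝔸.chimney F S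

/-- Germs of solid chimneys. -/
def IsSolidChimneyGerm (R : Filter P) : Prop :=
  ∃ F S, 𝔸.IsFacet F ∧ 𝔸.IsVFacet S ∧ 𝔸.IsSolid (𝔸.chimney F S) ∧ R = 𝔸.chimneyGerm F S

/-- Germs of splayed chimneys (those of spherical direction). -/
def IsSplayedChimneyGerm (R : Filter P) : Prop :=
  ∃ F S, 𝔸.IsFacet F ∧ 𝔸.IsSphericalVFacet S ∧ R = 𝔸.chimneyGerm F S

/-- Germs `]x, y)` at `x` of preordered intervals `]x, y]`. -/
def IsPreorderedIntervalGerm (F : Filter P) : Prop :=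
  ∃ x y : P, x ≠ y ∧ (y -ᵥ x ∈ 𝔸.titsCone ∨ x -ᵥ y ∈ 𝔸.titsCone) ∧
    F = germ x (AffineMap.lineMap x y '' Set.Ioc (0 : ℝ) 1)

/-- Generic half-lines. -/
def IsGenericRay (F : Filter P) : Prop :=
  ∃ (x : P) (v : V), v ≠ 0 ∧ (∃ S, 𝔸.IsSphericalVFacet S ∧ v ∈ S) ∧
    F = 𝓟 ((fun t : ℝ => t • v +ᵥ x) '' Set.Ici 0)

end Model

/-! ### Affine hovels -/

section Hovel

variable {I V P X : Type*} [Fintype I] [NormedAddCommGroup V] [NormedSpace ℝ V]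
  [MetricSpace P] [NormedAddTorsor V P]

/-- A set covered by a set of subsets (apartments), each with a structure of apartment of type `𝔸`:
a set of bijections from the model, which is an orbit of `W`. -/
structure ApartmentSystem (𝔸 : Model I V P) (X : Type*) where
  apartments : Set (Set X)
  isom : Set X → Set (P → X)
  sUnion_apartments : ⋃₀ apartments = univ
  isom_nonempty : ∀ A ∈ apartments, (isom A).Nonempty
  isom_bijOn : ∀ A ∈ apartments, ∀ f ∈ isom A, BijOn f univ A
  isom_iff : ∀ A ∈ apartments, ∀ f₀ ∈ isom A, ∀ f : P → X,
    f ∈ isom A ↔ ∃ w ∈ 𝔸.affineWeyl, f = f₀ ∘ w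

namespace ApartmentSystem

variable {𝔸 : Model I V P} (𝓘 : ApartmentSystem 𝔸 X)

/-- `f` is a chart of the apartment `A`. -/
def IsChart (A : Set X) (f : P → X) : Prop := A ∈ 𝓘.apartments ∧ f ∈ 𝓘.isom A

/-- The restriction of `φ` to `A` is an isomorphism of apartments from `A` onto `A'`. -/
def IsIso (A A' : Set X) (φ : X → X) : Prop :=
  BijOn φ A A' ∧ ∃ f ∈ 𝓘.isom A, φ ∘ f ∈ 𝓘.isom A'

/-- The enclosure of a filter `G` of subsets of `X`, computed in the apartment with chart `f`. -/
def clIn (𝔸 : Model I V P) (f : P → X) (G : Filter X) : Filter X := (𝔸.cl (G.comap f)).map f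

/-- `A ∩ A'` contains the filter `G`, and some isomorphism from `A` onto `A'` fixes `G`, i.e. fixes
pointwise an element of `G`. -/
def IsoFixing (A A' : Set X) (G : Filter X) : Prop :=
  A ∩ A' ∈ G ∧ ∃ φ, 𝓘.IsIso A A' φ ∧ ∃ S ∈ G, ∀ x ∈ S, φ x = x

/-- `G` corresponds, in some apartment, to a filter of the model with the property `p`. -/
def Has (p : Filter P → Prop) (G : Filter X) : Prop :=
  ∃ A f, 𝓘.IsChart A f ∧ ∃ F, p F ∧ G = F.map f

end ApartmentSystem

/-- Affine hovels of type `𝔸`. A subset `A` contains a filter `G` when `A ∈ G`. -/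
structure Hovel (𝔸 : Model I V P) (X : Type*) extends ApartmentSystem 𝔸 X where
  ma2 : ∀ A f, toApartmentSystem.IsChart A f → ∀ A' ∈ apartments, ∀ F : Filter P,
    ((∃ x, F = pure x) ∨ 𝔸.IsPreorderedIntervalGerm F ∨ 𝔸.IsGenericRay F ∨
      𝔸.IsSolidChimney F) →
    A' ∈ F.map f → toApartmentSystem.IsoFixing A A' (ApartmentSystem.clIn 𝔸 f (F.map f))
  ma3 : ∀ R F : Filter X, toApartmentSystem.Has 𝔸.IsSplayedChimneyGerm R →
    (toApartmentSystem.Has 𝔸.IsFacet F ∨ toApartmentSystem.Has 𝔸.IsSolidChimneyGerm F) →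
    ∃ A ∈ apartments, A ∈ R ∧ A ∈ F
  ma4 : ∀ R F : Filter X, toApartmentSystem.Has 𝔸.IsSplayedChimneyGerm R →
    (toApartmentSystem.Has 𝔸.IsFacet F ∨ toApartmentSystem.Has 𝔸.IsSolidChimneyGerm F) →
    ∀ A f, toApartmentSystem.IsChart A f → ∀ A' ∈ apartments,
    A ∈ R → A ∈ F → A' ∈ R → A' ∈ F →
    toApartmentSystem.IsoFixing A A' (ApartmentSystem.clIn 𝔸 f (R ⊔ F))

namespace Hovel

variable {𝔸 : Model I V P} (𝓘 : Hovel 𝔸 X)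

/-- `D` is a half-apartment of the hovel and `M` is its wall. -/
def IsHalfApartment (D M : Set X) : Prop :=
  ∃ A f, 𝓘.IsChart A f ∧ ∃ β ∈ 𝔸.realRoots, ∃ p : P, wall β p ∈ 𝔸.walls ∧
    D = f '' half β p ∧ M = f '' wall β p

/-- Chambers of the hovel. -/
def IsChamber (C : Filter X) : Prop := 𝓘.Has 𝔸.IsChamber C

/-- Panels of the hovel. -/
def IsPanel (F : Filter X) : Prop := 𝓘.Has 𝔸.IsPanel F

/-- The facet `C` dominates the facet `F`: in some apartment containing both, `F` is contained in
the closure of `C`. -/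
def Dominates (C F : Filter X) : Prop :=
  ∃ A f, 𝓘.IsChart A f ∧ ∃ C₀ F₀, 𝔸.IsFacet C₀ ∧ 𝔸.IsFacet F₀ ∧
    C = C₀.map f ∧ F = F₀.map f ∧ F₀ ≤ adherence C₀

/-- The hovel is thick: every panel is dominated by at least three chambers. -/
def IsThick : Prop :=
  ∀ F, 𝓘.IsPanel F → 3 ≤ {C | 𝓘.IsChamber C ∧ 𝓘.Dominates C F}.encard

end Hovel

end Hovel

end AffineHovel

/-!
In a chart, a panel spans the kernel of a real root `β`, and its two sides are the chambers just
above and just below it. All three parts extend a partial chart by prescribing an apartment through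
two germs (MA3) and comparing it with the given charts (MA4): enclosed sets containing germs of
chimneys directed by a panel and by a chamber are large enough to contain a whole half-space.

For part 1, an apartment containing the chamber `C` and the splayed germ at the panel sees `C` as
one of the two sides of its panel; an apartment containing the splayed germ based on that side and a
chamber germ deep inside the half-apartment `D` then contains both `D` and `C`.

For part 2, fix charts `f` and `f₁` agreeing on the wall. The levels up to which a chart can follow
`f` beyond the wall while extending `f₁` are unbounded: part 1 pushes the level past any wall, and
an apartment containing a chimney germ just below the supremum of the levels reaches that supremum.
Finally an apartment containing germs deep inside both half-apartments can be used at all levels.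

For part 3, part 1 gives an apartment containing `D` and a chamber which is not one of the two
chambers along a panel of the wall in the given apartment. If these apartments met outside `D`, they
would agree near that panel on both sides of the wall, and the new chamber would be one of the two.
-/

namespace AffineHovel

theorem exists_forall_dual_apply_eq {K V ι : Type*} [Field K] [AddCommGroup V] [Module K V]
    [Finite ι] {α : ι → Dual K V} (hα : LinearIndependent K α) (c : ι → K) :
    ∃ v, ∀ i, α i v = c i := by
  classical
  cases nonempty_fintype ι
  suffices hrange : LinearMap.range (LinearMap.pi α) = ⊤ by
    obtain ⟨v, hv⟩ := LinearMap.range_eq_top.1 hrange c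
    exact ⟨v, congrFun hv⟩
  by_contra hne
  obtain ⟨φ, hφ, hle⟩ := Submodule.exists_le_ker_of_lt_top _ (lt_top_iff_ne_top.2 hne)
  have hcomb : ∑ i, φ (fun j => if i = j then 1 else 0) • α i = 0 := by
    ext v
    have hv : φ (LinearMap.pi α v) = 0 := hle ⟨v, rfl⟩
    rw [LinearMap.pi_apply_eq_sum_univ φ] at hv
    simpa [mul_comm] using hv
  refine hφ (LinearMap.ext fun x => ?_)
  rw [LinearMap.pi_apply_eq_sum_univ φ]
  simp [Fintype.linearIndependent_iff.1 hα _ hcomb]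

namespace SimpleRootData

section Algebra

variable {I V : Type*} [AddCommGroup V] [Module ℝ V] {d : SimpleRootData I V}

/-! ### The vectorial Weyl group and its real roots -/

theorem act_apply (w : V ≃ₗ[ℝ] V) (α : Dual ℝ V) (v : V) : act w α v = α (w⁻¹ v) := rfl

@[simp]
theorem act_apply_apply (w : V ≃ₗ[ℝ] V) (α : Dual ℝ V) (v : V) : act w α (w v) = α v :=
  congrArg α (w.symm_apply_apply v)

theorem act_mul (u w : V ≃ₗ[ℝ] V) (α : Dual ℝ V) : act (u * w) α = act u (act w α) := by
  ext v; simp [act_apply, mul_inv_rev]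

@[simp]
theorem act_one (α : Dual ℝ V) : act (1 : V ≃ₗ[ℝ] V) α = α := by
  ext v; simp [act_apply]

@[simp]
theorem act_neg (w : V ≃ₗ[ℝ] V) (α : Dual ℝ V) : act w (-α) = -act w α := rfl

theorem act_ne_zero (w : V ≃ₗ[ℝ] V) {α : Dual ℝ V} (hα : α ≠ 0) : act w α ≠ 0 := fun h =>
  hα (LinearMap.ext fun v => by rw [← act_apply_apply w, h]; rfl)

theorem refl_apply (i : I) (v : V) : d.refl i v = v - d.root i v • d.coroot i :=
  Module.reflection_apply _ _

theorem refl_apply_of_root_eq_zero {i : I} {v : V} (h : d.root i v = 0) : d.refl i v = v := by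
  rw [refl_apply, h, zero_smul, sub_zero]

theorem refl_inv (i : I) : (d.refl i)⁻¹ = d.refl i := Module.reflection_inv _

theorem refl_mul_self (i : I) : d.refl i * d.refl i = 1 :=
  (congrArg (d.refl i * ·) (refl_inv i).symm).trans (mul_inv_cancel _)

theorem root_refl_self (i : I) (v : V) : d.root i (d.refl i v) = -d.root i v := by
  rw [refl_apply, map_sub, map_smul, d.root_coroot_two, smul_eq_mul]
  ring

theorem act_refl (i : I) (α : Dual ℝ V) :
    act (d.refl i) α = α - α (d.coroot i) • d.root i := by
  ext v
  simp only [act_apply, refl_inv, refl_apply, map_sub, map_smul, smul_eq_mul,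
    LinearMap.sub_apply, LinearMap.smul_apply]
  ring

theorem act_refl_root (i : I) : act (d.refl i) (d.root i) = -d.root i := by
  rw [act_refl, d.root_coroot_two]
  module

theorem root_half_smul_coroot (i : I) (r : ℝ) : d.root i ((r / 2) • d.coroot i) = r := by
  rw [map_smul, d.root_coroot_two, smul_eq_mul, div_mul_cancel₀ r two_ne_zero]

theorem refl_mem_weyl (i : I) : d.refl i ∈ d.weyl := Subgroup.subset_closure ⟨i, rfl⟩

theorem root_mem_realRoots (i : I) : d.root i ∈ d.realRoots :=
  ⟨1, one_mem _, i, (act_one _).symm⟩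

theorem act_mem_realRoots {w : V ≃ₗ[ℝ] V} (hw : w ∈ d.weyl) {α : Dual ℝ V}
    (hα : α ∈ d.realRoots) : act w α ∈ d.realRoots := by
  obtain ⟨u, hu, i, rfl⟩ := hα
  exact ⟨w * u, mul_mem hw hu, i, (act_mul _ _ _).symm⟩

theorem neg_mem_realRoots {α : Dual ℝ V} (hα : α ∈ d.realRoots) : -α ∈ d.realRoots := by
  obtain ⟨u, hu, i, rfl⟩ := hα
  exact ⟨u * d.refl i, mul_mem hu (refl_mem_weyl i), i, by rw [act_mul, act_refl_root, act_neg]⟩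

theorem ne_zero_of_mem_realRoots {α : Dual ℝ V} (hα : α ∈ d.realRoots) : α ≠ 0 := by
  obtain ⟨u, -, i, rfl⟩ := hα
  exact act_ne_zero u (d.linearIndependent_root.ne_zero i)

/-! ### Vectorial facets -/

variable (d) in
/-- The group `{± w | w ∈ W^v}`. It acts transitively on the vectorial facets of a given type,
both signs together. -/
noncomputable def signedWeyl : Subgroup (V ≃ₗ[ℝ] V) where
  carrier := {σ | σ ∈ d.weyl ∨ LinearEquiv.neg ℝ * σ ∈ d.weyl}
  one_mem' := Or.inl (one_mem _)
  inv_mem' := by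
    rintro σ (hσ | hσ)
    · exact Or.inl (inv_mem hσ)
    · right
      convert inv_mem hσ using 1
      rw [mul_inv_rev]
      ext v
      exact (map_neg (σ⁻¹) v).symm
  mul_mem' := by
    rintro σ τ (hσ | hσ) (hτ | hτ)
    · exact Or.inl (mul_mem hσ hτ)
    · right
      convert mul_mem hσ hτ using 1
      ext v; simp
    · right
      rw [← mul_assoc]
      exact mul_mem hσ hτ
    · left
      convert mul_mem hσ hτ using 1
      ext v; simp

theorem weyl_le_signedWeyl : d.weyl ≤ d.signedWeyl := fun _ => Or.inl

theorem neg_mem_signedWeyl : LinearEquiv.neg ℝ ∈ d.signedWeyl := by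
  right
  convert one_mem d.weyl using 1
  ext v; simp

theorem conj_mem_weyl {σ u : V ≃ₗ[ℝ] V} (hσ : σ ∈ d.signedWeyl) (hu : u ∈ d.weyl) :
    σ * u * σ⁻¹ ∈ d.weyl := by
  rcases hσ with hσ | hσ
  · exact mul_mem (mul_mem hσ hu) (inv_mem hσ)
  · convert mul_mem (mul_mem hσ hu) (inv_mem hσ) using 1
    rw [mul_inv_rev]
    ext v
    change σ (u (σ⁻¹ v)) = -σ (u (σ⁻¹ (-v)))
    simp

theorem act_mem_of_mem_signedWeyl {R : Set (Dual ℝ V)} (hneg : ∀ α ∈ R, -α ∈ R)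
    (hact : ∀ w ∈ d.weyl, ∀ α ∈ R, act w α ∈ R) {σ : V ≃ₗ[ℝ] V} (hσ : σ ∈ d.signedWeyl)
    {α : Dual ℝ V} (hα : α ∈ R) : act σ α ∈ R := by
  rcases hσ with hσ | hσ
  · exact hact σ hσ α hα
  · convert hneg _ (hact _ hσ α hα) using 1
    ext v
    change α (σ⁻¹ v) = -α (σ⁻¹ (-v))
    simp

theorem isVFacetOfType_iff {J : Set I} {S : Set V} :
    d.IsVFacetOfType J S ↔ ∃ σ ∈ d.signedWeyl, S = σ ⁻¹' d.stdFacet J := by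
  have himage (w : V ≃ₗ[ℝ] V) : w '' d.stdFacet J = (w⁻¹ : V ≃ₗ[ℝ] V) ⁻¹' d.stdFacet J :=
    LinearEquiv.image_eq_preimage_symm w _
  have hneg (w : V ≃ₗ[ℝ] V) : (fun v => -(w v)) '' d.stdFacet J =
      ((LinearEquiv.neg ℝ * w : V ≃ₗ[ℝ] V)⁻¹ : V ≃ₗ[ℝ] V) ⁻¹' d.stdFacet J :=
    LinearEquiv.image_eq_preimage_symm (LinearEquiv.neg ℝ * w) _
  constructor
  · rintro ⟨w, hw, rfl | rfl⟩
    · exact ⟨w⁻¹, inv_mem (weyl_le_signedWeyl hw), himage w⟩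
    · exact ⟨_, inv_mem (mul_mem neg_mem_signedWeyl (weyl_le_signedWeyl hw)), hneg w⟩
  · rintro ⟨σ, hσ | hσ, rfl⟩
    · exact ⟨σ⁻¹, inv_mem hσ, Or.inl (by rw [himage, inv_inv])⟩
    · refine ⟨_, inv_mem hσ, Or.inr ?_⟩
      rw [hneg]
      congr 2
      ext v
      simp [mul_inv_rev]

theorem IsVFacetOfType.neg {J : Set I} {S : Set V} (h : d.IsVFacetOfType J S) :
    d.IsVFacetOfType J (Neg.neg ⁻¹' S) := by
  obtain ⟨σ, hσ, rfl⟩ := isVFacetOfType_iff.1 h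
  exact isVFacetOfType_iff.2 ⟨_, mul_mem hσ neg_mem_signedWeyl, rfl⟩

theorem IsVFacetOfType.image {J : Set I} {S : Set V} (h : d.IsVFacetOfType J S)
    {w : V ≃ₗ[ℝ] V} (hw : w ∈ d.weyl) : d.IsVFacetOfType J (w '' S) := by
  obtain ⟨σ, hσ, rfl⟩ := isVFacetOfType_iff.1 h
  refine isVFacetOfType_iff.2 ⟨_, mul_mem hσ (inv_mem (weyl_le_signedWeyl hw)), ?_⟩
  rw [LinearEquiv.image_eq_preimage_symm]
  rfl

theorem root_nonneg_of_mem_stdFacet {J : Set I} {v : V} (hv : v ∈ d.stdFacet J) (i : I) :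
    0 ≤ d.root i v := by
  by_cases hi : i ∈ J
  · exact (hv.1 i hi).ge
  · exact (hv.2 i hi).le

theorem smul_mem_stdFacet {J : Set I} {v : V} (hv : v ∈ d.stdFacet J) {t : ℝ} (ht : 0 < t) :
    t • v ∈ d.stdFacet J :=
  ⟨fun i hi => by simp [hv.1 i hi], fun i hi => by simpa using mul_pos ht (hv.2 i hi)⟩

theorem refl_apply_of_mem_stdFacet {i : I} {v : V} (hv : v ∈ d.stdFacet {i}) :
    d.refl i v = v := refl_apply_of_root_eq_zero (hv.1 i rfl)

theorem preimage_refl_stdFacet (i : I) : d.refl i ⁻¹' d.stdFacet {i} = d.stdFacet {i} := by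
  ext v
  refine ⟨fun hv => ?_, fun hv => ?_⟩
  · have hfix := refl_apply_of_mem_stdFacet hv
    rwa [← (d.refl i).injective hfix]
  · rwa [mem_preimage, refl_apply_of_mem_stdFacet hv]

theorem isVFacet_stdFacet (J : Set I) : d.IsVFacet (d.stdFacet J) :=
  ⟨J, 1, one_mem _, Or.inl (by simp)⟩

theorem IsVFacet.smul_mem {S : Set V} (hS : d.IsVFacet S) {v : V} (hv : v ∈ S) {t : ℝ}
    (ht : 0 < t) : t • v ∈ S := by
  obtain ⟨J, hJ⟩ := hS
  obtain ⟨σ, -, rfl⟩ := isVFacetOfType_iff.1 hJ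
  simpa using smul_mem_stdFacet hv ht

theorem IsVFacet.neg {S : Set V} (hS : d.IsVFacet S) : d.IsVFacet (Neg.neg ⁻¹' S) :=
  hS.imp fun _ h => h.neg

theorem IsVChamber.isVFacet {Q : Set V} (hQ : d.IsVChamber Q) : d.IsVFacet Q := ⟨∅, hQ⟩

theorem IsVPanel.isVFacet {S : Set V} (hS : d.IsVPanel S) : d.IsVFacet S :=
  hS.elim fun i h => ⟨{i}, h⟩

theorem IsVChamber.isSphericalVFacet {Q : Set V} (hQ : d.IsVChamber Q) :
    d.IsSphericalVFacet Q :=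
  ⟨∅, by simp, hQ⟩

theorem IsVPanel.isSphericalVFacet {S : Set V} (hS : d.IsVPanel S) : d.IsSphericalVFacet S := by
  obtain ⟨i, hi⟩ := hS
  refine ⟨{i}, (Set.toFinite {1, d.refl i}).subset fun u hu => ?_, hi⟩
  rw [SetLike.mem_coe, image_singleton, Subgroup.mem_closure_singleton] at hu
  obtain ⟨n, rfl⟩ := hu
  have hsq : d.refl i ^ (2 : ℤ) = 1 := by rw [zpow_ofNat, pow_two, refl_mul_self]
  rcases Int.even_or_odd' n with ⟨k, rfl | rfl⟩
  · exact Or.inl (by rw [zpow_mul, hsq, one_zpow])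
  · exact Or.inr (by rw [zpow_add, zpow_mul, hsq, one_zpow, one_mul, zpow_one]; rfl)

section Finite

variable [Finite I]

theorem stdFacet_nonempty (J : Set I) : (d.stdFacet J).Nonempty := by
  classical
  obtain ⟨v, hv⟩ := exists_forall_dual_apply_eq d.linearIndependent_root
    fun i => if i ∈ J then 0 else 1
  exact ⟨v, fun i hi => by simp [hv, hi], fun i hi => by simp [hv, hi]⟩

theorem IsVFacet.nonempty {S : Set V} (hS : d.IsVFacet S) : S.Nonempty := by
  obtain ⟨J, hJ⟩ := hS
  obtain ⟨σ, -, rfl⟩ := isVFacetOfType_iff.1 hJ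
  exact (stdFacet_nonempty J).preimage σ.surjective

end Finite

section PosCone

variable [Fintype I] {γ : Dual ℝ V} {v : V}

theorem nonneg_of_mem_posCone (hγ : γ ∈ d.posCone) (hv : ∀ i, 0 ≤ d.root i v) : 0 ≤ γ v := by
  obtain ⟨c, hc, rfl⟩ := hγ
  simp only [LinearMap.sum_apply, LinearMap.smul_apply, smul_eq_mul]
  exact Finset.sum_nonneg fun i _ => mul_nonneg (hc i) (hv i)

theorem neg_notMem_posCone (hv : ∀ i, 0 ≤ d.root i v) (hpos : 0 < γ v) : -γ ∉ d.posCone :=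
  fun h => (neg_neg_of_pos hpos).not_ge (nonneg_of_mem_posCone h hv)

theorem pos_of_mem_posCone (hγ : γ ∈ d.posCone) (h0 : γ ≠ 0) (hv : v ∈ d.stdFacet ∅) :
    0 < γ v := by
  obtain ⟨c, hc, rfl⟩ := hγ
  have hroot : ∀ i, 0 < d.root i v := fun i => hv.2 i (notMem_empty i)
  obtain ⟨j, hj⟩ : ∃ j, c j ≠ 0 := by
    by_contra! hzero
    exact h0 (by simp [hzero])
  simp only [LinearMap.sum_apply, LinearMap.smul_apply, smul_eq_mul]
  exact Finset.sum_pos' (fun i _ => mul_nonneg (hc i) (hroot i).le)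
    ⟨j, Finset.mem_univ j, mul_pos ((hc j).lt_of_ne' hj) (hroot j)⟩

theorem eq_smul_root_or_pos_of_mem_posCone (hγ : γ ∈ d.posCone) (i : I) :
    (∃ c : ℝ, 0 ≤ c ∧ γ = c • d.root i) ∨ ∀ v ∈ d.stdFacet {i}, 0 < γ v := by
  obtain ⟨c, hc, rfl⟩ := hγ
  by_cases h : ∃ j, j ≠ i ∧ 0 < c j
  · obtain ⟨j, hji, hj⟩ := h
    refine Or.inr fun v hv => ?_
    simp only [LinearMap.sum_apply, LinearMap.smul_apply, smul_eq_mul]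
    exact Finset.sum_pos' (fun k _ => mul_nonneg (hc k) (root_nonneg_of_mem_stdFacet hv k))
      ⟨j, Finset.mem_univ _, mul_pos hj (hv.2 j (by simpa using hji))⟩
  · push Not at h
    refine Or.inl ⟨c i, hc i, Finset.sum_eq_single i (fun j _ hj => ?_) (by simp)⟩
    rw [le_antisymm (h j hj) (hc j), zero_smul]

end PosCone

end Algebra

end SimpleRootData

namespace VectorialData

open SimpleRootData

variable {I V : Type*} [Fintype I] [AddCommGroup V] [Module ℝ V] {D : VectorialData I V}

/-! ### Signs of roots on vectorial facets -/

variable (D) in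
/-- The set `Δ = Φ ∪ Δ_im` of all roots, real or imaginary. -/
def roots : Set (Dual ℝ V) := D.realRoots ∪ D.imRoots

theorem ne_zero_of_mem_roots {α : Dual ℝ V} (hα : α ∈ D.roots) : α ≠ 0 :=
  hα.elim ne_zero_of_mem_realRoots (D.imRoots_ne_zero α)

theorem neg_mem_roots {α : Dual ℝ V} (hα : α ∈ D.roots) : -α ∈ D.roots :=
  hα.imp neg_mem_realRoots (D.imRoots_neg α)

theorem act_mem_imRoots {w : V ≃ₗ[ℝ] V} (hw : w ∈ D.weyl) {δ : Dual ℝ V}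
    (hδ : δ ∈ D.imRoots) : act w δ ∈ D.imRoots := by
  rcases D.imRoots_pos_or_neg δ hδ with hpos | hneg
  · exact (D.imRoots_act δ hδ hpos w hw).1
  · simpa using D.imRoots_neg _ (D.imRoots_act _ (D.imRoots_neg δ hδ) hneg w hw).1

theorem act_mem_roots {σ : V ≃ₗ[ℝ] V} (hσ : σ ∈ D.signedWeyl) {α : Dual ℝ V}
    (hα : α ∈ D.roots) : act σ α ∈ D.roots :=
  act_mem_of_mem_signedWeyl (fun _ => neg_mem_roots)
    (fun _ hw _ => Or.imp (act_mem_realRoots hw) (act_mem_imRoots hw)) hσ hα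

theorem mem_posCone_or_neg_mem_posCone {α : Dual ℝ V} (hα : α ∈ D.roots) :
    α ∈ D.posCone ∨ -α ∈ D.posCone :=
  hα.elim (D.root_pos_or_neg α) (D.imRoots_pos_or_neg α)

theorem eq_root_of_eq_smul_root {α : Dual ℝ V} (hα : α ∈ D.roots) {i : I} {c : ℝ} (hc : 0 ≤ c)
    (h : α = c • D.root i) : α = D.root i := by
  have hc0 : c ≠ 0 := by
    rintro rfl
    exact ne_zero_of_mem_roots hα (by rw [h, zero_smul])
  rcases hα with hα | hα
  · rw [h, D.root_reduced _ (root_mem_realRoots i) c (hc.lt_of_ne' hc0) (h ▸ hα), one_smul]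
  · exact absurd h (D.imRoots_ne_smul α hα _ (root_mem_realRoots i) c)

theorem eq_root_or_pos_or_neg_on_stdFacet {α : Dual ℝ V} (hα : α ∈ D.roots) (i : I) :
    α = D.root i ∨ α = -D.root i ∨
      (∀ v ∈ D.stdFacet {i}, 0 < α v) ∨ ∀ v ∈ D.stdFacet {i}, α v < 0 := by
  rcases mem_posCone_or_neg_mem_posCone hα with h | h <;>
    rcases eq_smul_root_or_pos_of_mem_posCone h i with ⟨c, hc, hmul⟩ | hpos
  · exact Or.inl (eq_root_of_eq_smul_root hα hc hmul)
  · exact Or.inr (Or.inr (Or.inl hpos))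
  · exact Or.inr (Or.inl (neg_eq_iff_eq_neg.1 (eq_root_of_eq_smul_root (neg_mem_roots hα) hc hmul)))
  · exact Or.inr (Or.inr (Or.inr fun v hv => neg_pos.1 (hpos v hv)))

theorem eq_zero_of_mem_stdFacet_univ {α : Dual ℝ V} (hα : α ∈ D.roots) {v : V}
    (hv : v ∈ D.stdFacet univ) : α v = 0 := by
  have hcone : ∀ γ ∈ D.posCone, γ v = 0 := by
    rintro _ ⟨c, -, rfl⟩
    simp [hv.1 _ (mem_univ _)]
  rcases mem_posCone_or_neg_mem_posCone hα with h | h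
  · exact hcone _ h
  · exact neg_eq_zero.1 (hcone _ h)

end VectorialData

namespace SimpleRootData

open VectorialData

variable {I V : Type*} [Fintype I] [AddCommGroup V] [Module ℝ V] {D : VectorialData I V}

theorem IsVFacet.nonneg_or_nonpos {S : Set V}
    (hS : D.IsVFacet S) {α : Dual ℝ V} (hα : α ∈ D.roots) :
    (∀ s ∈ S, 0 ≤ α s) ∨ ∀ s ∈ S, α s ≤ 0 := by
  obtain ⟨J, hJ⟩ := hS
  obtain ⟨σ, hσ, rfl⟩ := isVFacetOfType_iff.1 hJ
  refine (mem_posCone_or_neg_mem_posCone (act_mem_roots hσ hα)).imp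
    (fun h s hs => ?_) (fun h s hs => ?_)
  all_goals have hsign := nonneg_of_mem_posCone h (root_nonneg_of_mem_stdFacet hs)
  · rwa [act_apply_apply] at hsign
  · rwa [LinearMap.neg_apply, act_apply_apply, neg_nonneg] at hsign

theorem IsVChamber.pos_or_neg {Q : Set V}
    (hQ : D.IsVChamber Q) {α : Dual ℝ V} (hα : α ∈ D.roots) :
    (∀ s ∈ Q, 0 < α s) ∨ ∀ s ∈ Q, α s < 0 := by
  obtain ⟨σ, hσ, rfl⟩ := isVFacetOfType_iff.1 hQ
  have hσα := act_mem_roots hσ hα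
  refine (mem_posCone_or_neg_mem_posCone hσα).imp (fun h s hs => ?_) (fun h s hs => ?_)
  · simpa using pos_of_mem_posCone h (ne_zero_of_mem_roots hσα) hs
  · simpa using pos_of_mem_posCone h (neg_ne_zero.2 (ne_zero_of_mem_roots hσα)) hs

end SimpleRootData

namespace VectorialData

open SimpleRootData

variable {I V : Type*} [Fintype I] [AddCommGroup V] [Module ℝ V] {D : VectorialData I V}

/-! ### Stabilizers of vectorial panels -/

theorem eq_one_of_forall_act_root_mem_posCone {u : V ≃ₗ[ℝ] V} (hu : u ∈ D.weyl)
    (h : ∀ j, act u (D.root j) ∈ D.posCone) : u = 1 := by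
  by_contra hne
  have hne' : (⟨u, hu⟩ : D.weyl) ≠ 1 := fun h => hne (congrArg Subtype.val h)
  obtain ⟨j, hdescent⟩ := D.cox.exists_rightDescent_of_ne_one hne'
  have hlength := (D.root_pos_iff ⟨u, hu⟩ j).1 (h j)
  exact hlength.not_gt hdescent

theorem act_root_mem_posCone_of_apply_eq {u : V ≃ₗ[ℝ] V} (hu : u ∈ D.weyl) {J : Set I} {s : V}
    (hs : s ∈ D.stdFacet J) (hfix : u s = s) {j : I} (hj : j ∉ J) :
    act u (D.root j) ∈ D.posCone := by
  have hpos : 0 < act u (D.root j) s := by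
    have h := act_apply_apply u (D.root j) s
    rw [hfix] at h
    exact h ▸ hs.2 j hj
  exact (D.root_pos_or_neg _ (act_mem_realRoots hu (root_mem_realRoots j))).resolve_right
    (neg_notMem_posCone (root_nonneg_of_mem_stdFacet hs) hpos)

theorem eq_one_or_eq_refl_of_forall_apply_eq {u : V ≃ₗ[ℝ] V} (hu : u ∈ D.weyl) {i : I}
    (hfix : ∀ v ∈ D.stdFacet {i}, u v = v) : u = 1 ∨ u = D.refl i := by
  obtain ⟨s, hs⟩ := stdFacet_nonempty (d := D.toSimpleRootData) {i}
  have eq_one {u : V ≃ₗ[ℝ] V} (hu : u ∈ D.weyl) (hus : u s = s)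
      (hi : act u (D.root i) ∈ D.posCone) : u = 1 := by
    refine eq_one_of_forall_act_root_mem_posCone hu fun j => ?_
    obtain rfl | hj := eq_or_ne j i
    · exact hi
    · exact act_root_mem_posCone_of_apply_eq hu hs hus hj
  rcases D.root_pos_or_neg _ (act_mem_realRoots hu (root_mem_realRoots i)) with h | h
  · exact Or.inl (eq_one hu (hfix s hs) h)
  · right
    have hmul : u * D.refl i = 1 := by
      refine eq_one (mul_mem hu (refl_mem_weyl i)) ?_ ?_
      · rw [LinearEquiv.mul_apply, refl_apply_of_mem_stdFacet hs, hfix s hs]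
      · rwa [act_mul, act_refl_root, act_neg]
    rw [eq_inv_of_mul_eq_one_left hmul, refl_inv]

variable (D) in
/-- `S` is a vectorial panel contained in the kernel of the real root `β`. -/
structure IsPanelDir (S : Set V) (β : Dual ℝ V) : Prop where
  panel : D.IsVPanel S
  real : β ∈ D.realRoots
  vanish : ∀ s ∈ S, β s = 0

namespace IsPanelDir

variable {S : Set V} {β : Dual ℝ V}

theorem isVFacet (h : D.IsPanelDir S β) : D.IsVFacet S := h.panel.isVFacet

theorem neg_root (h : D.IsPanelDir S β) : D.IsPanelDir S (-β) :=
  ⟨h.panel, neg_mem_realRoots h.real, fun s hs => by simp [h.vanish s hs]⟩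

theorem neg_dir (h : D.IsPanelDir S β) : D.IsPanelDir (Neg.neg ⁻¹' S) β :=
  ⟨h.panel.imp fun _ h => h.neg, h.real, fun s hs => by simpa using h.vanish _ hs⟩

theorem exists_presentation (h : D.IsPanelDir S β) :
    ∃ σ ∈ D.signedWeyl, ∃ i, S = σ ⁻¹' D.stdFacet {i} ∧ act σ β = D.root i := by
  obtain ⟨i, hi⟩ := h.panel
  obtain ⟨σ, hσ, rfl⟩ := isVFacetOfType_iff.1 hi
  obtain ⟨s, hs⟩ := h.isVFacet.nonempty
  have hzero : act σ β (σ s) = 0 := by rw [act_apply_apply, h.vanish s hs]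
  rcases eq_root_or_pos_or_neg_on_stdFacet (act_mem_roots hσ (Or.inl h.real)) i with
    heq | heq | hpos | hneg
  · exact ⟨σ, hσ, i, rfl, heq⟩
  · refine ⟨D.refl i * σ, mul_mem (weyl_le_signedWeyl (refl_mem_weyl i)) hσ, i, ?_, ?_⟩
    · conv_lhs => rw [← preimage_refl_stdFacet i]
      rfl
    · rw [act_mul, heq, act_neg, act_refl_root, neg_neg]
  · exact absurd hzero (hpos _ hs).ne'
  · exact absurd hzero (hneg _ hs).ne

theorem eq_or_eq_neg_or_pos_or_neg (h : D.IsPanelDir S β) {α : Dual ℝ V} (hα : α ∈ D.roots) :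
    α = β ∨ α = -β ∨ (∀ s ∈ S, 0 < α s) ∨ ∀ s ∈ S, α s < 0 := by
  obtain ⟨σ, hσ, i, rfl, hβ⟩ := h.exists_presentation
  have hinj : ∀ {γ : Dual ℝ V}, act σ α = act σ γ → α = γ := fun hact =>
    LinearMap.ext fun v => by rw [← act_apply_apply σ α, hact, act_apply_apply]
  refine (eq_root_or_pos_or_neg_on_stdFacet (act_mem_roots hσ hα) i).imp (fun heq => ?_)
    (Or.imp (fun heq => ?_) (Or.imp (fun hpos s hs => ?_) (fun hneg s hs => ?_)))
  · exact hinj (heq.trans hβ.symm)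
  · exact hinj (by rw [heq, act_neg, hβ])
  · simpa using hpos _ hs
  · simpa using hneg _ hs

theorem exists_stabilizer (h : D.IsPanelDir S β) : ∃ r : V ≃ₗ[ℝ] V,
    (∀ v, β (r v) = -β v) ∧ ∀ u ∈ D.weyl, (∀ s ∈ S, u s = s) → u = 1 ∨ u = r := by
  obtain ⟨σ, hσ, i, rfl, hβ⟩ := h.exists_presentation
  refine ⟨σ⁻¹ * D.refl i * σ, fun v => ?_, fun u hu hfix => ?_⟩
  · rw [← act_apply_apply σ β v, ← act_apply_apply σ β, hβ, ← root_refl_self,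
      ← LinearEquiv.mul_apply, ← LinearEquiv.mul_apply, mul_assoc, mul_inv_cancel_left]
  · have hconj : ∀ v ∈ D.stdFacet {i}, (σ * u * σ⁻¹) v = v := by
      intro v hv
      have hσv : σ (σ⁻¹ v) = v := σ.apply_symm_apply v
      rw [LinearEquiv.mul_apply, LinearEquiv.mul_apply, hfix _ (by rwa [mem_preimage, hσv]), hσv]
    refine (eq_one_or_eq_refl_of_forall_apply_eq (conj_mem_weyl hσ hu) hconj).imp
      (fun hone => ?_) (fun hrefl => ?_)
    · rwa [mul_inv_eq_one, mul_eq_left] at hone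
    · rw [← hrefl]
      group

end IsPanelDir

theorem exists_isPanelDir {β : Dual ℝ V} (hβ : β ∈ D.realRoots) : ∃ S, D.IsPanelDir S β := by
  obtain ⟨w, hw, i, rfl⟩ := hβ
  exact ⟨(w⁻¹ : V ≃ₗ[ℝ] V) ⁻¹' D.stdFacet {i}, ⟨i, isVFacetOfType_iff.2
    ⟨w⁻¹, inv_mem (weyl_le_signedWeyl hw), rfl⟩⟩, ⟨w, hw, i, rfl⟩, fun s hs => hs.1 i rfl⟩

end VectorialData

/-! ### Topology of vectorial facets -/

namespace SimpleRootData

section Topology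

variable {I V : Type*} [AddCommGroup V] [Module ℝ V] [TopologicalSpace V] [ContinuousSMul ℝ V]
  {d : SimpleRootData I V} {S : Set V}

theorem IsVFacet.zero_mem_closure [Finite I] (hS : d.IsVFacet S) : (0 : V) ∈ closure S := by
  obtain ⟨v, hv⟩ := hS.nonempty
  have htendsto : Tendsto (fun t : ℝ => t • v) (𝓝[>] 0) (𝓝 0) := by
    have hcont : Continuous fun t : ℝ => t • v := by fun_prop
    simpa using (hcont.tendsto 0).mono_left nhdsWithin_le_nhds
  refine mem_closure_of_tendsto htendsto ?_
  filter_upwards [self_mem_nhdsWithin] with t ht using hS.smul_mem hv ht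

variable [IsTopologicalAddGroup V] [T2Space V] [FiniteDimensional ℝ V]

theorem IsVFacet.add_mem_of_mem_closure (hS : d.IsVFacet S) {v u : V} (hv : v ∈ S)
    (hu : u ∈ closure S) : v + u ∈ S := by
  obtain ⟨J, hJ⟩ := hS
  obtain ⟨σ, -, rfl⟩ := isVFacetOfType_iff.1 hJ
  have hcont (i : I) : Continuous fun v => d.root i (σ v) :=
    (d.root i ∘ₗ σ.toLinearMap).continuous_of_finiteDimensional
  have hzero : ∀ i ∈ J, d.root i (σ u) = 0 := fun i hi =>
    closure_minimal (t := {u | d.root i (σ u) = 0})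
      (fun x hx => hx.1 i hi) (isClosed_eq (hcont i) continuous_const) hu
  have hnonneg (i : I) : 0 ≤ d.root i (σ u) :=
    closure_minimal (t := {u | 0 ≤ d.root i (σ u)})
      (fun x hx => root_nonneg_of_mem_stdFacet (v := σ x) hx i)
      (isClosed_le continuous_const (hcont i)) hu
  rw [mem_preimage, map_add]
  refine ⟨fun i hi => ?_, fun i hi => ?_⟩
  · rw [map_add, hv.1 i hi, hzero i hi, add_zero]
  · rw [map_add]
    exact add_pos_of_pos_of_nonneg (hv.2 i hi) (hnonneg i)

theorem IsVFacet.add_mem (hS : d.IsVFacet S) {v u : V} (hv : v ∈ S) (hu : u ∈ S) : v + u ∈ S :=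
  hS.add_mem_of_mem_closure hv (subset_closure hu)

theorem IsVFacet.add_mem_closure (hS : d.IsVFacet S) {v u : V} (hv : v ∈ closure S)
    (hu : u ∈ closure S) : v + u ∈ closure S := by
  have hmaps : MapsTo (fun x => x + u) S S := fun x hx => hS.add_mem_of_mem_closure hx hu
  exact hmaps.closure (by fun_prop) hv

theorem eventually_root_pos_of_notMem [Finite I] (σ : V ≃ₗ[ℝ] V) {J : Set I} {s : V}
    (hs : σ s ∈ d.stdFacet J) : ∀ᶠ v in 𝓝 s, ∀ j ∉ J, 0 < d.root j (σ v) := by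
  refine eventually_all.2 fun j => eventually_imp_distrib_left.2 fun hj => ?_
  have hcont : Continuous fun v => d.root j (σ v) :=
    (d.root j ∘ₗ σ.toLinearMap).continuous_of_finiteDimensional
  exact hcont.continuousAt.eventually (lt_mem_nhds (hs.2 j hj))

theorem IsVFacet.eventually_sub_mem [Finite I] (hS : d.IsVFacet S) {v : V} (hv : v ∈ S) :
    ∀ᶠ u in 𝓝 (0 : V), u ∈ S → v - u ∈ S := by
  obtain ⟨J, hJ⟩ := hS
  obtain ⟨σ, -, rfl⟩ := isVFacetOfType_iff.1 hJ
  have htendsto : Tendsto (fun u : V => v - u) (𝓝 0) (𝓝 v) := by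
    simpa using (continuous_sub_left v).tendsto 0
  filter_upwards [htendsto.eventually (eventually_root_pos_of_notMem σ hv)] with u hpos hu
  refine ⟨fun i hi => ?_, hpos⟩
  rw [map_sub, map_sub, hv.1 i hi, hu.1 i hi, sub_zero]

theorem IsVChamber.isOpen [Finite I] (hS : d.IsVChamber S) : IsOpen S := by
  obtain ⟨σ, -, rfl⟩ := isVFacetOfType_iff.1 hS
  refine isOpen_iff_eventually.2 fun s hs => ?_
  filter_upwards [eventually_root_pos_of_notMem σ hs] with v hpos
  exact ⟨fun i hi => absurd hi (notMem_empty i), hpos⟩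

theorem IsVChamber.eventually_sub_mem [Finite I] (hS : d.IsVChamber S) {v : V} (hv : v ∈ S) :
    ∀ᶠ u in 𝓝 (0 : V), v - u ∈ S :=
  (continuous_sub_left v).continuousAt.eventually (hS.isOpen.mem_nhds (by simpa using hv))

end Topology

end SimpleRootData

namespace VectorialData

open SimpleRootData

section Topology

variable {I V : Type*} [Fintype I] [AddCommGroup V] [Module ℝ V] [TopologicalSpace V]
  {D : VectorialData I V} {S : Set V} {β : Dual ℝ V}

variable (D) in
/-- `Q` is the vectorial chamber adjacent to the panel `S` on the positive side of `β`. -/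
structure IsSide (S : Set V) (β : Dual ℝ V) (Q : Set V) : Prop where
  chamber : D.IsVChamber Q
  pos : ∀ q ∈ Q, 0 < β q
  pos_of_pos : ∀ α ∈ D.roots, (∀ s ∈ S, 0 < α s) → ∀ q ∈ Q, 0 < α q
  add_mem : ∀ s ∈ S, ∀ q ∈ Q, s + q ∈ Q
  eventually_mem : ∀ s ∈ S, ∀ᶠ v in 𝓝 s, 0 < β v → v ∈ Q

namespace IsPanelDir

variable [ContinuousSMul ℝ V] [IsTopologicalAddGroup V] [T2Space V] [FiniteDimensional ℝ V]

theorem exists_isSide (h : D.IsPanelDir S β) : ∃ Q, D.IsSide S β Q := by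
  obtain ⟨σ, hσ, i, rfl, hβ⟩ := h.exists_presentation
  have hβσ (v : V) : β v = D.root i (σ v) := by rw [← hβ, act_apply_apply]
  refine ⟨σ ⁻¹' D.stdFacet ∅, isVFacetOfType_iff.2 ⟨σ, hσ, rfl⟩, fun q hq => ?_,
    fun α hα hpos q hq => ?_, fun s hs q hq => ?_, fun s hs => ?_⟩
  · exact hβσ q ▸ hq.2 i (notMem_empty i)
  · obtain ⟨s, hs⟩ := h.isVFacet.nonempty
    have hσα := act_mem_roots hσ hα
    have hσs : 0 < act σ α (σ s) := by simpa using hpos s hs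
    have hcone : act σ α ∈ D.posCone := (mem_posCone_or_neg_mem_posCone hσα).resolve_right
      (neg_notMem_posCone (root_nonneg_of_mem_stdFacet hs) hσs)
    simpa using pos_of_mem_posCone hcone (ne_zero_of_mem_roots hσα) hq
  · refine ⟨fun j hj => absurd hj (notMem_empty j), fun j _ => ?_⟩
    rw [map_add, map_add]
    exact add_pos_of_nonneg_of_pos (root_nonneg_of_mem_stdFacet hs j) (hq.2 j (notMem_empty j))
  · filter_upwards [eventually_root_pos_of_notMem σ hs] with v hv hpos
    refine ⟨fun j hj => absurd hj (notMem_empty j), fun j _ => ?_⟩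
    obtain rfl | hj := eq_or_ne j i
    · exact hβσ v ▸ hpos
    · exact hv j hj

theorem eventually_mem_of_apply_eq_zero (h : D.IsPanelDir S β) {s : V} (hs : s ∈ S) :
    ∀ᶠ v in 𝓝 s, β v = 0 → v ∈ S := by
  obtain ⟨σ, -, i, rfl, hβ⟩ := h.exists_presentation
  filter_upwards [eventually_root_pos_of_notMem σ hs] with v hv hzero
  refine ⟨fun j hj => ?_, hv⟩
  rw [mem_singleton_iff.1 hj, ← hβ, act_apply_apply, hzero]

/-- Uniform in the root, although `Δ` may be infinite: a neighbourhood of `s` meets only `S` and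
the two adjacent chambers. -/
theorem eventually_forall_roots_pos (h : D.IsPanelDir S β) {s : V} (hs : s ∈ S) :
    ∀ᶠ v in 𝓝 s, ∀ α ∈ D.roots, (∀ s ∈ S, 0 < α s) → 0 < α v := by
  obtain ⟨Q, hQ⟩ := h.exists_isSide
  obtain ⟨Q', hQ'⟩ := h.neg_root.exists_isSide
  filter_upwards [hQ.eventually_mem s hs, hQ'.eventually_mem s hs,
    h.eventually_mem_of_apply_eq_zero hs] with v hQv hQ'v hSv α hα hpos
  rcases lt_trichotomy (β v) 0 with hv | hv | hv
  · exact hQ'.pos_of_pos α hα hpos v (hQ'v (neg_pos.2 hv))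
  · exact hpos v (hSv hv)
  · exact hQ.pos_of_pos α hα hpos v (hQv hv)

theorem span_eq_ker (h : D.IsPanelDir S β) : Submodule.span ℝ S = LinearMap.ker β := by
  refine le_antisymm (Submodule.span_le.2 h.vanish) fun v hv => ?_
  obtain ⟨s, hs⟩ := h.isVFacet.nonempty
  have htendsto : Tendsto (fun t : ℝ => s + t • v) (𝓝[>] 0) (𝓝 s) := by
    have hcont : Continuous fun t : ℝ => s + t • v := by fun_prop
    simpa using (hcont.tendsto 0).mono_left nhdsWithin_le_nhds
  obtain ⟨t, hmem, ht⟩ := ((htendsto.eventually (h.eventually_mem_of_apply_eq_zero hs)).and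
    self_mem_nhdsWithin).exists
  have hst : s + t • v ∈ S := hmem (by rw [map_add, map_smul, h.vanish s hs, hv]; simp)
  have hv_eq : v = t⁻¹ • ((s + t • v) - s) := by
    rw [add_sub_cancel_left, inv_smul_smul₀ (ne_of_gt ht)]
  rw [hv_eq]
  exact Submodule.smul_mem _ _ (sub_mem (Submodule.subset_span hst) (Submodule.subset_span hs))

end IsPanelDir

end Topology

end VectorialData

/-! ### Walls and the affine Weyl group -/

section Walls

variable {V P : Type*} [NormedAddCommGroup V] [NormedSpace ℝ V] [MetricSpace P]
  [NormedAddTorsor V P]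

theorem wall_eq_wall {β : Dual ℝ V} {p q : P} (h : β (p -ᵥ q) = 0) : wall β p = wall β q := by
  ext z
  have hz : β (z -ᵥ q) = β (z -ᵥ p) + β (p -ᵥ q) := by rw [← map_add, vsub_add_vsub_cancel]
  simp only [wall, mem_ofPred_eq, hz, h, add_zero]

theorem wall_neg (β : Dual ℝ V) (p : P) : wall (-β) p = wall β p := by
  ext z; simp [wall]

theorem affineEquiv_vsub (t : P ≃ᵃ[ℝ] P) (a b : P) : t a -ᵥ t b = t.linear (a -ᵥ b) :=
  (t.toAffineMap.linearMap_vsub a b).symm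

theorem act_linear_vsub (t : P ≃ᵃ[ℝ] P) (γ : Dual ℝ V) (z p : P) :
    SimpleRootData.act t.linear γ (t z -ᵥ t p) = γ (z -ᵥ p) := by
  rw [affineEquiv_vsub, SimpleRootData.act_apply_apply]

theorem image_eq_of_forall_mem_iff (t : P ≃ᵃ[ℝ] P) {A B : Set P} (h : ∀ z, t z ∈ B ↔ z ∈ A) :
    t '' A = B :=
  (congrArg (t '' ·) (Set.ext h)).symm.trans (image_preimage_eq B t.surjective)

theorem image_wall (t : P ≃ᵃ[ℝ] P) (γ : Dual ℝ V) (p : P) :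
    t '' wall γ p = wall (SimpleRootData.act t.linear γ) (t p) :=
  image_eq_of_forall_mem_iff t fun z => by simp only [wall, mem_ofPred_eq, act_linear_vsub]

theorem image_half (t : P ≃ᵃ[ℝ] P) (γ : Dual ℝ V) (p : P) :
    t '' half γ p = half (SimpleRootData.act t.linear γ) (t p) :=
  image_eq_of_forall_mem_iff t fun z => by simp only [half, mem_ofPred_eq, act_linear_vsub]

theorem image_openHalf (t : P ≃ᵃ[ℝ] P) (γ : Dual ℝ V) (p : P) :
    t '' openHalf γ p = openHalf (SimpleRootData.act t.linear γ) (t p) :=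
  image_eq_of_forall_mem_iff t fun z => by simp only [openHalf, mem_ofPred_eq, act_linear_vsub]

theorem inv_mem_wallReflections {I : Type*} {d : SimpleRootData I V} {W : Set (Set P)}
    {s : P ≃ᵃ[ℝ] P} (hs : s ∈ wallReflections d W) : s⁻¹ ∈ wallReflections d W := by
  obtain ⟨w, hw, i, p, hp, hlin, hfix⟩ := hs
  refine ⟨w, hw, i, p, hp, ?_, ?_⟩
  · change s.linear⁻¹ = _
    simp only [hlin, mul_inv_rev, inv_inv, SimpleRootData.refl_inv, mul_assoc]
  · conv_lhs => rw [← hfix]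
    exact s.symm_apply_apply p

end Walls

namespace Model

open SimpleRootData VectorialData

section AffineWeyl

variable {I V P : Type*} [Fintype I] [NormedAddCommGroup V] [NormedSpace ℝ V]
  [MetricSpace P] [NormedAddTorsor V P] {𝔸 : Model I V P}

theorem linear_mem_weyl {t : P ≃ᵃ[ℝ] P} (ht : t ∈ 𝔸.affineWeyl) : t.linear ∈ 𝔸.weyl := by
  suffices h : 𝔸.affineWeyl ≤ 𝔸.weyl.comap (AffineEquiv.linearHom (k := ℝ) (P₁ := P)) from h ht
  refine (Subgroup.closure_le _).2 ?_
  rintro s ⟨w, hw, i, p, -, hs, -⟩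
  change s.linear ∈ 𝔸.weyl
  exact hs ▸ mul_mem (mul_mem hw (refl_mem_weyl i)) (inv_mem hw)

theorem image_mem_walls {t : P ≃ᵃ[ℝ] P} (ht : t ∈ 𝔸.affineWeyl) {M : Set P}
    (hM : M ∈ 𝔸.walls) : t '' M ∈ 𝔸.walls := by
  suffices h : ∀ M ∈ 𝔸.walls, t '' M ∈ 𝔸.walls from h M hM
  refine Subgroup.closure_induction''
    (p := fun (t : P ≃ᵃ[ℝ] P) _ => ∀ M ∈ 𝔸.walls, t '' M ∈ 𝔸.walls)
    (fun s hs => 𝔸.image_wall s hs) (fun s hs => 𝔸.image_wall _ (inv_mem_wallReflections hs))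
    (fun M hM => ?_) (fun s u _ _ hs hu M hM => ?_) ht
  · rwa [AffineEquiv.coe_one, image_id]
  · rw [AffineEquiv.coe_mul, image_comp]
    exact hs _ (hu M hM)

theorem wall_act_mem_walls {t : P ≃ᵃ[ℝ] P} (ht : t ∈ 𝔸.affineWeyl) {γ : Dual ℝ V} {p : P}
    (h : wall γ p ∈ 𝔸.walls) : wall (act t.linear γ) (t p) ∈ 𝔸.walls := by
  rw [← AffineHovel.image_wall]; exact image_mem_walls ht h

theorem exists_wall_mem_walls {γ : Dual ℝ V} (hγ : γ ∈ 𝔸.realRoots) :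
    ∃ p : P, wall γ p ∈ 𝔸.walls := by
  obtain ⟨M, hM, p, rfl⟩ := (𝔸.infinite_walls γ hγ).nonempty
  exact ⟨p, hM⟩

/-- The affine map with linear part `L` that fixes `p`. -/
def affineAt (L : V ≃ₗ[ℝ] V) (p : P) : P ≃ᵃ[ℝ] P :=
  ((AffineEquiv.vaddConst ℝ p).symm.trans L.toAffineEquiv).trans (AffineEquiv.vaddConst ℝ p)

theorem affineAt_apply (L : V ≃ₗ[ℝ] V) (p z : P) : affineAt L p z = L (z -ᵥ p) +ᵥ p := rfl

theorem affineAt_linear (L : V ≃ₗ[ℝ] V) (p : P) : (affineAt L p).linear = L := by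
  ext v; rfl

theorem affineAt_mem_affineWeyl {w : V ≃ₗ[ℝ] V} (hw : w ∈ 𝔸.weyl) {i : I} {p : P}
    (h : wall (act w (𝔸.root i)) p ∈ 𝔸.walls) :
    affineAt (w * 𝔸.refl i * w⁻¹) p ∈ 𝔸.affineWeyl :=
  Subgroup.subset_closure ⟨w, hw, i, p, h, affineAt_linear _ _, by simp [affineAt_apply]⟩

theorem affineAt_refl_mem_affineWeyl {i : I} {p : P} (h : wall (𝔸.root i) p ∈ 𝔸.walls) :
    affineAt (𝔸.refl i) p ∈ 𝔸.affineWeyl := by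
  simpa using affineAt_mem_affineWeyl (one_mem _) (by rwa [act_one])

theorem exists_mem_affineWeyl_linear_eq {w : V ≃ₗ[ℝ] V} (hw : w ∈ 𝔸.weyl) :
    ∃ t ∈ 𝔸.affineWeyl, (t : P ≃ᵃ[ℝ] P).linear = w := by
  suffices h : 𝔸.weyl ≤ 𝔸.affineWeyl.map (AffineEquiv.linearHom (k := ℝ) (P₁ := P)) from h hw
  refine (Subgroup.closure_le _).2 ?_
  rintro _ ⟨i, rfl⟩
  obtain ⟨p, hp⟩ := exists_wall_mem_walls (𝔸 := 𝔸) (root_mem_realRoots i)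
  exact ⟨_, affineAt_refl_mem_affineWeyl hp, affineAt_linear _ _⟩

theorem exists_reflection {β : Dual ℝ V} (hβ : β ∈ 𝔸.realRoots) {p : P}
    (hp : wall β p ∈ 𝔸.walls) : ∃ s ∈ 𝔸.affineWeyl,
      (∀ z, β ((s : P ≃ᵃ[ℝ] P) z -ᵥ p) = - β (z -ᵥ p)) ∧ (∀ z ∈ wall β p, s z = z) := by
  obtain ⟨w, hw, i, rfl⟩ := hβ
  refine ⟨_, affineAt_mem_affineWeyl hw hp, fun z => ?_, fun z hz => ?_⟩
  · simp [affineAt_apply, act_apply, root_refl_self]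
  · have hroot : 𝔸.root i (w⁻¹ (z -ᵥ p)) = 0 := hz
    rw [affineAt_apply, LinearEquiv.mul_apply, LinearEquiv.mul_apply,
      refl_apply_of_root_eq_zero hroot, ← LinearEquiv.mul_apply, mul_inv_cancel,
      LinearEquiv.coe_one, id_eq, vsub_vadd]

/-! ### Translations of the affine Weyl group -/

variable (𝔸) in
/-- The vectors of the translations in the affine Weyl group. -/
def translations : AddSubgroup V where
  carrier := {v | AffineEquiv.constVAdd ℝ P v ∈ 𝔸.affineWeyl}
  zero_mem' := by
    rw [mem_ofPred_eq, AffineEquiv.constVAdd_zero]; exact one_mem _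
  add_mem' {a b} ha hb := by
    rw [mem_ofPred_eq, AffineEquiv.constVAdd_add]; exact mul_mem ha hb
  neg_mem' {a} ha := by
    rw [mem_ofPred_eq, ← AffineEquiv.constVAdd_symm]
    exact inv_mem (S := Subgroup (P ≃ᵃ[ℝ] P)) ha

theorem wall_vadd_mem_walls {v : V} (hv : v ∈ 𝔸.translations) {γ : Dual ℝ V} {p : P}
    (h : wall γ p ∈ 𝔸.walls) : wall γ (v +ᵥ p) ∈ 𝔸.walls := by
  have hact := wall_act_mem_walls hv h
  rwa [show (AffineEquiv.constVAdd ℝ P v).linear = 1 from rfl, act_one] at hact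

theorem smul_coroot_mem_translations {i : I} {p p' : P} (hp : wall (𝔸.root i) p ∈ 𝔸.walls)
    (hp' : wall (𝔸.root i) p' ∈ 𝔸.walls) :
    𝔸.root i (p' -ᵥ p) • 𝔸.coroot i ∈ 𝔸.translations := by
  change AffineEquiv.constVAdd ℝ P _ ∈ 𝔸.affineWeyl
  convert mul_mem (affineAt_refl_mem_affineWeyl hp') (affineAt_refl_mem_affineWeyl hp) using 1
  ext z
  apply vsub_left_injective p
  have hvsub (v : V) : (v +ᵥ p) -ᵥ p' = v - (p' -ᵥ p) := by
    rw [vadd_vsub_assoc, sub_eq_add_neg, neg_vsub_eq_vsub_rev]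
  simp only [AffineEquiv.coe_mul, Function.comp_apply, affineAt_apply,
    AffineEquiv.constVAdd_apply, refl_apply, hvsub, vadd_vsub_assoc, map_sub, map_smul,
    𝔸.root_coroot_two]
  module

theorem exists_wall_mem_Ioc {i : I} {p p' : P} (hp : wall (𝔸.root i) p ∈ 𝔸.walls)
    (hp' : wall (𝔸.root i) p' ∈ 𝔸.walls) (hpos : 0 < 𝔸.root i (p' -ᵥ p)) (y : P) :
    ∃ q, wall (𝔸.root i) q ∈ 𝔸.walls ∧
      𝔸.root i (q -ᵥ y) ∈ Ioc 0 (2 * 𝔸.root i (p' -ᵥ p)) := by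
  set g := 𝔸.root i (p' -ᵥ p)
  obtain ⟨n, hn, -⟩ := existsUnique_add_zsmul_mem_Ioc (mul_pos two_pos hpos)
    (𝔸.root i (p -ᵥ y)) 0
  refine ⟨n • (g • 𝔸.coroot i) +ᵥ p,
    wall_vadd_mem_walls (zsmul_mem (smul_coroot_mem_translations hp hp') n) hp, ?_⟩
  rw [zero_add] at hn
  rwa [vadd_vsub_assoc, map_add, map_zsmul, map_smul, 𝔸.root_coroot_two, smul_eq_mul, add_comm,
    mul_comm g]

theorem exists_gap_root (i : I) : ∃ G : ℝ, 0 < G ∧ ∀ y : P, ∃ p, wall (𝔸.root i) p ∈ 𝔸.walls ∧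
    𝔸.root i (p -ᵥ y) ∈ Ioc 0 G := by
  obtain ⟨_, ⟨hM, p, rfl⟩, _, ⟨hM', p', rfl⟩, hne⟩ :=
    (𝔸.infinite_walls _ (root_mem_realRoots i)).nontrivial
  have hroot : 𝔸.root i (p' -ᵥ p) ≠ 0 := fun h => hne (wall_eq_wall h).symm
  rcases hroot.lt_or_gt with hneg | hpos
  · have hpos : 0 < 𝔸.root i (p -ᵥ p') := by
      rw [← neg_vsub_eq_vsub_rev, map_neg]; exact neg_pos.2 hneg
    exact ⟨_, mul_pos two_pos hpos, exists_wall_mem_Ioc hM' hM hpos⟩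
  · exact ⟨_, mul_pos two_pos hpos, exists_wall_mem_Ioc hM hM' hpos⟩

variable (𝔸) in
theorem exists_gap : ∃ G : ℝ, ∀ γ ∈ 𝔸.realRoots, ∀ y : P, ∃ p, wall γ p ∈ 𝔸.walls ∧
    γ (p -ᵥ y) ∈ Ioc 0 G := by
  choose G hG hgap using exists_gap_root (𝔸 := 𝔸)
  refine ⟨∑ i, G i, ?_⟩
  rintro _ ⟨w, hw, i, rfl⟩ y
  obtain ⟨t, ht, rfl⟩ := exists_mem_affineWeyl_linear_eq (𝔸 := 𝔸) hw
  obtain ⟨p, hp, hmem⟩ := hgap i (t.symm y)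
  refine ⟨t p, wall_act_mem_walls ht hp, ?_⟩
  rw [← t.apply_symm_apply y, act_linear_vsub]
  exact Ioc_subset_Ioc_right
    (Finset.single_le_sum (fun i _ => (hG i).le) (Finset.mem_univ i)) hmem

/-! ### Discrete directions -/

variable (𝔸) in
/-- The direction `ker γ` is discrete: some open slab `{a < γ < b}` contains no wall. Otherwise the
walls of direction `ker γ` are dense. -/
def IsDiscrete (γ : Dual ℝ V) : Prop := ∃ x y : P, 0 < γ (y -ᵥ x) ∧
  ∀ p, wall γ p ∈ 𝔸.walls → ¬ (0 < γ (p -ᵥ x) ∧ 0 < γ (y -ᵥ p))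

theorem IsDiscrete.act {γ : Dual ℝ V} (h : 𝔸.IsDiscrete γ) {w : V ≃ₗ[ℝ] V} (hw : w ∈ 𝔸.weyl) :
    𝔸.IsDiscrete (act w γ) := by
  obtain ⟨t, ht, rfl⟩ := exists_mem_affineWeyl_linear_eq (𝔸 := 𝔸) hw
  obtain ⟨x, y, hxy, hgap⟩ := h
  refine ⟨t x, t y, by rwa [act_linear_vsub], fun q hq => ?_⟩
  obtain ⟨p, rfl⟩ := t.surjective q
  rw [act_linear_vsub, act_linear_vsub]
  refine hgap p ?_
  have hwall := wall_act_mem_walls (inv_mem ht) hq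
  rw [show (t⁻¹).linear = t.linear⁻¹ from rfl, ← act_mul, inv_mul_cancel, act_one] at hwall
  rwa [show (t⁻¹ : P ≃ᵃ[ℝ] P) (t p) = p from t.symm_apply_apply p] at hwall

theorem IsDiscrete.neg {γ : Dual ℝ V} (h : 𝔸.IsDiscrete γ) : 𝔸.IsDiscrete (-γ) := by
  obtain ⟨x, y, hxy, hgap⟩ := h
  refine ⟨y, x, ?_, fun p hp hbetween => hgap p (by rwa [wall_neg] at hp) ?_⟩
  · rwa [LinearMap.neg_apply, ← map_neg, neg_vsub_eq_vsub_rev]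
  · simpa only [LinearMap.neg_apply, ← map_neg, neg_vsub_eq_vsub_rev, and_comm] using hbetween

variable (𝔸) in
/-- The periods of the set of walls of direction `ker αᵢ`, measured by `αᵢ`. -/
def periods (i : I) : AddSubgroup ℝ where
  carrier := {r | ∀ (p : P) (v : V), 𝔸.root i v = r →
    (wall (𝔸.root i) p ∈ 𝔸.walls ↔ wall (𝔸.root i) (v +ᵥ p) ∈ 𝔸.walls)}
  zero_mem' p v hv := by
    rw [wall_eq_wall (p := v +ᵥ p) (q := p) (by rwa [vadd_vsub])]
  add_mem' {a b} ha hb p v hv := by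
    have hroot := root_half_smul_coroot (d := 𝔸.toSimpleRootData) i b
    rw [hb p _ hroot, ha _ (v - (b / 2) • 𝔸.coroot i) (by rw [map_sub, hv, hroot]; ring),
      vadd_vadd, sub_add_cancel]
  neg_mem' {a} ha p v hv := by
    rw [ha (v +ᵥ p) (-v) (by rw [map_neg, hv, neg_neg]), vadd_vadd, neg_add_cancel, zero_vadd]

theorem root_mem_periods {v : V} (hv : v ∈ 𝔸.translations) (i : I) :
    𝔸.root i v ∈ 𝔸.periods i := by
  intro p u hu
  rw [wall_eq_wall (p := u +ᵥ p) (q := v +ᵥ p) (by simp [hu])]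
  refine ⟨wall_vadd_mem_walls hv, fun h => ?_⟩
  simpa using wall_vadd_mem_walls (neg_mem hv) h

theorem smul_root_coroot_mem_periods {i j : I} {p q : P} (hp : wall (𝔸.root j) p ∈ 𝔸.walls)
    (hq : wall (𝔸.root j) q ∈ 𝔸.walls) :
    𝔸.root j (q -ᵥ p) * 𝔸.root i (𝔸.coroot j) ∈ 𝔸.periods i := by
  rw [← smul_eq_mul, ← map_smul]
  exact root_mem_periods (smul_coroot_mem_translations hp hq) i

theorem IsDiscrete.not_dense_periods {i : I} (hi : 𝔸.IsDiscrete (𝔸.root i)) :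
    ¬ Dense (𝔸.periods i : Set ℝ) := fun hdense => by
  obtain ⟨x, y, hxy, hgap⟩ := hi
  obtain ⟨p, hp⟩ := exists_wall_mem_walls (𝔸 := 𝔸) (root_mem_realRoots i)
  have hlt : 𝔸.root i (x -ᵥ p) < 𝔸.root i (y -ᵥ p) := by
    rwa [← sub_pos, ← map_sub, vsub_sub_vsub_cancel_right]
  obtain ⟨r, hr, hxr, hry⟩ := hdense.exists_mem_open isOpen_Ioo (nonempty_Ioo.2 hlt)
  have hroot := root_half_smul_coroot (d := 𝔸.toSimpleRootData) i r
  refine hgap _ ((hr p _ hroot).1 hp) ⟨?_, ?_⟩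
  · rw [vadd_vsub_assoc, map_add, hroot, ← neg_vsub_eq_vsub_rev, map_neg]
    linarith
  · rw [vsub_vadd_eq_vsub_sub, map_sub, hroot]
    linarith

theorem exists_pos_mem_periods (i : I) : ∃ r ∈ 𝔸.periods i, 0 < r := by
  obtain ⟨p, hp⟩ := exists_wall_mem_walls (𝔸 := 𝔸) (root_mem_realRoots i)
  obtain ⟨_, -, hgap⟩ := exists_gap_root (𝔸 := 𝔸) i
  obtain ⟨q, hq, hpos, -⟩ := hgap p
  refine ⟨_, smul_root_coroot_mem_periods hp hq, ?_⟩
  rw [𝔸.root_coroot_two]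
  exact mul_pos hpos two_pos

theorem IsDiscrete.exists_generator_periods {i : I} (hi : 𝔸.IsDiscrete (𝔸.root i)) :
    ∃ c : ℝ, 0 < c ∧ c ∈ 𝔸.periods i ∧ ∀ r ∈ 𝔸.periods i, ∃ n : ℤ, r = n * c := by
  obtain ⟨c, hc⟩ := (𝔸.periods i).dense_or_cyclic.resolve_left hi.not_dense_periods
  have hcyc : ∀ r ∈ 𝔸.periods i, ∃ n : ℤ, r = n * c := fun r hr => by
    obtain ⟨n, rfl⟩ := AddSubgroup.mem_closure_singleton.1 (hc ▸ hr)
    exact ⟨n, zsmul_eq_mul c n⟩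
  have hmem : c ∈ 𝔸.periods i := hc ▸ AddSubgroup.subset_closure rfl
  obtain ⟨r, hr, hpos⟩ := exists_pos_mem_periods (𝔸 := 𝔸) i
  obtain ⟨m, hm⟩ := hcyc r hr
  rcases lt_trichotomy c 0 with hneg | rfl | hpos
  · refine ⟨-c, neg_pos.2 hneg, neg_mem hmem, fun r hr => ?_⟩
    obtain ⟨n, rfl⟩ := hcyc r hr
    exact ⟨-n, by push_cast; ring⟩
  · simp [hm] at hpos
  · exact ⟨c, hpos, hmem, hcyc⟩

theorem exists_wall_between_of_not_isDiscrete {γ : Dual ℝ V} (h : ¬ 𝔸.IsDiscrete γ) {x y : P}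
    (hxy : 0 < γ (y -ᵥ x)) : ∃ p, wall γ p ∈ 𝔸.walls ∧ 0 < γ (p -ᵥ x) ∧ 0 < γ (y -ᵥ p) := by
  by_contra! hgap
  exact h ⟨x, y, hxy, fun p hp hbetween => (hgap p hp hbetween.1).not_gt hbetween.2⟩

/-- Otherwise translations by small multiples of `αₖ^∨` would give arbitrarily small periods of
`αᵢ`. -/
theorem root_coroot_eq_zero_of_not_isDiscrete {i k : I} (hi : 𝔸.IsDiscrete (𝔸.root i))
    (hk : ¬ 𝔸.IsDiscrete (𝔸.root k)) : 𝔸.root i (𝔸.coroot k) = 0 := by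
  by_contra hne
  obtain ⟨c, hc, -, hcyc⟩ := hi.exists_generator_periods
  set m := 𝔸.root i (𝔸.coroot k)
  have hm : 0 < |m| := abs_pos.2 hne
  obtain ⟨p, hp⟩ := exists_wall_mem_walls (𝔸 := 𝔸) (root_mem_realRoots k)
  have hroot := root_half_smul_coroot (d := 𝔸.toSimpleRootData) k (c / |m|)
  obtain ⟨q, hq, hpq, hqy⟩ := exists_wall_between_of_not_isDiscrete hk (x := p)
    (y := (c / |m| / 2) • 𝔸.coroot k +ᵥ p) (by rw [vadd_vsub, hroot]; positivity)
  rw [vadd_vsub_assoc, map_add, hroot, ← neg_vsub_eq_vsub_rev, map_neg, ← sub_eq_add_neg,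
    sub_pos, lt_div_iff₀ hm] at hqy
  obtain ⟨n, hn⟩ := hcyc _ (smul_root_coroot_mem_periods hp hq)
  have hlt : |(n : ℝ)| * c < 1 * c := by
    rwa [one_mul, ← abs_of_pos hc, ← abs_mul, ← hn, abs_mul, abs_of_pos hpq, abs_of_pos hc]
  have hn0 : n = 0 := Int.abs_lt_one_iff.1 (by exact_mod_cast lt_of_mul_lt_mul_right hlt hc.le)
  rw [hn0, Int.cast_zero, zero_mul] at hn
  exact mul_ne_zero hpq.ne' hne hn

/-! ### The lattice of discrete roots -/

variable (𝔸) in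
/-- A family of positive reals such that `c i` generates the periods of `αᵢ` whenever the direction
`ker αᵢ` is discrete. -/
structure IsPeriodScale (c : I → ℝ) : Prop where
  pos : ∀ i, 0 < c i
  mem_periods : ∀ i, 𝔸.IsDiscrete (𝔸.root i) → c i ∈ 𝔸.periods i
  exists_eq_mul : ∀ i, 𝔸.IsDiscrete (𝔸.root i) → ∀ r ∈ 𝔸.periods i, ∃ n : ℤ, r = n * c i

variable (𝔸) in
theorem exists_isPeriodScale : ∃ c, 𝔸.IsPeriodScale c := by
  have h (i : I) : ∃ c : ℝ, 0 < c ∧ (𝔸.IsDiscrete (𝔸.root i) →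
      c ∈ 𝔸.periods i ∧ ∀ r ∈ 𝔸.periods i, ∃ n : ℤ, r = n * c) := by
    by_cases hi : 𝔸.IsDiscrete (𝔸.root i)
    · obtain ⟨c, hpos, hc⟩ := hi.exists_generator_periods
      exact ⟨c, hpos, fun _ => hc⟩
    · exact ⟨1, one_pos, fun h => absurd h hi⟩
  choose c hpos hc using h
  exact ⟨c, hpos, fun i hi => (hc i hi).1, fun i hi => (hc i hi).2⟩

variable (𝔸) in
/-- The lattice generated by the multiples `c i⁻¹ αᵢ` of the simple roots of discrete direction. -/
def rootLattice (c : I → ℝ) : Submodule ℤ (Dual ℝ V) :=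
  Submodule.span ℤ ((fun i => (c i)⁻¹ • 𝔸.root i) '' {i | 𝔸.IsDiscrete (𝔸.root i)})

theorem inv_smul_root_mem_rootLattice (c : I → ℝ) {i : I} (hi : 𝔸.IsDiscrete (𝔸.root i)) :
    (c i)⁻¹ • 𝔸.root i ∈ 𝔸.rootLattice c :=
  Submodule.subset_span ⟨i, hi, rfl⟩

theorem exists_eq_sum_of_mem_rootLattice {c : I → ℝ} {γ : Dual ℝ V} (hγ : γ ∈ 𝔸.rootLattice c) :
    ∃ n : I → ℤ, γ = ∑ j, n j • ((c j)⁻¹ • 𝔸.root j) := by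
  obtain ⟨n, hn⟩ := (Submodule.mem_span_range_iff_exists_fun ℤ).1
    (Submodule.span_mono (image_subset_range _ _) hγ)
  exact ⟨n, hn.symm⟩

namespace IsPeriodScale

variable {c : I → ℝ} (hc : 𝔸.IsPeriodScale c)
include hc

theorem exists_root_coroot_mul_eq {j k : I} (hj : 𝔸.IsDiscrete (𝔸.root j))
    (hk : 𝔸.IsDiscrete (𝔸.root k)) : ∃ m : ℤ, 𝔸.root j (𝔸.coroot k) * c k = m * c j := by
  obtain ⟨p, hp⟩ := exists_wall_mem_walls (𝔸 := 𝔸) (root_mem_realRoots k)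
  have hroot := root_half_smul_coroot (d := 𝔸.toSimpleRootData) k (c k)
  have hper := smul_root_coroot_mem_periods (i := j) hp ((hc.mem_periods k hk p _ hroot).1 hp)
  rw [vadd_vsub, hroot, mul_comm] at hper
  exact hc.exists_eq_mul j hj _ hper

theorem act_refl_inv_smul_root_mem {j : I} (hj : 𝔸.IsDiscrete (𝔸.root j)) (k : I) :
    act (𝔸.refl k) ((c j)⁻¹ • 𝔸.root j) ∈ 𝔸.rootLattice c := by
  rw [act_refl]
  refine sub_mem (inv_smul_root_mem_rootLattice c hj) ?_
  by_cases hk : 𝔸.IsDiscrete (𝔸.root k)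
  · obtain ⟨m, hm⟩ := hc.exists_root_coroot_mul_eq hj hk
    have hcoef : ((c j)⁻¹ • 𝔸.root j) (𝔸.coroot k) = m * (c k)⁻¹ := by
      have := (hc.pos j).ne'
      have := (hc.pos k).ne'
      rw [LinearMap.smul_apply, smul_eq_mul]
      field_simp
      rw [hm, mul_comm]
    rw [hcoef, mul_smul, Int.cast_smul_eq_zsmul]
    exact zsmul_mem (inv_smul_root_mem_rootLattice c hk) m
  · rw [LinearMap.smul_apply, root_coroot_eq_zero_of_not_isDiscrete hj hk, smul_zero, zero_smul]
    exact zero_mem _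

theorem act_refl_mem (k : I) {γ : Dual ℝ V} (hγ : γ ∈ 𝔸.rootLattice c) :
    act (𝔸.refl k) γ ∈ 𝔸.rootLattice c := by
  induction hγ using Submodule.span_induction with
  | mem γ hγ =>
    obtain ⟨j, hj, rfl⟩ := hγ
    exact hc.act_refl_inv_smul_root_mem hj k
  | zero => exact zero_mem _
  | add γ δ _ _ hγ hδ => exact add_mem hγ hδ
  | smul n γ _ hγ =>
    have hact : act (𝔸.refl k) (n • γ) = n • act (𝔸.refl k) γ := by ext v; simp [act_apply]
    exact hact ▸ zsmul_mem hγ n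

theorem act_mem {w : V ≃ₗ[ℝ] V} (hw : w ∈ 𝔸.weyl) :
    ∀ γ ∈ 𝔸.rootLattice c, act w γ ∈ 𝔸.rootLattice c := by
  refine Subgroup.closure_induction''
    (p := fun w _ => ∀ γ ∈ 𝔸.rootLattice c, act w γ ∈ 𝔸.rootLattice c) ?_ ?_
    (fun γ hγ => by rwa [act_one]) (fun u w _ _ hu hw γ hγ => ?_) hw
  · rintro _ ⟨k, rfl⟩ γ
    exact hc.act_refl_mem k
  · rintro _ ⟨k, rfl⟩ γ
    rw [refl_inv]
    exact hc.act_refl_mem k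
  · rw [act_mul]
    exact hu _ (hw γ hγ)

theorem exists_eq_smul_sum {γ : Dual ℝ V} (hγ : γ ∈ 𝔸.realRoots) (hd : 𝔸.IsDiscrete γ) :
    ∃ i, ∃ n : I → ℤ, γ = c i • ∑ j, n j • ((c j)⁻¹ • 𝔸.root j) := by
  obtain ⟨w, hw, i, rfl⟩ := hγ
  have hi : 𝔸.IsDiscrete (𝔸.root i) := by
    simpa only [← act_mul, inv_mul_cancel, act_one] using hd.act (inv_mem hw)
  obtain ⟨n, hn⟩ := exists_eq_sum_of_mem_rootLattice
    (hc.act_mem hw _ (inv_smul_root_mem_rootLattice c hi))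
  refine ⟨i, n, ?_⟩
  rw [← hn, show act w ((c i)⁻¹ • 𝔸.root i) = (c i)⁻¹ • act w (𝔸.root i) from rfl,
    smul_inv_smul₀ (hc.pos i).ne']

end IsPeriodScale

theorem sum_zsmul_inv_smul_root_apply {v : I → V} (hv : ∀ i, 𝔸.root i (v i) = 1)
    (hv' : ∀ i j, i ≠ j → 𝔸.root i (v j) = 0) (c : I → ℝ) (n : I → ℤ) (j : I) :
    (∑ i, n i • ((c i)⁻¹ • 𝔸.root i)) (v j) = n j * (c j)⁻¹ := by
  rw [LinearMap.sum_apply, Finset.sum_eq_single j]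
  · simp [hv j]
  · intro i _ hi; simp [hv' i j hi]
  · simp

theorem finite_setOf_isDiscrete_abs_le (K : ℝ) {v : I → V} (hv : ∀ i, 𝔸.root i (v i) = 1)
    (hv' : ∀ i j, i ≠ j → 𝔸.root i (v j) = 0) :
    {γ ∈ 𝔸.realRoots | 𝔸.IsDiscrete γ ∧ ∀ j, |γ (v j)| ≤ K}.Finite := by
  obtain ⟨c, hc⟩ := exists_isPeriodScale 𝔸
  have hbox (i : I) : {n : I → ℤ | ∀ j, |n j| ≤ ⌈K / c i * c j⌉}.Finite :=
    (Set.Finite.pi' fun j => Set.finite_Icc (-⌈K / c i * c j⌉) ⌈K / c i * c j⌉).subset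
      fun n hn j => abs_le.1 (hn j)
  let e (i : I) (n : I → ℤ) : Dual ℝ V := c i • ∑ j, n j • ((c j)⁻¹ • 𝔸.root j)
  refine (Set.finite_iUnion fun i => (hbox i).image (e i)).subset ?_
  rintro γ ⟨hγ, hd, hK⟩
  obtain ⟨i, n, hn⟩ := hc.exists_eq_smul_sum hγ hd
  refine mem_iUnion.2 ⟨i, n, fun j => ?_, hn.symm⟩
  have hval : γ (v j) = c i * (n j * (c j)⁻¹) := by
    rw [hn, LinearMap.smul_apply, sum_zsmul_inv_smul_root_apply hv hv', smul_eq_mul]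
  have hj := hK j
  rw [hval, abs_mul, abs_of_pos (hc.pos i), abs_mul, abs_inv, abs_of_pos (hc.pos j),
    ← le_div_iff₀' (hc.pos i), ← div_eq_mul_inv, div_le_iff₀ (hc.pos j)] at hj
  exact_mod_cast hj.trans (Int.le_ceil _)

end AffineWeyl

end Model

namespace Model

open SimpleRootData VectorialData

/-! ### Enclosed sets -/

section Enclosed

variable {I V P : Type*} [Fintype I] [NormedAddCommGroup V] [NormedSpace ℝ V]
  [MetricSpace P] [NormedAddTorsor V P] {𝔸 : Model I V P}

theorem half_inter_half_neg (β : Dual ℝ V) (p : P) : half β p ∩ half (-β) p = wall β p := by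
  ext z
  simp only [half, wall, mem_inter_iff, mem_ofPred_eq, LinearMap.neg_apply, neg_nonneg]
  rw [and_comm, ← le_antisymm_iff]

theorem IsPart.mem_of_nonneg {α : Dual ℝ V} {S : Set P} (hS : 𝔸.IsPart α S) {y z : P}
    (hz : z ∈ S) (h : 0 ≤ α (y -ᵥ z)) : y ∈ S := by
  have hsum (p : P) : α (y -ᵥ p) = α (y -ᵥ z) + α (z -ᵥ p) := by
    rw [← map_add, vsub_add_vsub_cancel]
  rcases hS with rfl | ⟨p, -, rfl | rfl⟩
  · exact mem_univ y
  · rw [half, mem_ofPred_eq] at hz ⊢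
    rw [hsum]
    exact add_nonneg h hz
  · rw [openHalf, mem_ofPred_eq] at hz ⊢
    rw [hsum]
    exact add_pos_of_nonneg_of_pos h hz

theorem IsClosedPart.isPart {α : Dual ℝ V} {S : Set P} (hS : 𝔸.IsClosedPart α S) :
    𝔸.IsPart α S :=
  hS.imp_right fun ⟨p, hp, h⟩ => ⟨p, hp, Or.inl h⟩

theorem IsEnclosed.isSemiEnclosed {T : Set P} (hT : 𝔸.IsEnclosed T) : 𝔸.IsSemiEnclosed T := by
  obtain ⟨D, hD, rfl⟩ := hT
  exact ⟨D, fun β hβ => (hD β hβ).isPart, rfl⟩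

open scoped Classical in
theorem biInter_ite_eq {ι X : Type*} {R : Set ι} {a : ι} (ha : a ∈ R) (S : Set X) :
    ⋂ i ∈ R, (if i = a then S else univ) = S := by
  simp only [Set.iInter_ite, iInter_univ, inter_univ]
  ext z
  simp only [mem_iInter]
  exact ⟨fun h => h a ha rfl, fun h _ _ _ => h⟩

open scoped Classical in
theorem IsClosedPart.isEnclosed {α : Dual ℝ V} {S : Set P} (hα : α ∈ 𝔸.allRoots)
    (hS : 𝔸.IsClosedPart α S) : 𝔸.IsEnclosed S := by
  refine ⟨fun γ => if γ = α then S else univ, fun γ _ => ?_, (biInter_ite_eq hα S).symm⟩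
  by_cases h : γ = α
  · simpa only [h, if_true] using hS
  · exact Or.inl (if_neg h)

open scoped Classical in
theorem IsPart.isSemiEnclosed {α : Dual ℝ V} {S : Set P} (hα : α ∈ 𝔸.allRoots)
    (hS : 𝔸.IsPart α S) : 𝔸.IsSemiEnclosed S := by
  refine ⟨fun γ => if γ = α then S else univ, fun γ _ => ?_, (biInter_ite_eq hα S).symm⟩
  by_cases h : γ = α
  · simpa only [h, if_true] using hS
  · exact Or.inl (if_neg h)

theorem isEnclosed_half {β : Dual ℝ V} (hβ : β ∈ 𝔸.realRoots) {p : P}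
    (hp : wall β p ∈ 𝔸.walls) : 𝔸.IsEnclosed (half β p) :=
  IsClosedPart.isEnclosed (Or.inl hβ) (Or.inr ⟨p, fun _ => hp, rfl⟩)

theorem isEnclosed_wall {β : Dual ℝ V} (hβ : β ∈ 𝔸.realRoots) {p : P}
    (hp : wall β p ∈ 𝔸.walls) : 𝔸.IsEnclosed (wall β p) := by
  rw [← half_inter_half_neg]
  exact (isEnclosed_half hβ hp).inter
    (isEnclosed_half (neg_mem_realRoots hβ) (by rwa [wall_neg]))

theorem IsEnclosed.mem_of_forall_exists_nonneg {T : Set P} (hT : 𝔸.IsEnclosed T) {y : P}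
    (h : ∀ α ∈ 𝔸.allRoots, ∃ t ∈ T, 0 ≤ α (y -ᵥ t)) : y ∈ T := by
  obtain ⟨D, hD, rfl⟩ := hT
  refine mem_iInter₂.2 fun α hα => ?_
  obtain ⟨t, ht, hyt⟩ := h α hα
  exact (hD α hα).isPart.mem_of_nonneg (mem_iInter₂.1 ht α hα) hyt

theorem IsEnclosed.vadd_mem {T : Set P} (hT : 𝔸.IsEnclosed T) {S : Set V} (hS : 𝔸.IsVFacet S)
    {a : P} (ha : ∀ s ∈ S, s +ᵥ a ∈ T) {s : V} (hs : s ∈ S) {t : P} (ht : t ∈ T) :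
    s +ᵥ t ∈ T := by
  refine hT.mem_of_forall_exists_nonneg fun α _ => ?_
  rcases le_or_gt 0 (α s) with h0 | h0
  · exact ⟨t, ht, by rwa [vadd_vsub]⟩
  · -- If `α` is negative on `s`, it is as small as needed far away in the cone `a + S`.
    obtain ⟨n, hn⟩ := exists_nat_gt ((-α s - α (t -ᵥ a)) / (-α s))
    rw [div_lt_iff₀ (by linarith)] at hn
    refine ⟨((n : ℝ) + 1) • s +ᵥ a, ha _ (hS.smul_mem hs (by positivity)), ?_⟩
    rw [vsub_vadd_eq_vsub_sub, vadd_vsub_assoc, map_sub, map_add, map_smul, smul_eq_mul]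
    nlinarith

theorem IsTrueAt.image {t : P ≃ᵃ[ℝ] P} (ht : t ∈ 𝔸.affineWeyl) {α : Dual ℝ V} {p : P}
    (h : 𝔸.IsTrueAt α p) : 𝔸.IsTrueAt (act t.linear α) (t p) := fun hα => by
  refine wall_act_mem_walls ht (h ?_)
  have := act_mem_realRoots (inv_mem (linear_mem_weyl ht)) hα
  rwa [← act_mul, inv_mul_cancel, act_one] at this

theorem IsPart.image {t : P ≃ᵃ[ℝ] P} (ht : t ∈ 𝔸.affineWeyl) {α : Dual ℝ V} {S : Set P}
    (h : 𝔸.IsPart α S) : 𝔸.IsPart (act t.linear α) (t '' S) := by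
  rcases h with rfl | ⟨p, hp, rfl | rfl⟩
  · exact Or.inl (image_univ_of_surjective t.surjective)
  · exact Or.inr ⟨t p, hp.image ht, Or.inl (image_half t α p)⟩
  · exact Or.inr ⟨t p, hp.image ht, Or.inr (image_openHalf t α p)⟩

theorem IsSemiEnclosed.image {t : P ≃ᵃ[ℝ] P} (ht : t ∈ 𝔸.affineWeyl) {T : Set P}
    (h : 𝔸.IsSemiEnclosed T) : 𝔸.IsSemiEnclosed (t '' T) := by
  obtain ⟨D, hD, rfl⟩ := h
  have hw := weyl_le_signedWeyl (linear_mem_weyl ht)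
  have hroots {β : Dual ℝ V} (hβ : β ∈ 𝔸.allRoots) : act t.linear⁻¹ β ∈ 𝔸.allRoots :=
    act_mem_roots (inv_mem hw) hβ
  refine ⟨fun β => t '' D (act t.linear⁻¹ β), fun β hβ => ?_, ?_⟩
  · have := (hD _ (hroots hβ)).image ht
    rwa [← act_mul, mul_inv_cancel, act_one] at this
  · refine image_eq_of_forall_mem_iff t fun z => ?_
    simp only [mem_iInter, t.injective.mem_set_image]
    refine ⟨fun h β hβ => ?_, fun h β hβ => h _ (hroots hβ)⟩
    have := h _ (act_mem_roots hw hβ)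
    rwa [← act_mul, inv_mul_cancel, act_one] at this

end Enclosed

/-! ### Facets -/

theorem mem_localFacet {V P : Type*} [NormedAddCommGroup V] [MetricSpace P] [NormedAddTorsor V P]
    {x : P} {S : Set V} {T : Set P} :
    T ∈ localFacet x S ↔ ∀ᶠ v in 𝓝 (0 : V), v ∈ S → v +ᵥ x ∈ T := by
  have h : map (fun v : V => v +ᵥ x) (𝓝[S] 0) = 𝓝[(fun v : V => v +ᵥ x) '' S] ((0 : V) +ᵥ x) :=
    (IsometryEquiv.vaddConst x).isometry.isEmbedding.map_nhdsWithin_eq S (0 : V)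
  rw [zero_vadd] at h
  rw [localFacet, germ, ← h, mem_map, mem_nhdsWithin_iff_eventually]
  rfl

section Facets

variable {I V P : Type*} [Fintype I] [NormedAddCommGroup V] [NormedSpace ℝ V]
  [MetricSpace P] [NormedAddTorsor V P] {𝔸 : Model I V P}

theorem mem_localFacet_of_mem_facet {x : P} {S : Set V} {T : Set P} (hT : T ∈ 𝔸.facet x S) :
    T ∈ localFacet x S := by
  obtain ⟨T', -, hT', hsub⟩ := hT
  exact mem_of_superset hT' hsub

theorem IsEnclosed.mem_facet {x : P} {S : Set V} {T : Set P} (hTe : 𝔸.IsEnclosed T)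
    (hT : ∀ᶠ v in 𝓝 (0 : V), v ∈ S → v +ᵥ x ∈ T) : T ∈ 𝔸.facet x S :=
  ⟨T, hTe.isSemiEnclosed, mem_localFacet.2 hT, Subset.rfl⟩

theorem exists_mem_of_mem_localFacet {x : P} {S : Set V} (hS : 𝔸.IsVFacet S) {T : Set P}
    (hT : T ∈ localFacet x S) {O : Set V} (hO : O ∈ 𝓝 (0 : V)) : ∃ s ∈ S, s ∈ O ∧ s +ᵥ x ∈ T := by
  have hfreq : ∃ᶠ v in 𝓝 (0 : V), v ∈ S := mem_closure_iff_frequently.1 hS.zero_mem_closure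
  obtain ⟨v, hv, hvT, hvO⟩ := (hfreq.and_eventually ((mem_localFacet.1 hT).and hO)).exists
  exact ⟨v, hv, hvO, hvT hv⟩

theorem exists_mem_of_mem_facet {x : P} {S : Set V} (hS : 𝔸.IsVFacet S) {T : Set P}
    (hT : T ∈ 𝔸.facet x S) {O : Set V} (hO : O ∈ 𝓝 (0 : V)) : ∃ s ∈ S, s ∈ O ∧ s +ᵥ x ∈ T :=
  exists_mem_of_mem_localFacet hS (mem_localFacet_of_mem_facet hT) hO

theorem facet_neBot {x : P} {S : Set V} (hS : 𝔸.IsVFacet S) : (𝔸.facet x S).NeBot := by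
  refine neBot_iff.2 fun h => ?_
  obtain ⟨s, -, -, hs⟩ := exists_mem_of_mem_facet (x := x) (T := ∅) hS (by rw [h]; exact mem_bot)
    univ_mem
  exact hs

theorem mem_closure_of_mem_facet {x : P} {S : Set V} (hS : 𝔸.IsVFacet S) {T : Set P}
    (hT : T ∈ 𝔸.facet x S) : x ∈ closure T := by
  refine mem_closure_iff_nhds.2 fun O hO => ?_
  have hcont : Continuous fun v : V => v +ᵥ x := by fun_prop
  have hpre : (fun v : V => v +ᵥ x) ⁻¹' O ∈ 𝓝 (0 : V) :=
    hcont.continuousAt.preimage_mem_nhds (by simpa only [zero_vadd] using hO)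
  obtain ⟨s, -, hsO, hsT⟩ := exists_mem_of_mem_facet hS hT hpre
  exact ⟨_, hsO, hsT⟩

theorem mem_adherence {F : Filter P} {U : Set P} :
    U ∈ adherence F ↔ ∃ T ∈ F, closure T ⊆ U :=
  mem_lift'_sets (monotone_closure P)

variable [FiniteDimensional ℝ V]

theorem continuous_apply_vsub (α : Dual ℝ V) (p : P) : Continuous fun z : P => α (z -ᵥ p) :=
  α.continuous_of_finiteDimensional.comp (continuous_id.vsub continuous_const)

theorem isClosed_half (α : Dual ℝ V) (p : P) : IsClosed (half α p) :=
  isClosed_le continuous_const (continuous_apply_vsub α p)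

theorem IsEnclosed.isClosed {T : Set P} (hT : 𝔸.IsEnclosed T) : IsClosed T := by
  obtain ⟨D, hD, rfl⟩ := hT
  refine isClosed_biInter fun β hβ => ?_
  rcases hD β hβ with h | ⟨p, -, h⟩
  · rw [h]
    exact isClosed_univ
  · rw [h]
    exact isClosed_half β p

theorem IsEnclosed.mem_of_mem_facet {x : P} {S : Set V} (hS : 𝔸.IsVFacet S) {T : Set P}
    (hTe : 𝔸.IsEnclosed T) (hT : T ∈ 𝔸.facet x S) : x ∈ T :=
  hTe.isClosed.closure_eq ▸ mem_closure_of_mem_facet hS hT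

theorem isEmbedding_affineEquiv (t : P ≃ᵃ[ℝ] P) : IsEmbedding t :=
  Homeomorph.isEmbedding
    { toEquiv := t.toEquiv
      continuous_toFun := t.toAffineMap.continuous_of_finiteDimensional
      continuous_invFun := t.symm.toAffineMap.continuous_of_finiteDimensional }

theorem facet_image_le_map {t : P ≃ᵃ[ℝ] P} (ht : t ∈ 𝔸.affineWeyl) (x : P) (S : Set V) :
    𝔸.facet (t x) (t.linear '' S) ≤ (𝔸.facet x S).map t := by
  rintro U ⟨T, hT, hTm, hTU⟩
  refine ⟨t '' T, hT.image ht, ?_, image_subset_iff.2 hTU⟩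
  have himage : t '' ((fun v => v +ᵥ x) '' S) = (fun v => v +ᵥ t x) '' (t.linear '' S) := by
    simp only [image_image, AffineEquiv.map_vadd]
  rw [localFacet, germ, ← himage, ← (isEmbedding_affineEquiv t).map_nhdsWithin_eq]
  exact image_mem_map hTm

theorem map_facet {t : P ≃ᵃ[ℝ] P} (ht : t ∈ 𝔸.affineWeyl) (x : P) (S : Set V) :
    (𝔸.facet x S).map t = 𝔸.facet (t x) (t.linear '' S) := by
  refine le_antisymm ?_ (facet_image_le_map ht x S)
  have hinv := facet_image_le_map (inv_mem ht) (t x) (t.linear '' S)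
  have hpoint : (t⁻¹ : P ≃ᵃ[ℝ] P) (t x) = x := t.symm_apply_apply x
  have hdir : (t⁻¹ : P ≃ᵃ[ℝ] P).linear '' (t.linear '' S) = S :=
    t.linear.symm_image_image S
  rw [hpoint, hdir] at hinv
  have hcomp : t ∘ (t⁻¹ : P ≃ᵃ[ℝ] P) = id := funext t.apply_symm_apply
  simpa only [map_map, hcomp, map_id] using map_mono (m := t) hinv

theorem map_le_adherence_map {t : P ≃ᵃ[ℝ] P} {F C : Filter P} (h : F ≤ adherence C) :
    F.map t ≤ adherence (C.map t) := by
  intro U hU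
  obtain ⟨T, hT, hTU⟩ := mem_adherence.1 hU
  have hcont : Continuous t := t.toAffineMap.continuous_of_finiteDimensional
  have hpre : closure (t ⁻¹' T) ∈ F := h (mem_adherence.2 ⟨_, hT, Subset.rfl⟩)
  exact mem_map.2 (mem_of_superset hpre fun z hz =>
    hTU (hcont.closure_preimage_subset T hz))

end Facets

/-! ### Germs of chimneys -/

section Chimneys

variable {I V P : Type*} [Fintype I] [NormedAddCommGroup V] [NormedSpace ℝ V]
  [MetricSpace P] [NormedAddTorsor V P] {𝔸 : Model I V P} {F : Filter P} {S : Set V}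

theorem mem_chimney_map_vadd {ξ : V} {U : Set P} :
    U ∈ 𝔸.chimney (F.map fun x => ξ +ᵥ x) S ↔
      ∃ T, 𝔸.IsEnclosed T ∧ T ⊆ U ∧ ∃ W ∈ F, ∀ u ∈ W, ∀ s ∈ S, s +ᵥ (ξ +ᵥ u) ∈ T := by
  constructor
  · rintro ⟨T, hTe, hT, hTU⟩
    obtain ⟨W, hW, S', hS', hsub⟩ := mem_map₂_iff.1 hT
    exact ⟨T, hTe, hTU, _, hW, fun u hu s hs =>
      hsub ⟨_, hu, s, mem_principal.1 hS' hs, rfl⟩⟩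
  · rintro ⟨T, hTe, hTU, W, hW, h⟩
    refine ⟨T, hTe, mem_map₂_iff.2 ⟨_, image_mem_map hW, S, mem_principal_self S, ?_⟩, hTU⟩
    rintro _ ⟨_, ⟨u, hu, rfl⟩, s, hs, rfl⟩
    exact h u hu s hs

variable [FiniteDimensional ℝ V]

theorem chimney_map_add_vadd_le (hS : 𝔸.IsVFacet S) (ξ : V) {η : V} (hη : η ∈ closure S) :
    𝔸.chimney (F.map fun x => (ξ + η) +ᵥ x) S ≤ 𝔸.chimney (F.map fun x => ξ +ᵥ x) S := by
  intro U hU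
  obtain ⟨T, hTe, hTU, W, hW, h⟩ := mem_chimney_map_vadd.1 hU
  refine mem_chimney_map_vadd.2 ⟨T, hTe, hTU, W, hW, fun u hu s hs => ?_⟩
  have := h u hu _ (hS.add_mem_of_mem_closure hs hη)
  rwa [vadd_vadd, add_assoc, add_comm η, ← vadd_vadd] at this

theorem mem_chimneyGerm (hS : 𝔸.IsVFacet S) {U : Set P} :
    U ∈ 𝔸.chimneyGerm F S ↔ ∃ ξ ∈ closure S, U ∈ 𝔸.chimney (F.map fun x => ξ +ᵥ x) S := by
  refine mem_biInf_of_directed (fun ξ hξ η hη => ?_) ⟨0, hS.zero_mem_closure⟩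
  refine ⟨ξ + η, hS.add_mem_closure hξ hη, chimney_map_add_vadd_le hS ξ hη, ?_⟩
  rw [add_comm]
  exact chimney_map_add_vadd_le hS η hξ

theorem IsEnclosed.mem_chimneyGerm_of_vadd_mem (hS : 𝔸.IsVFacet S) {T : Set P}
    (hTe : 𝔸.IsEnclosed T) (hT : T ∈ F) (hadd : ∀ t ∈ T, ∀ s ∈ S, s +ᵥ t ∈ T) :
    T ∈ 𝔸.chimneyGerm F S :=
  (mem_chimneyGerm hS).2 ⟨0, hS.zero_mem_closure, mem_chimney_map_vadd.2
    ⟨T, hTe, Subset.rfl, T, hT, by simpa only [zero_vadd] using hadd⟩⟩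

theorem IsEnclosed.mem_chimneyGerm_facet (hS : 𝔸.IsVFacet S) {a : P} {T : Set P}
    (hTe : 𝔸.IsEnclosed T) (hT : ∀ s ∈ S, s +ᵥ a ∈ T) : T ∈ 𝔸.chimneyGerm (𝔸.facet a S) S :=
  hTe.mem_chimneyGerm_of_vadd_mem hS (hTe.mem_facet (Eventually.of_forall hT))
    fun _ ht _ hs => hTe.vadd_mem hS hT hs ht

theorem exists_isEnclosed_of_mem_chimneyGerm (hS : 𝔸.IsVFacet S) {U : Set P}
    (hU : U ∈ 𝔸.chimneyGerm F S) :
    ∃ T, 𝔸.IsEnclosed T ∧ T ⊆ U ∧ T ∈ 𝔸.chimneyGerm F S ∧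
      ∃ ξ ∈ closure S, ∃ W ∈ F, ∀ u ∈ W, ∀ s ∈ S, s +ᵥ (ξ +ᵥ u) ∈ T := by
  obtain ⟨ξ, hξ, hUξ⟩ := (mem_chimneyGerm hS).1 hU
  obtain ⟨T, hTe, hTU, hW⟩ := mem_chimney_map_vadd.1 hUξ
  exact ⟨T, hTe, hTU, (mem_chimneyGerm hS).2
    ⟨ξ, hξ, mem_chimney_map_vadd.2 ⟨T, hTe, Subset.rfl, hW⟩⟩, ξ, hξ, hW⟩

theorem exists_vadd_of_mem_chimneyGerm (hS : 𝔸.IsVFacet S) {a : P} {U : Set P}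
    (hU : U ∈ 𝔸.chimneyGerm (𝔸.facet a S) S) :
    ∃ s₀ ∈ S, ∀ s ∈ S, s +ᵥ (s₀ +ᵥ a) ∈ U := by
  obtain ⟨T, -, hTU, -, ξ, hξ, W, hW, h⟩ := exists_isEnclosed_of_mem_chimneyGerm hS hU
  obtain ⟨s₀, hs₀, -, hm⟩ := exists_mem_of_mem_facet hS hW univ_mem
  refine ⟨s₀ + ξ, hS.add_mem_of_mem_closure hs₀ hξ, fun s hs => hTU ?_⟩
  have := h _ hm s hs
  rwa [vadd_vadd ξ, add_comm] at this

end Chimneys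

end Model

namespace Model

open SimpleRootData VectorialData

/-! ### Nested chambers -/

section Sides

variable {I V P : Type*} [Fintype I] [NormedAddCommGroup V] [NormedSpace ℝ V]
  [MetricSpace P] [NormedAddTorsor V P] {𝔸 : Model I V P} {α : Dual ℝ V} {p x y : P}
  {S Q Q' : Set V}

theorem neg_apply_vsub (α : Dual ℝ V) (x y : P) : (-α) (x -ᵥ y) = α (y -ᵥ x) := by
  rw [LinearMap.neg_apply, ← map_neg, neg_vsub_eq_vsub_rev]

theorem disjoint_half_openHalf_neg (α : Dual ℝ V) (p : P) :
    Disjoint (half α p) (openHalf (-α) p) := by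
  refine Set.disjoint_left.2 fun z (hz : 0 ≤ α (z -ᵥ p)) (hz' : 0 < (-α) (z -ᵥ p)) => ?_
  exact (neg_pos.1 hz').not_ge hz

theorem notMem_realRoots_of_mem_imRoots (hα : α ∈ 𝔸.imRoots) : α ∉ 𝔸.realRoots :=
  fun h => 𝔸.imRoots_ne_smul α hα α h 1 (one_smul ℝ α).symm

theorem isTrueAt_of_mem_imRoots (hα : α ∈ 𝔸.imRoots) (p : P) : 𝔸.IsTrueAt α p :=
  fun h => absurd h (notMem_realRoots_of_mem_imRoots hα)

theorem IsTrueAt.neg (h : 𝔸.IsTrueAt α p) : 𝔸.IsTrueAt (-α) p := fun hα => by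
  rw [wall_neg]
  exact h (by simpa only [neg_neg] using neg_mem_realRoots hα)

theorem openHalf_mem_facet_of_forall_pos (hα : α ∈ 𝔸.allRoots) (hp : 𝔸.IsTrueAt α p)
    (h : 0 ≤ α (y -ᵥ p)) (hS : ∀ s ∈ S, 0 < α s) : openHalf α p ∈ 𝔸.facet y S := by
  refine ⟨_, IsPart.isSemiEnclosed hα (Or.inr ⟨p, hp, Or.inr rfl⟩), mem_localFacet.2 ?_,
    Subset.rfl⟩
  refine Eventually.of_forall fun v hv => ?_
  rw [openHalf, mem_ofPred_eq, vadd_vsub_assoc, map_add]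
  exact add_pos_of_pos_of_nonneg (hS v hv) h

open scoped Classical in
theorem setOf_forall_pos_mem_facet {R : Set (Dual ℝ V)} (hR : R ⊆ 𝔸.realRoots)
    (hpos : ∀ γ ∈ R, ∀ q ∈ Q', 0 < γ q) {p : Dual ℝ V → P}
    (hp : ∀ γ ∈ R, wall γ (p γ) ∈ 𝔸.walls ∧ 0 ≤ γ (y -ᵥ p γ)) :
    {z | ∀ γ ∈ R, 0 < γ (z -ᵥ p γ)} ∈ 𝔸.facet y Q' := by
  refine ⟨_, ⟨fun γ => if γ ∈ R then openHalf γ (p γ) else univ, fun γ _ => ?_, rfl⟩,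
    mem_localFacet.2 (Eventually.of_forall fun v hv => mem_iInter₂.2 fun γ _ => ?_),
    fun z hz γ hγ => ?_⟩
  · by_cases hγ : γ ∈ R
    · exact Or.inr ⟨p γ, fun _ => (hp γ hγ).1, Or.inr (if_pos hγ)⟩
    · exact Or.inl (if_neg hγ)
  · change v +ᵥ y ∈ if γ ∈ R then openHalf γ (p γ) else univ
    split_ifs with hγ
    · rw [openHalf, mem_ofPred_eq, vadd_vsub_assoc, map_add]
      exact add_pos_of_pos_of_nonneg (hpos γ hγ v hv) (hp γ hγ).2
    · exact mem_univ _
  · have hzγ : z ∈ if γ ∈ R then openHalf γ (p γ) else univ :=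
      mem_iInter₂.1 hz γ (Or.inl (hR hγ))
    rwa [if_pos hγ] at hzγ

theorem exists_forall_pos_of_facet_le (hQ : 𝔸.IsVChamber Q) (hle : 𝔸.facet x Q ≤ 𝔸.facet y Q')
    {R : Set (Dual ℝ V)} (hR : R ⊆ 𝔸.realRoots) (hpos : ∀ γ ∈ R, ∀ q ∈ Q', 0 < γ q)
    {p : Dual ℝ V → P} (hp : ∀ γ ∈ R, wall γ (p γ) ∈ 𝔸.walls ∧ 0 ≤ γ (y -ᵥ p γ)) {q : V}
    (hq : q ∈ Q) : ∃ t : ℝ, 0 < t ∧ ∀ γ ∈ R, 0 < t * γ q + γ (x -ᵥ p γ) := by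
  have hx := mem_localFacet.1 (mem_localFacet_of_mem_facet
    (hle (setOf_forall_pos_mem_facet hR hpos hp)))
  have hcont : Continuous fun t : ℝ => t • q := by fun_prop
  have hev := (hcont.tendsto' 0 0 (zero_smul ℝ q)).eventually hx
  obtain ⟨t, ht, ht0⟩ := ((hev.filter_mono nhdsWithin_le_nhds).and
    (self_mem_nhdsWithin : Ioi (0 : ℝ) ∈ 𝓝[>] 0)).exists
  refine ⟨t, ht0, fun γ hγ => ?_⟩
  simpa only [vadd_vsub_assoc, map_add, map_smul, smul_eq_mul] using
    ht (hQ.isVFacet.smul_mem hq ht0) γ hγ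

variable [FiniteDimensional ℝ V]

theorem openHalf_mem_facet (hα : α ∈ 𝔸.allRoots) (hp : 𝔸.IsTrueAt α p) (h : 0 < α (y -ᵥ p)) :
    openHalf α p ∈ 𝔸.facet y S := by
  refine ⟨_, IsPart.isSemiEnclosed hα (Or.inr ⟨p, hp, Or.inr rfl⟩), mem_localFacet.2 ?_,
    Subset.rfl⟩
  have hcont : Continuous fun v : V => α ((v +ᵥ y) -ᵥ p) :=
    (continuous_apply_vsub α p).comp (by fun_prop)
  filter_upwards [hcont.continuousAt.eventually
    (lt_mem_nhds (by simpa only [zero_vadd] using h))] with v hv _ using hv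

theorem openHalf_or_openHalf_neg_mem_facet (hQ : 𝔸.IsVChamber Q) (hα : α ∈ 𝔸.allRoots)
    (hp : 𝔸.IsTrueAt α p) (y : P) :
    openHalf α p ∈ 𝔸.facet y Q ∨ openHalf (-α) p ∈ 𝔸.facet y Q := by
  have hα' : -α ∈ 𝔸.allRoots := neg_mem_roots hα
  rcases lt_trichotomy (α (y -ᵥ p)) 0 with h | h | h
  · exact Or.inr (openHalf_mem_facet hα' hp.neg (neg_pos.2 h))
  · refine (hQ.pos_or_neg hα).imp (openHalf_mem_facet_of_forall_pos hα hp h.ge) fun hneg => ?_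
    exact openHalf_mem_facet_of_forall_pos hα' hp.neg (neg_nonneg.2 h.le)
      fun s hs => neg_pos.2 (hneg s hs)
  · exact Or.inl (openHalf_mem_facet hα hp h)

end Sides

section Nested

variable {I V P : Type*} [Fintype I] [NormedAddCommGroup V] [NormedSpace ℝ V]
  [FiniteDimensional ℝ V] [MetricSpace P] [NormedAddTorsor V P] {𝔸 : Model I V P}
  {Q Q' : Set V} {x y : P}

theorem IsPart.mem_facet_of_facet_le (hQ : 𝔸.IsVChamber Q) (hQ' : 𝔸.IsVChamber Q')
    (hle : 𝔸.facet x Q ≤ 𝔸.facet y Q') {α : Dual ℝ V} (hα : α ∈ 𝔸.allRoots) {D : Set P}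
    (hD : 𝔸.IsPart α D) (hDx : D ∈ 𝔸.facet x Q) : D ∈ 𝔸.facet y Q' := by
  rcases hD with rfl | ⟨p, hp, hD⟩
  · exact univ_mem
  have hsub : openHalf α p ⊆ D ∧ D ⊆ half α p := by
    rcases hD with rfl | rfl
    · exact ⟨openHalf_subset_half α p, Subset.rfl⟩
    · exact ⟨Subset.rfl, openHalf_subset_half α p⟩
  rcases openHalf_or_openHalf_neg_mem_facet hQ' hα hp y with h | h
  · exact mem_of_superset h hsub.1
  · exact absurd (disjoint_half_openHalf_neg α p)
      ((facet_neBot hQ.isVFacet).not_disjoint (mem_of_superset hDx hsub.2) (hle h))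

theorem not_between_of_facet_le (hQ : 𝔸.IsVChamber Q) (hle : 𝔸.facet x Q ≤ 𝔸.facet y Q')
    {α : Dual ℝ V} (hα : α ∈ 𝔸.allRoots) {p : P} (hp : 𝔸.IsTrueAt α p) :
    ¬ (0 < α (p -ᵥ x) ∧ 0 < α (y -ᵥ p)) := by
  rintro ⟨hpx, hyp⟩
  have hy := hle (openHalf_mem_facet (S := Q') hα hp hyp)
  have hx : openHalf (-α) p ∈ 𝔸.facet x Q :=
    openHalf_mem_facet (neg_mem_roots hα) hp.neg (by rwa [neg_apply_vsub])
  exact (facet_neBot hQ.isVFacet).not_disjoint (mem_of_superset hy (openHalf_subset_half α p)) hx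
    (disjoint_half_openHalf_neg α p)

theorem apply_vsub_eq_zero_of_facet_le (hQ : 𝔸.IsVChamber Q)
    (hle : 𝔸.facet x Q ≤ 𝔸.facet y Q') {α : Dual ℝ V} (hα : α ∈ 𝔸.allRoots)
    (hdense : ∀ u v : P, 0 < α (v -ᵥ u) → ∃ p, 𝔸.IsTrueAt α p ∧ 0 < α (p -ᵥ u) ∧ 0 < α (v -ᵥ p)) :
    α (y -ᵥ x) = 0 := by
  rcases lt_trichotomy (α (y -ᵥ x)) 0 with h | h | h
  · obtain ⟨p, hp, hpy, hxp⟩ := hdense y x (by rwa [← neg_apply_vsub, LinearMap.neg_apply, neg_pos])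
    exact absurd ⟨(neg_apply_vsub α p x).symm ▸ hxp, (neg_apply_vsub α y p).symm ▸ hpy⟩
      (not_between_of_facet_le hQ hle (neg_mem_roots hα) hp.neg)
  · exact h
  · obtain ⟨p, hp, hbetween⟩ := hdense x y h
    exact absurd hbetween (not_between_of_facet_le hQ hle hα hp)

theorem apply_vsub_eq_zero_of_mem_imRoots (hQ : 𝔸.IsVChamber Q)
    (hle : 𝔸.facet x Q ≤ 𝔸.facet y Q') {α : Dual ℝ V} (hα : α ∈ 𝔸.imRoots) : α (y -ᵥ x) = 0 := by
  refine apply_vsub_eq_zero_of_facet_le hQ hle (Or.inr hα) fun u v huv =>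
    ⟨(1 / 2 : ℝ) • (v -ᵥ u) +ᵥ u, isTrueAt_of_mem_imRoots hα _, ?_, ?_⟩
  · rw [vadd_vsub, map_smul, smul_eq_mul]
    linarith
  · rw [vsub_vadd_eq_vsub_sub, map_sub, map_smul, smul_eq_mul]
    linarith

theorem apply_vsub_eq_zero_of_not_isDiscrete (hQ : 𝔸.IsVChamber Q)
    (hle : 𝔸.facet x Q ≤ 𝔸.facet y Q') {γ : Dual ℝ V} (hγ : γ ∈ 𝔸.realRoots)
    (hd : ¬ 𝔸.IsDiscrete γ) : γ (y -ᵥ x) = 0 :=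
  apply_vsub_eq_zero_of_facet_le hQ hle (Or.inl hγ) fun _ _ huv =>
    (exists_wall_between_of_not_isDiscrete hd huv).imp fun _ h => ⟨fun _ => h.1, h.2⟩

theorem apply_vsub_le_of_facet_le (hQ : 𝔸.IsVChamber Q) (hle : 𝔸.facet x Q ≤ 𝔸.facet y Q')
    {γ : Dual ℝ V} (hγ : γ ∈ 𝔸.realRoots) {p : P} (hp : wall γ p ∈ 𝔸.walls) {G : ℝ}
    (hpx : γ (p -ᵥ x) ∈ Ioc 0 G) : γ (y -ᵥ x) ≤ G := by
  have hyp : γ (y -ᵥ p) ≤ 0 := not_lt.1 fun h =>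
    not_between_of_facet_le hQ hle (Or.inl hγ) (fun _ => hp) ⟨hpx.1, h⟩
  rw [← vsub_add_vsub_cancel y p x, map_add]
  linarith [hpx.2]

theorem mem_realRoots_of_neg_of_pos (hQ : 𝔸.IsVChamber Q)
    (hle : 𝔸.facet x Q ≤ 𝔸.facet y Q') {α : Dual ℝ V} (hα : α ∈ 𝔸.allRoots)
    (hneg : ∀ q ∈ Q, α q < 0) (hpos : ∀ q ∈ Q', 0 < α q) : α ∈ 𝔸.realRoots := by
  refine hα.resolve_right fun him => ?_
  have hy : openHalf α y ∈ 𝔸.facet y Q' :=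
    openHalf_mem_facet_of_forall_pos hα (isTrueAt_of_mem_imRoots him y) (by simp) hpos
  obtain ⟨q, hq, -, hqy⟩ := exists_mem_of_mem_facet hQ.isVFacet (hle hy) univ_mem
  rw [openHalf, mem_ofPred_eq, vadd_vsub_assoc, map_add, ← neg_apply_vsub, LinearMap.neg_apply,
    apply_vsub_eq_zero_of_mem_imRoots hQ hle him, neg_zero, add_zero] at hqy
  exact lt_asymm hqy (hneg q hq)

theorem finite_setOf_isDiscrete_pos_le (hQ : 𝔸.IsVChamber Q) {q : V} (hq : q ∈ Q) (K : ℝ) :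
    {γ ∈ 𝔸.realRoots | 𝔸.IsDiscrete γ ∧ (∀ q ∈ Q, 0 < γ q) ∧ γ q ≤ K}.Finite := by
  classical
  choose v hv using fun j =>
    exists_forall_dual_apply_eq 𝔸.linearIndependent_root (Pi.single j (1 : ℝ))
  have hnear (j : I) : ∀ᶠ t : ℝ in 𝓝 0, q - t • v j ∈ Q ∧ q + t • v j ∈ Q := by
    have hsub : Continuous fun t : ℝ => q - t • v j := by fun_prop
    have hadd : Continuous fun t : ℝ => q + t • v j := by fun_prop
    have hQq := hQ.isOpen.mem_nhds hq
    exact ((hsub.tendsto' 0 q (by simp)).eventually hQq).and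
      ((hadd.tendsto' 0 q (by simp)).eventually hQq)
  obtain ⟨t, ht, ht0⟩ := (((eventually_all.2 hnear).filter_mono nhdsWithin_le_nhds).and
    (self_mem_nhdsWithin : Ioi (0 : ℝ) ∈ 𝓝[>] 0)).exists
  replace ht0 : 0 < t := ht0
  refine (finite_setOf_isDiscrete_abs_le (𝔸 := 𝔸) (K / t) (v := v) (fun i => by simp [hv])
    (fun i j hij => by simp [hv, hij])).subset ?_
  rintro γ ⟨hγ, hd, hpos, hK⟩
  refine ⟨hγ, hd, fun j => ?_⟩
  have hsub := hpos _ (ht j).1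
  have hadd := hpos _ (ht j).2
  rw [map_sub, map_smul, smul_eq_mul] at hsub
  rw [map_add, map_smul, smul_eq_mul] at hadd
  refine (le_div_iff₀ ht0).2 ?_
  calc |γ (v j)| * t = |t * γ (v j)| := by rw [abs_mul, abs_of_pos ht0, mul_comm]
    _ ≤ K := abs_le.2 ⟨by linarith, by linarith⟩

theorem finite_setOf_isDiscrete_neg_pos (hQ : 𝔸.IsVChamber Q)
    (hle : 𝔸.facet x Q ≤ 𝔸.facet y Q') :
    {γ ∈ 𝔸.realRoots | 𝔸.IsDiscrete γ ∧ (∀ q ∈ Q, γ q < 0) ∧ ∀ q ∈ Q', 0 < γ q}.Finite := by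
  obtain ⟨q, hq⟩ := hQ.isVFacet.nonempty
  obtain ⟨G, hG⟩ := exists_gap 𝔸
  have hbelow (γ) (hγ : γ ∈ 𝔸.realRoots) : ∃ p, wall γ p ∈ 𝔸.walls ∧ γ (y -ᵥ p) ∈ Ioc 0 G := by
    simpa only [wall_neg, neg_apply_vsub] using hG (-γ) (neg_mem_realRoots hγ) y
  choose! p hp hpG using hbelow
  obtain ⟨t, ht0, ht⟩ := exists_forall_pos_of_facet_le hQ hle
    (R := {γ ∈ 𝔸.realRoots | ∀ q ∈ Q', 0 < γ q}) (fun _ h => h.1) (fun _ h => h.2)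
    (fun γ h => ⟨hp γ h.1, (hpG γ h.1).1.le⟩) hq
  refine ((finite_setOf_isDiscrete_pos_le hQ hq ((G + G) / t)).image Neg.neg).subset ?_
  rintro γ ⟨hγ, hd, hneg, hpos⟩
  refine ⟨-γ, ⟨neg_mem_realRoots hγ, hd.neg, fun q hq => neg_pos.2 (hneg q hq), ?_⟩, neg_neg γ⟩
  obtain ⟨r, hr, hrx⟩ := hG (-γ) (neg_mem_realRoots hγ) x
  have hxy := apply_vsub_le_of_facet_le hQ hle (neg_mem_realRoots hγ) hr hrx
  rw [neg_apply_vsub] at hxy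
  have hxp := ht γ ⟨hγ, hpos⟩
  rw [← vsub_add_vsub_cancel x y, map_add] at hxp
  rw [LinearMap.neg_apply, le_div_iff₀ ht0]
  linarith [(hpG γ hγ).2]

theorem finite_setOf_not_isDiscrete_neg_pos (hQ : 𝔸.IsVChamber Q)
    (hle : 𝔸.facet x Q ≤ 𝔸.facet y Q') :
    {γ ∈ 𝔸.realRoots | ¬ 𝔸.IsDiscrete γ ∧ (∀ q ∈ Q, γ q < 0) ∧ ∀ q ∈ Q', 0 < γ q}.Finite := by
  obtain ⟨q, hq⟩ := hQ.isVFacet.nonempty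
  by_contra hinf
  let f := Set.Infinite.natEmbedding _ hinf
  set R := {γ ∈ 𝔸.realRoots | ¬ 𝔸.IsDiscrete γ ∧ (∀ q ∈ Q, γ q < 0) ∧ ∀ q ∈ Q', 0 < γ q}
  let rank : Dual ℝ V → ℕ := Function.invFun fun n => (f n : Dual ℝ V)
  have hrank (n : ℕ) : rank (f n) = n :=
    Function.leftInverse_invFun (Subtype.val_injective.comp f.injective) n
  -- Walls of `f n` so close to `y` that no multiple of `q` crosses all of them.
  have hclose (γ) (hγ : γ ∈ R) : ∃ p, wall γ p ∈ 𝔸.walls ∧ 0 < γ (y -ᵥ p) ∧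
      γ (y -ᵥ p) * (rank γ + 1) < -γ q := by
    have hqγ := hγ.2.2.1 q hq
    have hval : γ (y -ᵥ ((rank γ + 1 : ℝ)⁻¹ • q +ᵥ y)) = -γ q / (rank γ + 1) := by
      rw [vsub_vadd_eq_vsub_sub, vsub_self, zero_sub, map_neg, map_smul, smul_eq_mul]
      ring
    obtain ⟨p, hp, hpz, hyp⟩ := exists_wall_between_of_not_isDiscrete hγ.2.1
      (hval ▸ div_pos (neg_pos.2 hqγ) (by positivity))
    refine ⟨p, hp, hyp, (lt_div_iff₀ (by positivity)).1 ?_⟩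
    rw [← hval, ← vsub_add_vsub_cancel y p (_ +ᵥ y), map_add]
    exact lt_add_of_pos_right _ hpz
  choose! p hp hyp hpq using hclose
  obtain ⟨t, ht0, ht⟩ := exists_forall_pos_of_facet_le hQ hle (R := R) (fun _ h => h.1)
    (fun _ h => h.2.2.2) (fun γ h => ⟨hp γ h, (hyp γ h).le⟩) hq
  obtain ⟨n, hn⟩ := exists_nat_gt (1 / t)
  rw [div_lt_iff₀ ht0] at hn
  have hγ := (f n).2
  have hxy := apply_vsub_eq_zero_of_not_isDiscrete hQ hle hγ.1 hγ.2.1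
  have hpos := ht _ hγ
  have hlt := hpq _ hγ
  rw [← vsub_add_vsub_cancel x y, map_add, ← neg_apply_vsub, LinearMap.neg_apply, hxy] at hpos
  rw [hrank] at hlt
  nlinarith [hγ.2.2.1 q hq, hyp _ hγ]

theorem finite_setOf_neg_pos (hQ : 𝔸.IsVChamber Q)
    (hle : 𝔸.facet x Q ≤ 𝔸.facet y Q') :
    {γ ∈ 𝔸.allRoots | (∀ q ∈ Q, γ q < 0) ∧ ∀ q ∈ Q', 0 < γ q}.Finite := by
  refine ((finite_setOf_isDiscrete_neg_pos hQ hle).union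
    (finite_setOf_not_isDiscrete_neg_pos hQ hle)).subset fun γ ⟨hγ, hneg, hpos⟩ => ?_
  have hreal := mem_realRoots_of_neg_of_pos hQ hle hγ hneg hpos
  exact (em (𝔸.IsDiscrete γ)).imp (⟨hreal, ·, hneg, hpos⟩) (⟨hreal, ·, hneg, hpos⟩)

/-- The roots left aside are the only ones whose half-spaces may cut the chamber of direction `Q'`
arbitrarily close to `y`. -/
theorem finite_setOf_neg_and_not (hQ : 𝔸.IsVChamber Q)
    (hle : 𝔸.facet x Q ≤ 𝔸.facet y Q') {q : V} (hq : q ∈ Q) :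
    {α ∈ 𝔸.allRoots | (∀ s ∈ Q', α s < 0) ∧
      ¬ ((∀ s ∈ Q, α s < 0) ∧ α q ≤ α (y -ᵥ x) + α (y -ᵥ x))}.Finite := by
  obtain ⟨G, hG⟩ := exists_gap 𝔸
  refine (((finite_setOf_neg_pos hQ hle).image Neg.neg).union
    ((finite_setOf_isDiscrete_pos_le hQ hq (G + G)).image Neg.neg)).subset ?_
  rintro α ⟨hα, hneg', hnot⟩
  refine (hQ.pos_or_neg hα).imp (fun hpos => ?_) fun hneg => ?_
  · exact ⟨-α, ⟨neg_mem_roots hα, fun s hs => neg_neg_of_pos (hpos s hs),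
      fun s hs => neg_pos.2 (hneg' s hs)⟩, neg_neg α⟩
  · have hlt : α (y -ᵥ x) + α (y -ᵥ x) < α q := not_le.1 fun h => hnot ⟨hneg, h⟩
    have hne : α (y -ᵥ x) ≠ 0 := fun h => by
      rw [h, add_zero] at hlt
      exact lt_asymm hlt (hneg q hq)
    have hreal : α ∈ 𝔸.realRoots :=
      hα.resolve_right fun h => hne (apply_vsub_eq_zero_of_mem_imRoots hQ hle h)
    have hd : 𝔸.IsDiscrete α :=
      not_not.1 fun h => hne (apply_vsub_eq_zero_of_not_isDiscrete hQ hle hreal h)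
    obtain ⟨r, hr, hrx⟩ := hG (-α) (neg_mem_realRoots hreal) x
    have hyx := apply_vsub_le_of_facet_le hQ hle (neg_mem_realRoots hreal) hr hrx
    rw [LinearMap.neg_apply] at hyx
    refine ⟨-α, ⟨neg_mem_realRoots hreal, hd.neg, fun s hs => neg_pos.2 (hneg s hs), ?_⟩, neg_neg α⟩
    rw [LinearMap.neg_apply]
    linarith

theorem eventually_forall_isPart_vadd_mem (hQ : 𝔸.IsVChamber Q) (hQ' : 𝔸.IsVChamber Q')
    (hle : 𝔸.facet x Q ≤ 𝔸.facet y Q') {D : Dual ℝ V → Set P}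
    (hD : ∀ α ∈ 𝔸.allRoots, 𝔸.IsPart α (D α)) (hDy : ∀ α ∈ 𝔸.allRoots, D α ∈ 𝔸.facet y Q') {q : V}
    (hq : q ∈ Q) (hqD : ∀ α ∈ 𝔸.allRoots, q +ᵥ x ∈ D α) :
    ∀ᶠ v in 𝓝 (0 : V), v ∈ Q' → ∀ α ∈ 𝔸.allRoots, v +ᵥ y ∈ D α := by
  have hnear := (eventually_all_finite (finite_setOf_neg_and_not hQ hle hq)).2 fun α h =>
    mem_localFacet.1 (mem_localFacet_of_mem_facet (hDy α h.1))
  have hhalf := hQ.eventually_sub_mem (hQ.isVFacet.smul_mem hq (one_half_pos (α := ℝ)))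
  filter_upwards [hnear, hhalf] with v hv hvq hvQ' α hα
  rcases hQ'.pos_or_neg hα with hpos | hneg
  · obtain ⟨s, -, hsv, hs⟩ := exists_mem_of_mem_facet hQ'.isVFacet (hDy α hα)
      (hQ'.eventually_sub_mem hvQ')
    refine (hD α hα).mem_of_nonneg hs ?_
    rw [vadd_vsub_vadd_cancel_right]
    exact (hpos _ hsv).le
  · by_cases h : (∀ s ∈ Q, α s < 0) ∧ α q ≤ α (y -ᵥ x) + α (y -ᵥ x)
    · refine (hD α hα).mem_of_nonneg (hqD α hα) ?_
      have hvlt := h.1 _ hvq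
      rw [map_sub, map_smul, smul_eq_mul] at hvlt
      rw [vadd_vsub_vadd_comm, map_add, map_sub]
      linarith [h.2]
    · exact hv α ⟨hα, hneg, h⟩ hvQ'

theorem facet_eq_of_facet_le (hQ : 𝔸.IsVChamber Q) (hQ' : 𝔸.IsVChamber Q')
    (hle : 𝔸.facet x Q ≤ 𝔸.facet y Q') : 𝔸.facet x Q = 𝔸.facet y Q' := by
  refine le_antisymm hle ?_
  rintro U ⟨_, ⟨D, hD, rfl⟩, hTx, hTU⟩
  refine ⟨_, ⟨D, hD, rfl⟩, mem_localFacet.2 ?_, hTU⟩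
  obtain ⟨q, hq, -, hqT⟩ := exists_mem_of_mem_localFacet hQ.isVFacet hTx univ_mem
  have hDx (α) (hα : α ∈ 𝔸.allRoots) : D α ∈ 𝔸.facet x Q :=
    ⟨_, ⟨D, hD, rfl⟩, hTx, biInter_subset_of_mem hα⟩
  have hDy (α) (hα : α ∈ 𝔸.allRoots) : D α ∈ 𝔸.facet y Q' :=
    (hD α hα).mem_facet_of_facet_le hQ hQ' hle hα (hDx α hα)
  filter_upwards [eventually_forall_isPart_vadd_mem hQ hQ' hle hD hDy hq (mem_iInter₂.1 hqT)]
    with v hv hvQ' using mem_iInter₂.2 (hv hvQ')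

end Nested

end Model

namespace Model

open SimpleRootData VectorialData

/-! ### Panels and their chambers -/

section PanelChambers

variable {I V P : Type*} [Fintype I] [NormedAddCommGroup V] [NormedSpace ℝ V]
  [MetricSpace P] [NormedAddTorsor V P] {𝔸 : Model I V P} {S : Set V} {β : Dual ℝ V}

theorem IsPart.exists_isClosedPart_superset {α : Dual ℝ V} {D : Set P} (hD : 𝔸.IsPart α D) :
    ∃ D', 𝔸.IsClosedPart α D' ∧ D ⊆ D' ∧
      ∀ z ∈ D', ∀ y ∈ D, ∀ t ∈ Ioc (0 : ℝ) 1, t • (y -ᵥ z) +ᵥ z ∈ D := by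
  have hval (p z y : P) (t : ℝ) : α ((t • (y -ᵥ z) +ᵥ z) -ᵥ p) =
      t * α (y -ᵥ p) + (1 - t) * α (z -ᵥ p) := by
    rw [vadd_vsub_assoc, map_add, map_smul, smul_eq_mul, ← vsub_sub_vsub_cancel_right y z p,
      map_sub]
    ring
  rcases hD with rfl | ⟨p, hp, rfl | rfl⟩
  · exact ⟨univ, Or.inl rfl, Subset.rfl, fun _ _ _ _ _ _ => mem_univ _⟩
  · refine ⟨half α p, Or.inr ⟨p, hp, rfl⟩, Subset.rfl, fun z hz y hy t ht => ?_⟩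
    rw [half, mem_ofPred_eq, hval]
    exact add_nonneg (mul_nonneg ht.1.le hy) (mul_nonneg (sub_nonneg.2 ht.2) hz)
  · refine ⟨half α p, Or.inr ⟨p, hp, rfl⟩, openHalf_subset_half α p, fun z hz y hy t ht => ?_⟩
    rw [openHalf, mem_ofPred_eq, hval]
    exact add_pos_of_pos_of_nonneg (mul_pos ht.1 hy) (mul_nonneg (sub_nonneg.2 ht.2) hz)

theorem IsSemiEnclosed.exists_isEnclosed_subset_closure {T : Set P} (hT : 𝔸.IsSemiEnclosed T)
    (hne : T.Nonempty) : ∃ E, 𝔸.IsEnclosed E ∧ T ⊆ E ∧ E ⊆ closure T := by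
  obtain ⟨D, hD, rfl⟩ := hT
  obtain ⟨y, hy⟩ := hne
  choose! D' hD' hsub hsegment using
    fun α (hα : α ∈ 𝔸.allRoots) => (hD α hα).exists_isClosedPart_superset
  refine ⟨_, ⟨D', hD', rfl⟩, iInter₂_mono hsub, fun z hz => ?_⟩
  have hcont : Continuous fun t : ℝ => t • (y -ᵥ z) +ᵥ z := by fun_prop
  refine mem_closure_of_tendsto (b := 𝓝[>] (0 : ℝ))
    ((hcont.tendsto' 0 z (by rw [zero_smul, zero_vadd])).mono_left nhdsWithin_le_nhds) ?_
  filter_upwards [Ioc_mem_nhdsGT one_pos] with t ht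
  exact mem_iInter₂.2 fun α hα =>
    hsegment α hα z (mem_iInter₂.1 hz α hα) y (mem_iInter₂.1 hy α hα) t ht

variable [FiniteDimensional ℝ V]

theorem IsPart.mem_of_mem_closure {α : Dual ℝ V} {D : Set P} (hD : 𝔸.IsPart α D) {z y : P}
    (hz : z ∈ closure D) (h : 0 < α (y -ᵥ z)) : y ∈ D := by
  have hcont : Continuous fun u : P => α (y -ᵥ u) :=
    α.continuous_of_finiteDimensional.comp (by fun_prop)
  obtain ⟨u, hu, huD⟩ := mem_closure_iff_nhds.1 hz _ (hcont.continuousAt.eventually (lt_mem_nhds h))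
  exact hD.mem_of_nonneg huD (le_of_lt hu)

theorem mem_localFacet_of_mem_closure (h : 𝔸.IsPanelDir S β) {Q : Set V} (hQ : 𝔸.IsSide S β Q)
    {T : Set P} (hT : 𝔸.IsSemiEnclosed T) {x : P} (hx : x ∈ closure T) {s : V} (hs : s ∈ S)
    (hsT : s +ᵥ x ∈ closure T) {z : P} (hz : z ∈ T) (hzx : 0 < β (z -ᵥ x)) :
    T ∈ localFacet x Q := by
  obtain ⟨D, hD, rfl⟩ := hT
  have hclosure {α} (hα : α ∈ 𝔸.allRoots) : closure (⋂ γ ∈ 𝔸.allRoots, D γ) ⊆ closure (D α) :=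
    closure_mono (biInter_subset_of_mem hα)
  have hpos : ∀ᶠ v in 𝓝 (0 : V), ∀ α ∈ 𝔸.allRoots, (∀ s ∈ S, 0 < α s) → 0 < α (s - v) :=
    ((continuous_sub_left s).tendsto' 0 s (sub_zero s)).eventually
      (h.eventually_forall_roots_pos hs)
  have hlt : ∀ᶠ v in 𝓝 (0 : V), β v < β (z -ᵥ x) :=
    (β.continuous_of_finiteDimensional.tendsto' 0 0 (map_zero β)).eventually (gt_mem_nhds hzx)
  refine mem_localFacet.2 ?_
  filter_upwards [hpos, hlt] with v hv hvz hvQ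
  refine mem_iInter₂.2 fun α hα => ?_
  rcases h.eq_or_eq_neg_or_pos_or_neg hα with rfl | rfl | hp | hn
  · exact (hD _ hα).mem_of_mem_closure (hclosure hα hx)
      (by simpa only [vadd_vsub] using hQ.pos v hvQ)
  · refine (hD _ hα).mem_of_nonneg (mem_iInter₂.1 hz _ hα) ?_
    rw [neg_apply_vsub, vsub_vadd_eq_vsub_sub, map_sub]
    exact (sub_pos.2 hvz).le
  · exact (hD _ hα).mem_of_mem_closure (hclosure hα hx)
      (by simpa only [vadd_vsub] using hQ.pos_of_pos α hα hp v hvQ)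
  · refine (hD _ hα).mem_of_mem_closure (hclosure hα hsT) ?_
    have hneg := hv (-α) (neg_mem_roots hα) fun u hu => neg_pos.2 (hn u hu)
    rwa [vadd_vsub_vadd_cancel_right, ← neg_sub, map_neg, ← LinearMap.neg_apply]

theorem facet_eq_of_dominates (h : 𝔸.IsPanelDir S β) {Q : Set V} (hQ : 𝔸.IsSide S β Q)
    {x y : P} {Q' : Set V} (hQ' : 𝔸.IsVChamber Q')
    (hdom : 𝔸.facet x S ≤ adherence (𝔸.facet y Q')) (hside : openHalf β x ∈ 𝔸.facet y Q') :
    𝔸.facet y Q' = 𝔸.facet x Q := by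
  refine (facet_eq_of_facet_le hQ.chamber hQ' ?_).symm
  rintro U ⟨T, hT, hTm, hTU⟩
  have hTy : T ∈ 𝔸.facet y Q' := ⟨T, hT, hTm, Subset.rfl⟩
  have hclosure : closure T ∈ 𝔸.facet x S := hdom (mem_adherence.2 ⟨T, hTy, Subset.rfl⟩)
  obtain ⟨s, hs, -, hsT⟩ := exists_mem_of_mem_facet h.isVFacet hclosure univ_mem
  have hxT : x ∈ closure T := by
    simpa only [closure_closure] using mem_closure_of_mem_facet h.isVFacet hclosure
  obtain ⟨z, hzT, hz⟩ := (facet_neBot hQ'.isVFacet).nonempty_of_mem (inter_mem hTy hside)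
  exact ⟨T, hT, mem_localFacet_of_mem_closure h hQ hT hxT hs hsT hzT hz, hTU⟩

theorem facet_eq_or_of_dominates (h : 𝔸.IsPanelDir S β) {Q₁ Q₂ : Set V} (hQ₁ : 𝔸.IsSide S β Q₁)
    (hQ₂ : 𝔸.IsSide S (-β) Q₂) {x y : P} (hx : wall β x ∈ 𝔸.walls) {Q' : Set V}
    (hQ' : 𝔸.IsVChamber Q') (hdom : 𝔸.facet x S ≤ adherence (𝔸.facet y Q')) :
    𝔸.facet y Q' = 𝔸.facet x Q₁ ∨ 𝔸.facet y Q' = 𝔸.facet x Q₂ :=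
  (openHalf_or_openHalf_neg_mem_facet hQ' (Or.inl h.real) (fun _ => hx) y).imp
    (facet_eq_of_dominates h hQ₁ hQ' hdom) (facet_eq_of_dominates h.neg_root hQ₂ hQ' hdom)

theorem facet_le_adherence_of_isSide {Q : Set V} (hQ : 𝔸.IsSide S β Q) (a : P) :
    𝔸.facet a S ≤ adherence (𝔸.facet a Q) := by
  intro U hU
  obtain ⟨T', ⟨T, hT, hTm, hTT'⟩, hU⟩ := mem_adherence.1 hU
  refine mem_of_superset ?_ ((closure_mono hTT').trans hU)
  obtain ⟨q, hq, -, hqT⟩ := exists_mem_of_mem_localFacet hQ.chamber.isVFacet hTm univ_mem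
  obtain ⟨E, hE, hTE, hEcl⟩ := hT.exists_isEnclosed_subset_closure ⟨_, hqT⟩
  refine mem_of_superset (hE.mem_facet ?_) hEcl
  filter_upwards [eventually_eventually_nhds.2 (mem_localFacet.1 hTm)] with v hv hvS
  have hcont : Continuous fun t : ℝ => v + t • q := by fun_prop
  have htendsto : Tendsto (fun t : ℝ => v + t • q) (𝓝[>] 0) (𝓝 v) :=
    (hcont.tendsto' 0 v (by rw [zero_smul, add_zero])).mono_left nhdsWithin_le_nhds
  refine hE.isClosed.mem_of_tendsto (htendsto.vadd (tendsto_const_nhds (x := a))) ?_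
  filter_upwards [htendsto.eventually hv, self_mem_nhdsWithin] with t ht ht0
  exact hTE (ht (hQ.add_mem v hvS _ (hQ.chamber.isVFacet.smul_mem hq ht0)))

end PanelChambers

/-! ### Solid chimneys -/

section SolidChimneys

variable {I V P : Type*} [Fintype I] [NormedAddCommGroup V] [NormedSpace ℝ V]
  [FiniteDimensional ℝ V] [MetricSpace P] [NormedAddTorsor V P] {𝔸 : Model I V P}
  {S S' : Set V} {β : Dual ℝ V}

theorem vadd_mem_support_chimney (hS' : 𝔸.IsVFacet S') (x : P) {s : V} (hs : s ∈ S) :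
    s +ᵥ x ∈ support (𝔸.chimney (𝔸.facet x S') S) := by
  rw [support, ← SetLike.mem_coe, AffineSubspace.coe_sInf]
  refine mem_iInter₂.2 fun E ⟨T, hTe, hT, hTE⟩ => hTE ?_
  obtain ⟨W, hW, S₁, hS₁, hsub⟩ := mem_map₂_iff.1 hT
  have hmaps : MapsTo (fun z : P => s +ᵥ z) W T :=
    fun z hz => hsub ⟨z, hz, s, mem_principal.1 hS₁ hs, rfl⟩
  have hmem := hmaps.closure (by fun_prop) (mem_closure_of_mem_facet hS' hW)
  rwa [hTe.isClosed.closure_eq] at hmem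

theorem isSolid_chimney (hS : 𝔸.IsVFacet S) (hS' : 𝔸.IsVFacet S') (x : P)
    (hfin : {u : V ≃ₗ[ℝ] V | u ∈ 𝔸.weyl ∧ ∀ s ∈ S, u s = s}.Finite) :
    𝔸.IsSolid (𝔸.chimney (𝔸.facet x S') S) := by
  refine hfin.subset fun u ⟨hu, hfix⟩ => ⟨hu, fun s hs => hfix s ?_⟩
  have hsum := AffineSubspace.vsub_mem_direction
    (vadd_mem_support_chimney hS' x (hS.add_mem hs hs)) (vadd_mem_support_chimney hS' x hs)
  rwa [vadd_vsub_vadd_cancel_right, add_sub_cancel_right] at hsum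

theorem eq_one_of_forall_mem_chamber {Q : Set V} (hQ : 𝔸.IsVChamber Q) {u : V ≃ₗ[ℝ] V}
    (hu : ∀ q ∈ Q, u q = q) : u = 1 := by
  have hsub : Q ⊆ LinearMap.eqLocus (u : V →ₗ[ℝ] V) LinearMap.id := hu
  have htop := Submodule.eq_top_of_nonempty_interior' (LinearMap.eqLocus (u : V →ₗ[ℝ] V) _)
    (hQ.isVFacet.nonempty.mono (hQ.isOpen.subset_interior_iff.2 hsub))
  exact LinearEquiv.ext fun v => (htop ▸ Submodule.mem_top : v ∈ LinearMap.eqLocus _ _)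

theorem isSolid_chimney_of_isVChamber {Q : Set V} (hQ : 𝔸.IsVChamber Q) (x : P) :
    𝔸.IsSolid (𝔸.chimney (𝔸.facet x Q) Q) :=
  isSolid_chimney hQ.isVFacet hQ.isVFacet x
    ((Set.finite_singleton 1).subset fun _ hu => eq_one_of_forall_mem_chamber hQ hu.2)

end SolidChimneys

/-! ### Enclosed sets containing cones -/

section Cones

variable {I V P : Type*} [Fintype I] [NormedAddCommGroup V] [NormedSpace ℝ V]
  [MetricSpace P] [NormedAddTorsor V P] {𝔸 : Model I V P} {T : Set P}

theorem exists_nonneg_of_neg {C : Set V} (hC : 𝔸.IsVFacet C) {t : P}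
    (ht : ∀ s ∈ C, s +ᵥ t ∈ T) {α : Dual ℝ V} (hα : ∀ s ∈ C, α s < 0) (z : P) :
    ∃ u ∈ T, 0 ≤ α (z -ᵥ u) := by
  obtain ⟨s, hs⟩ := hC.nonempty
  have hneg := hα s hs
  obtain ⟨n, hn⟩ := exists_nat_gt (-α (z -ᵥ t) / (-α s))
  rw [div_lt_iff₀ (neg_pos.2 hneg)] at hn
  refine ⟨((n : ℝ) + 1) • s +ᵥ t, ht _ (hC.smul_mem hs (by positivity)), ?_⟩
  rw [vsub_vadd_eq_vsub_sub, map_sub, map_smul, smul_eq_mul]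
  linarith

theorem IsClosedPart.exists_wall_mem {β : Dual ℝ V} {D : Set P} (hD : 𝔸.IsClosedPart (-β) D)
    (hβ : β ∈ 𝔸.realRoots) {t : P} (ht : t ∈ D) (K : ℝ) :
    ∃ p ∈ D, wall β p ∈ 𝔸.walls ∧ 0 ≤ β (p -ᵥ t) ∧
      (K ≤ β (p -ᵥ t) ∨ ∀ u ∈ D, β (u -ᵥ p) ≤ 0) := by
  rcases hD with rfl | ⟨p, hp, rfl⟩
  · obtain ⟨G, hG⟩ := exists_gap 𝔸
    obtain ⟨q, hq⟩ := LinearMap.surjective (ne_zero_of_mem_realRoots hβ) (max K 0)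
    obtain ⟨p, hp, hpq, -⟩ := hG β hβ (q +ᵥ t)
    rw [vsub_vadd_eq_vsub_sub, map_sub, hq, sub_pos] at hpq
    exact ⟨p, mem_univ p, hp, (le_max_right K 0).trans hpq.le,
      Or.inl ((le_max_left K 0).trans hpq.le)⟩
  · have hle : ∀ u ∈ half (-β) p, β (u -ᵥ p) ≤ 0 := fun u hu => neg_nonneg.1 hu
    refine ⟨p, ?_, by simpa only [wall_neg] using hp (neg_mem_realRoots hβ), ?_, Or.inr hle⟩
    · rw [half, mem_ofPred_eq, vsub_self, map_zero]
    · rw [← neg_apply_vsub]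
      exact ht

end Cones

end Model

namespace VectorialData

open SimpleRootData Model

section PanelDirections

variable {I V P : Type*} [Fintype I] [NormedAddCommGroup V] [NormedSpace ℝ V]
  [MetricSpace P] [NormedAddTorsor V P] {𝔸 : Model I V P} {S : Set V} {β : Dual ℝ V} {T : Set P}

theorem IsPanelDir.half_subset (h : 𝔸.IsPanelDir S β) {Q : Set V} (hQ : 𝔸.IsSide S (-β) Q)
    (hT : 𝔸.IsEnclosed T) {t₁ t₂ : P} (h₁ : ∀ s ∈ S, s +ᵥ t₁ ∈ T)
    (h₂ : ∀ q ∈ Neg.neg ⁻¹' Q, q +ᵥ t₂ ∈ T) : half β t₁ ⊆ T := by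
  intro z hz
  refine hT.mem_of_forall_exists_nonneg fun α hα => ?_
  rcases h.eq_or_eq_neg_or_pos_or_neg hα with rfl | rfl | hp | hn
  · obtain ⟨s, hs⟩ := h.isVFacet.nonempty
    refine ⟨_, h₁ s hs, ?_⟩
    rw [vsub_vadd_eq_vsub_sub, map_sub, h.vanish s hs, sub_zero]
    exact hz
  · refine exists_nonneg_of_neg hQ.chamber.isVFacet.neg h₂ (fun q hq => ?_) z
    have hpos := hQ.pos _ hq
    rwa [map_neg, neg_pos] at hpos
  · refine exists_nonneg_of_neg hQ.chamber.isVFacet.neg h₂ (fun q hq => ?_) z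
    have hpos := hQ.pos_of_pos α hα hp _ hq
    rwa [map_neg, neg_pos] at hpos
  · exact exists_nonneg_of_neg h.isVFacet h₁ hn z

theorem IsPanelDir.mem_of_between (h : 𝔸.IsPanelDir S β) (hT : 𝔸.IsEnclosed T)
    {t₁ t₂ : P} (h₁ : ∀ s ∈ S, s +ᵥ t₁ ∈ T) (h₂ : ∀ s ∈ Neg.neg ⁻¹' S, s +ᵥ t₂ ∈ T)
    {z : P} (hz₁ : β (z -ᵥ t₁) ≤ 0) (hz₂ : 0 ≤ β (z -ᵥ t₂)) : z ∈ T := by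
  refine hT.mem_of_forall_exists_nonneg fun α hα => ?_
  obtain ⟨s, hs⟩ := h.isVFacet.nonempty
  rcases h.eq_or_eq_neg_or_pos_or_neg hα with rfl | rfl | hp | hn
  · refine ⟨-s +ᵥ t₂, h₂ (-s) (by simpa only [mem_preimage, neg_neg] using hs), ?_⟩
    rw [vsub_vadd_eq_vsub_sub, map_sub, map_neg, h.vanish s hs, neg_zero, sub_zero]
    exact hz₂
  · refine ⟨_, h₁ s hs, ?_⟩
    rw [vsub_vadd_eq_vsub_sub, map_sub, LinearMap.neg_apply, LinearMap.neg_apply, h.vanish s hs,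
      neg_zero, sub_zero]
    exact neg_nonneg.2 hz₁
  · refine exists_nonneg_of_neg h.isVFacet.neg h₂ (fun q hq => ?_) z
    have hpos := hp _ hq
    rwa [map_neg, neg_pos] at hpos
  · exact exists_nonneg_of_neg h.isVFacet h₁ hn z

theorem IsPanelDir.vadd_smul_vadd_mem (h : 𝔸.IsPanelDir S β) {Q : Set V} (hQ : 𝔸.IsSide S β Q)
    {D : Dual ℝ V → Set P} (hD : ∀ α ∈ 𝔸.allRoots, 𝔸.IsClosedPart α (D α)) {t : P}
    (ht : ∀ s ∈ S, s +ᵥ t ∈ ⋂ α ∈ 𝔸.allRoots, D α) {q : V} (hq : q ∈ Q) {c : ℝ} (hc : 0 ≤ c)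
    (htop : c • q +ᵥ t ∈ D (-β)) {s : V} (hs : s ∈ S) :
    s +ᵥ (c • q +ᵥ t) ∈ ⋂ α ∈ 𝔸.allRoots, D α := by
  refine mem_iInter₂.2 fun α hα => ?_
  have hval : α ((s +ᵥ (c • q +ᵥ t)) -ᵥ (s +ᵥ t)) = c * α q := by
    rw [vadd_vsub_vadd_cancel_left, vadd_vsub, map_smul, smul_eq_mul]
  have hst := mem_iInter₂.1 (ht s hs) α hα
  rcases h.eq_or_eq_neg_or_pos_or_neg hα with rfl | rfl | hpos | hneg
  · exact (hD _ hα).isPart.mem_of_nonneg hst (hval ▸ mul_nonneg hc (hQ.pos q hq).le)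
  · refine (hD _ hα).isPart.mem_of_nonneg htop ?_
    rw [vadd_vsub, LinearMap.neg_apply, h.vanish s hs, neg_zero]
  · exact (hD _ hα).isPart.mem_of_nonneg hst
      (hval ▸ mul_nonneg hc (hQ.pos_of_pos α hα hpos q hq).le)
  · obtain ⟨u, hu, hle⟩ := exists_nonneg_of_neg h.isVFacet ht hneg (s +ᵥ (c • q +ᵥ t))
    exact (hD _ hα).isPart.mem_of_nonneg (mem_iInter₂.1 hu α hα) hle

variable [FiniteDimensional ℝ V]

theorem IsPanelDir.isSolid_chimney (h : 𝔸.IsPanelDir S β) (x : P) :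
    𝔸.IsSolid (𝔸.chimney (𝔸.facet x S) S) := by
  obtain ⟨r, -, hr⟩ := h.exists_stabilizer
  exact Model.isSolid_chimney h.isVFacet h.isVFacet x
    ((Set.toFinite {1, r}).subset fun u hu => hr u hu.1 hu.2)

theorem IsPanelDir.exists_wall_above (h : 𝔸.IsPanelDir S β) (hT : 𝔸.IsEnclosed T)
    {t : P} (ht : ∀ s ∈ S, s +ᵥ t ∈ T) (K : ℝ) : ∃ z : P, wall β z ∈ 𝔸.walls ∧
      (∀ s ∈ S, s +ᵥ z ∈ T) ∧ (K ≤ β (z -ᵥ t) ∨ ∀ u ∈ T, β (u -ᵥ z) ≤ 0) := by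
  obtain ⟨Q, hQ⟩ := h.exists_isSide
  obtain ⟨q, hq⟩ := hQ.chamber.isVFacet.nonempty
  obtain ⟨s₀, hs₀⟩ := h.isVFacet.nonempty
  obtain ⟨D, hD, rfl⟩ := hT
  have hneg : -β ∈ 𝔸.allRoots := neg_mem_roots (Or.inl h.real)
  have htD : t ∈ D (-β) := by
    refine (hD _ hneg).isPart.mem_of_nonneg (mem_iInter₂.1 (ht s₀ hs₀) _ hneg) ?_
    rw [neg_apply_vsub, vadd_vsub, h.vanish s₀ hs₀]
  obtain ⟨p, hpD, hp, hpt, hK⟩ := (hD _ hneg).exists_wall_mem h.real htD K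
  have hc : β (p -ᵥ t) / β q * β q = β (p -ᵥ t) := div_mul_cancel₀ _ (hQ.pos q hq).ne'
  have hzt : β (((β (p -ᵥ t) / β q) • q +ᵥ t) -ᵥ t) = β (p -ᵥ t) := by
    rw [vadd_vsub, map_smul, smul_eq_mul, hc]
  have hzp : β (((β (p -ᵥ t) / β q) • q +ᵥ t) -ᵥ p) = 0 := by
    rw [← vsub_sub_vsub_cancel_right _ p t, map_sub, hzt, sub_self]
  refine ⟨(β (p -ᵥ t) / β q) • q +ᵥ t, by rwa [wall_eq_wall hzp], fun s hs => ?_,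
    hK.imp hzt.symm.le.trans' fun hle u hu => ?_⟩
  · refine h.vadd_smul_vadd_mem hQ hD ht hq (div_nonneg hpt (hQ.pos q hq).le) ?_ hs
    refine (hD _ hneg).isPart.mem_of_nonneg hpD ?_
    rw [LinearMap.neg_apply, hzp, neg_zero]
  · rw [← vsub_sub_vsub_cancel_right u _ p, map_sub, hzp, sub_zero]
    exact hle u (mem_iInter₂.1 hu _ hneg)

theorem IsPanelDir.vanish_closure (h : 𝔸.IsPanelDir S β) {ξ : V} (hξ : ξ ∈ closure S) :
    β ξ = 0 :=
  closure_minimal (t := {v | β v = 0}) h.vanish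
    (isClosed_eq β.continuous_of_finiteDimensional continuous_const) hξ

theorem IsPanelDir.mem_facet_of_mem_chimneyGerm (h : 𝔸.IsPanelDir S β) {Q : Set V}
    (hQ : 𝔸.IsSide S β Q) {x : P} (hTe : 𝔸.IsEnclosed T)
    (hT : T ∈ 𝔸.chimneyGerm (𝔸.facet x Q) S) (hTx : T ∈ 𝔸.facet x S) : T ∈ 𝔸.facet x Q := by
  obtain ⟨T', -, hT'T, -, ξ, hξ, W, hW, hWT⟩ := exists_isEnclosed_of_mem_chimneyGerm h.isVFacet hT
  obtain ⟨q, hq, -, hqW⟩ := exists_mem_of_mem_facet hQ.chamber.isVFacet hW univ_mem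
  have hcone : ∀ s ∈ S, s +ᵥ (ξ +ᵥ (q +ᵥ x)) ∈ T := fun s hs => hT'T (hWT _ hqW s hs)
  have hxT := hTe.mem_of_mem_facet h.isVFacet hTx
  obtain ⟨s, hs⟩ := h.isVFacet.nonempty
  have hlt : ∀ᶠ v in 𝓝 (0 : V), β v < β q :=
    (β.continuous_of_finiteDimensional.tendsto' 0 0 (map_zero β)).eventually
      (gt_mem_nhds (hQ.pos q hq))
  refine hTe.mem_facet ?_
  filter_upwards [hlt] with v hv hvQ
  refine hTe.mem_of_forall_exists_nonneg fun α hα => ?_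
  rcases h.eq_or_eq_neg_or_pos_or_neg hα with rfl | rfl | hp | hn
  · exact ⟨x, hxT, by simpa only [vadd_vsub] using (hQ.pos v hvQ).le⟩
  · refine ⟨_, hcone s hs, ?_⟩
    rw [vadd_vadd, vadd_vadd, vadd_vsub_vadd_cancel_right]
    simp only [map_sub, map_add, LinearMap.neg_apply, h.vanish s hs, h.vanish_closure hξ]
    linarith
  · exact ⟨x, hxT, by simpa only [vadd_vsub] using (hQ.pos_of_pos α hα hp v hvQ).le⟩
  · exact exists_nonneg_of_neg h.isVFacet hcone hn _

end PanelDirections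

end VectorialData

/-! ### Half-spaces bounded by walls, and their germs -/

section HalfSpaces

variable {V P : Type*} [NormedAddCommGroup V] [NormedSpace ℝ V] [MetricSpace P]
  [NormedAddTorsor V P]

theorem exists_apply_vsub_eq {β : Dual ℝ V} (h : β ≠ 0) (x : P) (c : ℝ) :
    ∃ a : P, β (a -ᵥ x) = c := by
  obtain ⟨v, hv⟩ := LinearMap.surjective h c
  exact ⟨v +ᵥ x, by rw [vadd_vsub, hv]⟩

theorem wall_subset_half (β : Dual ℝ V) (p : P) : wall β p ⊆ half β p :=
  fun _ hz => ge_of_eq hz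

theorem half_eq_half {β : Dual ℝ V} {p q : P} (h : β (p -ᵥ q) = 0) : half β p = half β q := by
  ext z
  have hz : β (z -ᵥ q) = β (z -ᵥ p) + β (p -ᵥ q) := by rw [← map_add, vsub_add_vsub_cancel]
  simp only [half, mem_ofPred_eq, hz, h, add_zero]

end HalfSpaces

namespace Model

open SimpleRootData VectorialData

section Germs

variable {I V P : Type*} [Fintype I] [NormedAddCommGroup V] [NormedSpace ℝ V]
  [MetricSpace P] [NormedAddTorsor V P] {𝔸 : Model I V P} {S S' : Set V} {a : P}

theorem isSplayedChimneyGerm (hS' : 𝔸.IsVFacet S') (hS : 𝔸.IsSphericalVFacet S) (a : P) :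
    𝔸.IsSplayedChimneyGerm (𝔸.chimneyGerm (𝔸.facet a S') S) :=
  ⟨_, S, ⟨a, S', hS', rfl⟩, hS, rfl⟩

theorem half_mem_facet {β : Dual ℝ V} (hβ : β ∈ 𝔸.realRoots) (ha : wall β a ∈ 𝔸.walls)
    (hS : ∀ s ∈ S, 0 ≤ β s) : half β a ∈ 𝔸.facet a S :=
  (isEnclosed_half hβ ha).mem_facet <| Eventually.of_forall fun s hs => by
    simpa only [half, mem_ofPred_eq, vadd_vsub] using hS s hs

theorem mem_titsCone_or_neg_mem (hS : 𝔸.IsVFacet S) {v : V} (hv : v ∈ S) :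
    v ∈ 𝔸.titsCone ∨ -v ∈ 𝔸.titsCone := by
  obtain ⟨J, w, hw, rfl | rfl⟩ := hS
  · exact Or.inl ⟨w, hw, J, hv⟩
  · obtain ⟨u, hu, rfl⟩ := hv
    exact Or.inr ⟨w, hw, J, u, hu, by simp only [neg_neg]⟩

theorem isPreorderedIntervalGerm (hS : 𝔸.IsVFacet S) {v : V} (hv : v ∈ S) (hv0 : v ≠ 0) (a : P) :
    𝔸.IsPreorderedIntervalGerm (germ a (AffineMap.lineMap a (v +ᵥ a) '' Ioc (0 : ℝ) 1)) := by
  refine ⟨a, v +ᵥ a, fun h => hv0 ?_, ?_, rfl⟩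
  · rw [← vadd_vsub v a, ← h, vsub_self]
  · simpa only [vadd_vsub, vsub_vadd_eq_vsub_sub, vsub_self, zero_sub]
      using mem_titsCone_or_neg_mem hS hv

theorem lineMap_image_Ioc_subset (hS : 𝔸.IsVFacet S) {v : V} (hv : v ∈ S) (a : P) :
    AffineMap.lineMap a (v +ᵥ a) '' Ioc (0 : ℝ) 1 ⊆ (fun s => s +ᵥ a) '' S := by
  rintro _ ⟨t, ht, rfl⟩
  exact ⟨t • v, hS.smul_mem hv ht.1, by rw [AffineMap.lineMap_apply, vadd_vsub]⟩

variable [FiniteDimensional ℝ V]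

theorem half_mem_chimneyGerm {β : Dual ℝ V} (hβ : β ∈ 𝔸.realRoots) (ha : wall β a ∈ 𝔸.walls)
    (hSv : 𝔸.IsVFacet S) (hS : ∀ s ∈ S, 0 ≤ β s) :
    half β a ∈ 𝔸.chimneyGerm (𝔸.facet a S) S :=
  (isEnclosed_half hβ ha).mem_chimneyGerm_facet hSv fun s hs => by
    simpa only [half, mem_ofPred_eq, vadd_vsub] using hS s hs

theorem IsEnclosed.mem_facet_of_vadd_mem {T : Set P} (hT : 𝔸.IsEnclosed T) (hS : 𝔸.IsVFacet S)
    (ha : a ∈ T) {u : V} (hu : u ∈ S) (hua : u +ᵥ a ∈ T) : T ∈ 𝔸.facet a S := by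
  refine hT.mem_facet ?_
  filter_upwards [hS.eventually_sub_mem hu] with v huv hv
  refine hT.mem_of_forall_exists_nonneg fun α hα => ?_
  rcases hS.nonneg_or_nonpos hα with hnonneg | hnonpos
  · exact ⟨a, ha, by simpa only [vadd_vsub] using hnonneg v hv⟩
  · refine ⟨_, hua, ?_⟩
    rw [vadd_vsub_vadd_cancel_right, ← neg_sub, map_neg]
    exact neg_nonneg.2 (hnonpos _ (huv hv))

theorem chimneyGerm_le_of_le_adherence {F G : Filter P} (hS : 𝔸.IsVFacet S)
    (h : F ≤ adherence G) : 𝔸.chimneyGerm F S ≤ 𝔸.chimneyGerm G S := by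
  intro U hU
  obtain ⟨T, hTe, hTU, -, ξ, hξ, W, hW, hadd⟩ := exists_isEnclosed_of_mem_chimneyGerm hS hU
  have hWF : closure W ∈ F := h (mem_adherence.2 ⟨W, hW, Subset.rfl⟩)
  refine (iInf₂_le ξ hξ : 𝔸.chimneyGerm F S ≤ _) ⟨T, hTe, ?_, hTU⟩
  refine mem_map₂_iff.2 ⟨_, image_mem_map hWF, S, mem_principal_self S, ?_⟩
  rintro _ ⟨_, ⟨u, hu, rfl⟩, s, hs, rfl⟩
  have hmaps : MapsTo (fun u : P => s +ᵥ (ξ +ᵥ u)) W T := fun u hu => hadd u hu s hs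
  simpa only [hTe.isClosed.closure_eq] using hmaps.closure (by fun_prop) hu

theorem isSolidChimneyGerm_of_isVChamber {Q : Set V} (hQ : 𝔸.IsVChamber Q) (a : P) :
    𝔸.IsSolidChimneyGerm (𝔸.chimneyGerm (𝔸.facet a Q) Q) :=
  ⟨_, Q, ⟨a, Q, hQ.isVFacet, rfl⟩, hQ.isVFacet, isSolid_chimney_of_isVChamber hQ a, rfl⟩

end Germs

end Model

namespace VectorialData

open SimpleRootData Model

section PanelGerms

variable {I V P : Type*} [Fintype I] [NormedAddCommGroup V] [NormedSpace ℝ V]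
  [MetricSpace P] [NormedAddTorsor V P] {𝔸 : Model I V P} {S : Set V} {β : Dual ℝ V} {a : P}

theorem IsPanelDir.isSplayedChimneyGerm (h : 𝔸.IsPanelDir S β) (a : P) :
    𝔸.IsSplayedChimneyGerm (𝔸.chimneyGerm (𝔸.facet a S) S) :=
  Model.isSplayedChimneyGerm h.isVFacet h.panel.isSphericalVFacet a

theorem IsPanelDir.wall_mem_facet (h : 𝔸.IsPanelDir S β) (ha : wall β a ∈ 𝔸.walls) :
    wall β a ∈ 𝔸.facet a S :=
  (isEnclosed_wall h.real ha).mem_facet <| Eventually.of_forall fun s hs => by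
    simpa only [wall, mem_ofPred_eq, vadd_vsub] using h.vanish s hs

variable [FiniteDimensional ℝ V]

theorem IsPanelDir.wall_mem_chimneyGerm (h : 𝔸.IsPanelDir S β) (ha : wall β a ∈ 𝔸.walls) :
    wall β a ∈ 𝔸.chimneyGerm (𝔸.facet a S) S :=
  (isEnclosed_wall h.real ha).mem_chimneyGerm_facet h.isVFacet fun s hs => by
    simpa only [wall, mem_ofPred_eq, vadd_vsub] using h.vanish s hs

theorem IsPanelDir.isSolidChimneyGerm (h : 𝔸.IsPanelDir S β) (a : P) :
    𝔸.IsSolidChimneyGerm (𝔸.chimneyGerm (𝔸.facet a S) S) :=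
  ⟨_, S, ⟨a, S, h.isVFacet, rfl⟩, h.isVFacet, h.isSolid_chimney a, rfl⟩

end PanelGerms

end VectorialData

/-! ### Charts of apartments -/

namespace ApartmentSystem

section Charts

variable {I V P X : Type*} [Fintype I] [NormedAddCommGroup V] [NormedSpace ℝ V]
  [MetricSpace P] [NormedAddTorsor V P] {𝔸 : Model I V P} {𝓘 : ApartmentSystem 𝔸 X}
  {A A' : Set X} {f f' : P → X}

theorem IsChart.injective (hf : 𝓘.IsChart A f) : Function.Injective f :=
  injOn_univ.1 (𝓘.isom_bijOn A hf.1 f hf.2).injOn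

theorem IsChart.mem (hf : 𝓘.IsChart A f) (z : P) : f z ∈ A :=
  (𝓘.isom_bijOn A hf.1 f hf.2).mapsTo (mem_univ z)

theorem IsChart.range_eq (hf : 𝓘.IsChart A f) : range f = A := by
  rw [← image_univ, (𝓘.isom_bijOn A hf.1 f hf.2).image_eq]

theorem IsChart.mem_map (hf : 𝓘.IsChart A f) (F : Filter P) : A ∈ F.map f :=
  Filter.mem_map.2 (univ_mem' hf.mem)

theorem IsChart.subset_preimage_of_eqOn (hf' : 𝓘.IsChart A' f') {T : Set P} (h : EqOn f f' T) :
    T ⊆ f ⁻¹' A' := fun z hz => by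
  rw [mem_preimage, h hz]
  exact hf'.mem z

theorem IsChart.comp (hf : 𝓘.IsChart A f) {w : P ≃ᵃ[ℝ] P} (hw : w ∈ 𝔸.affineWeyl) :
    𝓘.IsChart A (f ∘ w) :=
  ⟨hf.1, (𝓘.isom_iff A hf.1 f hf.2 _).2 ⟨w, hw, rfl⟩⟩

theorem IsChart.exists_comp (hf : 𝓘.IsChart A f) (hf' : 𝓘.IsChart A f') :
    ∃ w ∈ 𝔸.affineWeyl, f' = f ∘ w :=
  (𝓘.isom_iff A hf.1 f hf.2 f').1 hf'.2

theorem IsIso.comp {φ : X → X} (h : 𝓘.IsIso A A' φ) (hf : 𝓘.IsChart A f)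
    (hA' : A' ∈ 𝓘.apartments) : 𝓘.IsChart A' (φ ∘ f) := by
  obtain ⟨-, f₀, hf₀, hφf₀⟩ := h
  obtain ⟨w, hw, rfl⟩ := (𝓘.isom_iff A hf.1 f₀ hf₀ f).1 hf.2
  exact IsChart.comp ⟨hA', hφf₀⟩ hw

theorem IsoFixing.exists_chart {F : Filter P} (hf : 𝓘.IsChart A f) (hA' : A' ∈ 𝓘.apartments)
    (h : 𝓘.IsoFixing A A' (clIn 𝔸 f (F.map f))) :
    ∃ f', 𝓘.IsChart A' f' ∧ ∃ T, 𝔸.IsEnclosed T ∧ T ∈ F ∧ EqOn f f' T := by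
  obtain ⟨-, φ, hφ, U, hU, hfix⟩ := h
  rw [clIn, comap_map hf.injective] at hU
  obtain ⟨T, hT, hTF, hTU⟩ := hU
  exact ⟨φ ∘ f, hφ.comp hf hA', T, hT, hTF, fun z hz => (hfix _ (hTU hz)).symm⟩

theorem IsChart.eq_of_eqOn_isOpen (hf : 𝓘.IsChart A f) (hf' : 𝓘.IsChart A f') {U : Set P}
    (hU : IsOpen U) (hne : U.Nonempty) (h : EqOn f f' U) : f = f' := by
  obtain ⟨w, -, rfl⟩ := hf.exists_comp hf'
  have hw : w = AffineEquiv.refl ℝ P := AffineEquiv.toAffineMap_injective <|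
    AffineMap.ext_on (hU.affineSpan_eq_top hne) fun z hz => (hf.injective (h hz)).symm
  rw [hw, AffineEquiv.coe_refl, Function.comp_id]

theorem IsChart.eq_or_reflect_of_eqOn_wall (hf : 𝓘.IsChart A f) (hf' : 𝓘.IsChart A f')
    {S : Set V} {β : Dual ℝ V} (hS : 𝔸.IsPanelDir S β) {a : P} (h : EqOn f f' (wall β a)) :
    f' = f ∨ ∃ t : P → P, f' = f ∘ t ∧ ∀ z, β (t z -ᵥ a) = -β (z -ᵥ a) := by
  obtain ⟨w, hw, rfl⟩ := hf.exists_comp hf'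
  have hfix : ∀ z ∈ wall β a, w z = z := fun z hz => (hf.injective (h hz)).symm
  have ha : w a = a := hfix a (by rw [wall, mem_ofPred_eq, vsub_self, map_zero])
  have hlinear (z : P) : w z -ᵥ a = w.linear (z -ᵥ a) := by rw [← affineEquiv_vsub, ha]
  have hfixS : ∀ s ∈ S, w.linear s = s := fun s hs => by
    have hs' : s +ᵥ a ∈ wall β a := by rw [wall, mem_ofPred_eq, vadd_vsub, hS.vanish s hs]
    simpa only [vadd_vsub, hfix _ hs'] using (hlinear (s +ᵥ a)).symm
  obtain ⟨r, hr, huniq⟩ := hS.exists_stabilizer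
  rcases huniq w.linear (Model.linear_mem_weyl hw) hfixS with hone | hrefl
  · refine Or.inl (funext fun z => congrArg f (vsub_left_cancel (p := a) ?_))
    rw [hlinear, hone, LinearEquiv.coe_one, id]
  · exact Or.inr ⟨w, rfl, fun z => by rw [hlinear, hrefl, hr]⟩

end Charts

end ApartmentSystem

/-! ### Agreement of charts of two apartments -/

namespace Hovel

open Model SimpleRootData VectorialData ApartmentSystem

theorem map_eq_of_eqOn {P X : Type*} {F : Filter P} {T : Set P} {f f' : P → X} (hT : T ∈ F)
    (he : EqOn f f' T) : F.map f = F.map f' :=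
  map_congr (eventually_of_mem hT he)

theorem tendsto_smul_vadd_germ {V P : Type*} [NormedAddCommGroup V] [NormedSpace ℝ V]
    [MetricSpace P] [NormedAddTorsor V P] (v : V) (a : P) :
    Tendsto (fun t : ℝ => t • v +ᵥ a) (𝓝[>] 0)
      (germ a (AffineMap.lineMap a (v +ᵥ a) '' Ioc (0 : ℝ) 1)) := by
  have hcont : Continuous fun t : ℝ => t • v +ᵥ a := by fun_prop
  refine tendsto_nhdsWithin_iff.2
    ⟨(hcont.tendsto' 0 a (by rw [zero_smul, zero_vadd])).mono_left nhdsWithin_le_nhds, ?_⟩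
  filter_upwards [Ioc_mem_nhdsGT (zero_lt_one' ℝ)] with t ht
  exact ⟨t, ht, by rw [AffineMap.lineMap_apply, vadd_vsub]⟩

section Charts

variable {I V P X : Type*} [Fintype I] [NormedAddCommGroup V] [NormedSpace ℝ V]
  [MetricSpace P] [NormedAddTorsor V P] {𝔸 : Model I V P}
  {𝓘 : Hovel 𝔸 X} {A A' : Set X} {f : P → X} {S : Set V} {β : Dual ℝ V}

theorem exists_chart_of_germs (hf : 𝓘.IsChart A f) (hA' : A' ∈ 𝓘.apartments) {R F : Filter P}
    (hR : 𝔸.IsSplayedChimneyGerm R) (hF : 𝔸.IsFacet F ∨ 𝔸.IsSolidChimneyGerm F)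
    (hRA' : f ⁻¹' A' ∈ R) (hFA' : f ⁻¹' A' ∈ F) :
    ∃ f', 𝓘.IsChart A' f' ∧ ∃ T, 𝔸.IsEnclosed T ∧ T ∈ R ∧ T ∈ F ∧ EqOn f f' T := by
  have hfix := 𝓘.ma4 (R.map f) (F.map f) ⟨A, f, hf, R, hR, rfl⟩
    (hF.imp (fun h => ⟨A, f, hf, F, h, rfl⟩) fun h => ⟨A, f, hf, F, h, rfl⟩)
    A f hf A' hA' (hf.mem_map R) (hf.mem_map F) hRA' hFA'
  rw [← map_sup] at hfix
  obtain ⟨f', hf', T, hT, hm, he⟩ := IsoFixing.exists_chart hf hA' hfix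
  exact ⟨f', hf', T, hT, hm.1, hm.2, he⟩

theorem exists_chart_of_mem (hf : 𝓘.IsChart A f) (hA' : A' ∈ 𝓘.apartments) {x : P}
    (hx : f x ∈ A') : ∃ f', 𝓘.IsChart A' f' ∧ ∃ T, 𝔸.IsEnclosed T ∧ x ∈ T ∧ EqOn f f' T :=
  IsoFixing.exists_chart (F := pure x) hf hA'
    (𝓘.ma2 A f hf A' hA' (pure x) (Or.inl ⟨x, rfl⟩) hx)

variable [FiniteDimensional ℝ V]

theorem exists_chart_of_localFacet (hf : 𝓘.IsChart A f) (hA' : A' ∈ 𝓘.apartments) {x : P}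
    (hS : 𝔸.IsVFacet S) {v : V} (hv : v ∈ S) (hv0 : v ≠ 0) (hm : f ⁻¹' A' ∈ localFacet x S) :
    ∃ f', 𝓘.IsChart A' f' ∧ ∃ T, 𝔸.IsEnclosed T ∧ x ∈ T ∧ (∃ u ∈ S, u +ᵥ x ∈ T) ∧
      EqOn f f' T := by
  have hgerm : f ⁻¹' A' ∈ germ x (AffineMap.lineMap x (v +ᵥ x) '' Ioc (0 : ℝ) 1) :=
    nhdsWithin_mono x (lineMap_image_Ioc_subset hS hv x) hm
  obtain ⟨f', hf', T, hT, hTm, he⟩ := IsoFixing.exists_chart hf hA'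
    (𝓘.ma2 A f hf A' hA' _ (Or.inr (Or.inl (isPreorderedIntervalGerm hS hv hv0 x))) hgerm)
  have htendsto := tendsto_smul_vadd_germ v x
  have hT_eventually : ∀ᶠ t : ℝ in 𝓝[>] 0, t • v +ᵥ x ∈ T := htendsto hTm
  obtain ⟨t, htT, ht0⟩ := (hT_eventually.and self_mem_nhdsWithin).exists
  exact ⟨f', hf', T, hT, hT.isClosed.mem_of_tendsto (htendsto.mono_right nhdsWithin_le_nhds)
    hT_eventually, ⟨t • v, hS.smul_mem hv ht0, htT⟩, he⟩

theorem exists_chart_of_facet (hf : 𝓘.IsChart A f) (hA' : A' ∈ 𝓘.apartments) {x : P}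
    (hS : 𝔸.IsVFacet S) (hm : f ⁻¹' A' ∈ 𝔸.facet x S) :
    ∃ f', 𝓘.IsChart A' f' ∧ ∃ T, 𝔸.IsEnclosed T ∧ T ∈ 𝔸.facet x S ∧ EqOn f f' T := by
  have hlocal := mem_localFacet_of_mem_facet hm
  obtain ⟨v, hv⟩ := hS.nonempty
  rcases eq_or_ne v 0 with rfl | hv0
  · have hx : f x ∈ A' := by
      simpa only [zero_vadd, mem_preimage] using (mem_localFacet.1 hlocal).self_of_nhds hv
    obtain ⟨f', hf', T, hT, hxT, he⟩ := exists_chart_of_mem hf hA' hx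
    exact ⟨f', hf', T, hT, hT.mem_facet_of_vadd_mem hS hxT hv (by rwa [zero_vadd]), he⟩
  · obtain ⟨f', hf', T, hT, hxT, ⟨u, hu, huT⟩, he⟩ :=
      exists_chart_of_localFacet hf hA' hS hv hv0 hlocal
    exact ⟨f', hf', T, hT, hT.mem_facet_of_vadd_mem hS hxT hu huT, he⟩

theorem exists_chart_half (hf : 𝓘.IsChart A f) (hA' : A' ∈ 𝓘.apartments)
    (hS : 𝔸.IsPanelDir S β) {Q : Set V} (hQ : 𝔸.IsSide S (-β) Q) {a b : P}
    (ha : f ⁻¹' A' ∈ 𝔸.chimneyGerm (𝔸.facet a S) S)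
    (hb : f ⁻¹' A' ∈ 𝔸.chimneyGerm (𝔸.facet b (Neg.neg ⁻¹' Q)) (Neg.neg ⁻¹' Q)) :
    ∃ f', 𝓘.IsChart A' f' ∧ EqOn f f' (half β a) := by
  have hQ' : 𝔸.IsVChamber (Neg.neg ⁻¹' Q) := IsVFacetOfType.neg hQ.chamber
  obtain ⟨f', hf', T, hT, hTa, hTb, he⟩ := exists_chart_of_germs hf hA'
    (hS.isSplayedChimneyGerm a) (Or.inr (isSolidChimneyGerm_of_isVChamber hQ' b)) ha hb
  obtain ⟨s, hs, hsT⟩ := exists_vadd_of_mem_chimneyGerm hS.isVFacet hTa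
  obtain ⟨q, -, hqT⟩ := exists_vadd_of_mem_chimneyGerm hQ'.isVFacet hTb
  refine ⟨f', hf', he.mono ?_⟩
  rw [← half_eq_half (p := s +ᵥ a) (by rw [vadd_vsub, hS.vanish s hs])]
  exact hS.half_subset hQ hT hsT hqT

theorem exists_chart_strip (hf : 𝓘.IsChart A f) (hA' : A' ∈ 𝓘.apartments)
    (hS : 𝔸.IsPanelDir S β) {a b : P}
    (ha : f ⁻¹' A' ∈ 𝔸.chimneyGerm (𝔸.facet a S) S)
    (hb : f ⁻¹' A' ∈ 𝔸.chimneyGerm (𝔸.facet b (Neg.neg ⁻¹' S)) (Neg.neg ⁻¹' S)) :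
    ∃ f', 𝓘.IsChart A' f' ∧ ∃ T, 𝔸.IsEnclosed T ∧ EqOn f f' T ∧
      ∀ z, β (z -ᵥ a) ≤ 0 → 0 ≤ β (z -ᵥ b) → z ∈ T := by
  obtain ⟨f', hf', T, hT, hTa, hTb, he⟩ := exists_chart_of_germs hf hA'
    (hS.isSplayedChimneyGerm a) (Or.inr (hS.neg_dir.isSolidChimneyGerm b)) ha hb
  obtain ⟨s, hs, hsT⟩ := exists_vadd_of_mem_chimneyGerm hS.isVFacet hTa
  obtain ⟨q, hq, hqT⟩ := exists_vadd_of_mem_chimneyGerm hS.neg_dir.isVFacet hTb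
  refine ⟨f', hf', T, hT, he, fun z hza hzb => hS.mem_of_between hT hsT hqT ?_ ?_⟩
  · rwa [vsub_vadd_eq_vsub_sub, map_sub, hS.vanish s hs, sub_zero]
  · rwa [vsub_vadd_eq_vsub_sub, map_sub, hS.neg_dir.vanish q hq, sub_zero]

end Charts

/-! ### Chambers dominating a panel -/

section Dominance

variable {I V P X : Type*} [Fintype I] [NormedAddCommGroup V] [NormedSpace ℝ V]
  [FiniteDimensional ℝ V] [MetricSpace P] [NormedAddTorsor V P] {𝔸 : Model I V P}
  {𝓘 : Hovel 𝔸 X} {A : Set X} {f : P → X} {C F : Filter X}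

theorem exists_eq_map_facet_of_isChamber (hC : 𝓘.IsChamber C) (hf : 𝓘.IsChart A f)
    (hm : A ∈ C) : ∃ y Q, 𝔸.IsVChamber Q ∧ C = (𝔸.facet y Q).map f := by
  obtain ⟨A₁, f₁, hf₁, _, ⟨y, Q, hQ, rfl⟩, rfl⟩ := hC
  obtain ⟨f', hf', T, -, hT, he⟩ := exists_chart_of_facet hf₁ hf.1 hQ.isVFacet hm
  obtain ⟨w, hw, rfl⟩ := hf.exists_comp hf'
  refine ⟨w y, w.linear '' Q, IsVFacetOfType.image hQ (linear_mem_weyl hw), ?_⟩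
  rw [map_eq_of_eqOn hT he, ← map_facet hw, map_map]

theorem Dominates.exists_chart (h : 𝓘.Dominates C F) (hA : A ∈ 𝓘.apartments) (hm : A ∈ C) :
    ∃ f, 𝓘.IsChart A f ∧ ∃ C₀ F₀, C = C₀.map f ∧ F = F₀.map f ∧ F₀ ≤ adherence C₀ := by
  obtain ⟨A₀, f₀, hf₀, _, F₀, ⟨y, Q, hQ, rfl⟩, -, rfl, rfl, hle⟩ := h
  obtain ⟨f', hf', T, hTe, hT, he⟩ := exists_chart_of_facet hf₀ hA hQ hm
  refine ⟨f', hf', 𝔸.facet y Q, F₀, map_eq_of_eqOn hT he, map_eq_of_eqOn (hle ?_) he, hle⟩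
  exact mem_adherence.2 ⟨T, hT, hTe.isClosed.closure_eq.subset⟩

theorem Dominates.mem (h : 𝓘.Dominates C F) (hA : A ∈ 𝓘.apartments) (hm : A ∈ C) : A ∈ F := by
  obtain ⟨f, hf, C₀, F₀, -, rfl, -⟩ := h.exists_chart hA hm
  exact hf.mem_map F₀

theorem Dominates.eq_or_eq (hC : 𝓘.IsChamber C) (hf : 𝓘.IsChart A f) (hm : A ∈ C)
    {S : Set V} {β : Dual ℝ V} (hS : 𝔸.IsPanelDir S β) {Q₁ Q₂ : Set V} (hQ₁ : 𝔸.IsSide S β Q₁)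
    (hQ₂ : 𝔸.IsSide S (-β) Q₂) {x : P} (hx : wall β x ∈ 𝔸.walls)
    (hdom : 𝓘.Dominates C ((𝔸.facet x S).map f)) :
    C = (𝔸.facet x Q₁).map f ∨ C = (𝔸.facet x Q₂).map f := by
  obtain ⟨y, Q, hQ, rfl⟩ := exists_eq_map_facet_of_isChamber hC hf hm
  obtain ⟨f', hf', C₀, F₀, hC₀, hF₀, hle⟩ := hdom.exists_chart hf.1 hm
  obtain ⟨w, -, rfl⟩ := hf.exists_comp hf'
  rw [← map_map] at hC₀ hF₀
  have hadh := map_le_adherence_map (t := w) hle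
  rw [← map_injective hf.injective hC₀, ← map_injective hf.injective hF₀] at hadh
  exact (facet_eq_or_of_dominates hS hQ₁ hQ₂ hx hQ hadh).imp (congrArg _) (congrArg _)

end Dominance

end Hovel

/-! ### A half-apartment and a chamber along its wall -/

namespace VectorialData

open SimpleRootData Model

section PanelsOnWalls

variable {I V P : Type*} [Fintype I] [NormedAddCommGroup V] [NormedSpace ℝ V]
  [MetricSpace P] [NormedAddTorsor V P] {𝔸 : Model I V P} {S : Set V} {β : Dual ℝ V}

theorem isPanelDir_of_wall_mem_facet [FiniteDimensional ℝ V] (hS : 𝔸.IsVPanel S)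
    (hβ : β ∈ 𝔸.realRoots) {x p : P} (hp : wall β p ∈ 𝔸.walls) (h : wall β p ∈ 𝔸.facet x S) :
    β (x -ᵥ p) = 0 ∧ 𝔸.IsPanelDir S β := by
  have hx : β (x -ᵥ p) = 0 := (isEnclosed_wall hβ hp).mem_of_mem_facet hS.isVFacet h
  refine ⟨hx, hS, hβ, fun s hs => ?_⟩
  have hcont : Continuous fun t : ℝ => t • s := by fun_prop
  have hnear : ∀ᶠ t : ℝ in 𝓝[>] 0, t • s ∈ S → t • s +ᵥ x ∈ wall β p :=
    ((hcont.tendsto' 0 0 (zero_smul ℝ s)).mono_left nhdsWithin_le_nhds).eventually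
      (mem_localFacet.1 (mem_localFacet_of_mem_facet h))
  obtain ⟨t, ht, ht0⟩ := (hnear.and self_mem_nhdsWithin).exists
  replace ht0 : 0 < t := ht0
  have hwall : β ((t • s +ᵥ x) -ᵥ p) = 0 := ht (hS.isVFacet.smul_mem hs ht0)
  rw [vadd_vsub_assoc, map_add, hx, add_zero, map_smul, smul_eq_mul] at hwall
  exact (mul_eq_zero.1 hwall).resolve_left ht0.ne'

theorem IsPanelDir.vadd_mem_of_isSide (hS : 𝔸.IsPanelDir S β) {Q : Set V} (hQ : 𝔸.IsSide S β Q)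
    {T : Set P} (hT : 𝔸.IsEnclosed T) {a z : P} (ha : ∀ q ∈ Q, q +ᵥ a ∈ T) (hz : z ∈ T)
    {s : V} (hs : s ∈ S) : s +ᵥ z ∈ T := by
  refine hT.mem_of_forall_exists_nonneg fun α hα => ?_
  rcases hS.eq_or_eq_neg_or_pos_or_neg hα with rfl | rfl | hpos | hneg
  · exact ⟨z, hz, by rw [vadd_vsub, hS.vanish s hs]⟩
  · exact ⟨z, hz, by rw [vadd_vsub, hS.neg_root.vanish s hs]⟩
  · exact ⟨z, hz, by simpa only [vadd_vsub] using (hpos s hs).le⟩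
  · refine exists_nonneg_of_neg hQ.chamber.isVFacet ha (fun q hq => ?_) _
    exact neg_pos.1 (hQ.pos_of_pos (-α) (neg_mem_roots hα) (fun s hs => neg_pos.2 (hneg s hs)) q hq)

end PanelsOnWalls

end VectorialData

namespace Hovel

open Model SimpleRootData VectorialData ApartmentSystem

section HalfApartments

variable {I V P X : Type*} [Fintype I] [NormedAddCommGroup V] [NormedSpace ℝ V]
  [MetricSpace P] [NormedAddTorsor V P] {𝔸 : Model I V P} {𝓘 : Hovel 𝔸 X} {A A' : Set X}
  {f f' : P → X} {S Q : Set V} {β : Dual ℝ V} {x z : P}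

theorem IsThick.exists_isChamber_ne (h : 𝓘.IsThick) {F : Filter X} (hF : 𝓘.IsPanel F)
    (C₁ C₂ : Filter X) : ∃ C, 𝓘.IsChamber C ∧ 𝓘.Dominates C F ∧ C ≠ C₁ ∧ C ≠ C₂ := by
  by_contra! hall
  have hsub : {C | 𝓘.IsChamber C ∧ 𝓘.Dominates C F} ⊆ {C₁, C₂} := fun C hC =>
    or_iff_not_imp_left.2 (hall C hC.1 hC.2)
  have htwo : (3 : ℕ∞) ≤ ({C₂} : Set (Filter X)).encard + 1 :=
    (h F hF).trans ((encard_le_encard hsub).trans (encard_insert_le _ _))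
  rw [encard_singleton] at htwo
  exact absurd htwo (by norm_num)

variable [FiniteDimensional ℝ V]

theorem exists_chart_half_of_isSide (hf : 𝓘.IsChart A f) (hf' : 𝓘.IsChart A' f')
    (hS : 𝔸.IsPanelDir S β) (hx : wall β x ∈ 𝔸.walls) {γ : Dual ℝ V} (hSγ : 𝔸.IsPanelDir S γ)
    (hQ : 𝔸.IsSide S γ Q) {T : Set P} (he : EqOn f f' T)
    (hTR : T ∈ 𝔸.chimneyGerm (𝔸.facet x S) S) (hTF : T ∈ 𝔸.facet x S) :
    ∃ A'' f'', 𝓘.IsChart A'' f'' ∧ EqOn f f'' (half β x) ∧ f' ⁻¹' A'' ∈ 𝔸.facet x Q := by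
  obtain ⟨C, hC⟩ := hS.neg_root.exists_isSide
  have hC' : 𝔸.IsVChamber (Neg.neg ⁻¹' C) := IsVFacetOfType.neg hC.chamber
  have hsplayed := Model.isSplayedChimneyGerm (𝔸 := 𝔸) hQ.chamber.isVFacet
    hS.panel.isSphericalVFacet x
  obtain ⟨A'', hA'', hR, hopp⟩ := 𝓘.ma3 ((𝔸.chimneyGerm (𝔸.facet x Q) S).map f')
    ((𝔸.chimneyGerm (𝔸.facet x (Neg.neg ⁻¹' C)) (Neg.neg ⁻¹' C)).map f)
    ⟨A', f', hf', _, hsplayed, rfl⟩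
    (Or.inr ⟨A, f, hf, _, isSolidChimneyGerm_of_isVChamber hC' x, rfl⟩)
  have hRS : A'' ∈ (𝔸.chimneyGerm (𝔸.facet x S) S).map f := by
    rw [map_eq_of_eqOn hTR he]
    exact map_mono (chimneyGerm_le_of_le_adherence hS.isVFacet
      (facet_le_adherence_of_isSide hQ x)) hR
  obtain ⟨f'', hf'', he''⟩ := exists_chart_half hf hA'' hS hC hRS hopp
  have hpanel : A'' ∈ (𝔸.facet x S).map f' := by
    rw [← map_eq_of_eqOn hTF he, Filter.mem_map]
    exact mem_of_superset (half_mem_facet hS.real hx fun s hs => (hS.vanish s hs).ge)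
      (hf''.subset_preimage_of_eqOn he'')
  obtain ⟨g, hg, U, hU, hUR, hUF, heU⟩ := exists_chart_of_germs hf' hA'' hsplayed
    (Or.inl ⟨x, S, hS.isVFacet, rfl⟩) hR hpanel
  exact ⟨A'', f'', hf'', he'', mem_of_superset (hSγ.mem_facet_of_mem_chimneyGerm hQ hU hUR hUF)
    (hg.subset_preimage_of_eqOn heU)⟩

theorem exists_chart_of_dominates (hf : 𝓘.IsChart A f) (hS : 𝔸.IsPanelDir S β)
    (hx : wall β x ∈ 𝔸.walls) {C : Filter X} (hC : 𝓘.IsChamber C)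
    (hdom : 𝓘.Dominates C ((𝔸.facet x S).map f)) :
    ∃ A' f', 𝓘.IsChart A' f' ∧ EqOn f f' (half β x) ∧ A' ∈ C := by
  obtain ⟨Q₁, hQ₁⟩ := hS.exists_isSide
  obtain ⟨Q₂, hQ₂⟩ := hS.neg_root.exists_isSide
  have hfacet : 𝓘.Has 𝔸.IsFacet C := by
    obtain ⟨A₀, f₀, hf₀, F, ⟨y, Q, hQ, rfl⟩, rfl⟩ := hC
    exact ⟨A₀, f₀, hf₀, _, ⟨y, Q, hQ.isVFacet, rfl⟩, rfl⟩
  obtain ⟨A', hA', hR, hA'C⟩ := 𝓘.ma3 ((𝔸.chimneyGerm (𝔸.facet x S) S).map f) C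
    ⟨A, f, hf, _, hS.isSplayedChimneyGerm x, rfl⟩ (Or.inl hfacet)
  obtain ⟨f', hf', T, -, hTR, hTF, he⟩ := exists_chart_of_germs hf hA'
    (hS.isSplayedChimneyGerm x) (Or.inl ⟨x, S, hS.isVFacet, rfl⟩) hR (hdom.mem hA' hA'C)
  rw [map_eq_of_eqOn hTF he] at hdom
  rcases Dominates.eq_or_eq hC hf' hA'C hS hQ₁ hQ₂ hx hdom with rfl | rfl
  · exact exists_chart_half_of_isSide hf hf' hS hx hS hQ₁ he hTR hTF
  · exact exists_chart_half_of_isSide hf hf' hS hx hS.neg_root hQ₂ he hTR hTF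

theorem exists_apartment_of_dominates {D M : Set X} {F C : Filter X}
    (hD : 𝓘.IsHalfApartment D M) (hF : 𝓘.IsPanel F) (hM : M ∈ F) (hC : 𝓘.IsChamber C)
    (hdom : 𝓘.Dominates C F) : ∃ A ∈ 𝓘.apartments, D ⊆ A ∧ A ∈ C := by
  obtain ⟨A, f, hf, β, hβ, p, hp, rfl, rfl⟩ := hD
  obtain ⟨A₀, f₀, hf₀, _, ⟨x₀, S₀, hS₀, -, rfl⟩, rfl⟩ := hF
  have hA : A ∈ (𝔸.facet x₀ S₀).map f₀ :=
    mem_of_superset hM ((image_subset_range f _).trans_eq hf.range_eq)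
  obtain ⟨f₁, hf₁, T, -, hT, he⟩ := exists_chart_of_facet hf₀ hf.1 hS₀.isVFacet hA
  obtain ⟨w, hw, rfl⟩ := hf.exists_comp hf₁
  rw [map_eq_of_eqOn hT he, ← map_map, map_facet hw] at hM hdom
  have hpanel : 𝔸.IsVPanel (w.linear '' S₀) :=
    hS₀.imp fun i hi => IsVFacetOfType.image hi (linear_mem_weyl hw)
  rw [Filter.mem_map, preimage_image_eq _ hf.injective] at hM
  obtain ⟨hx, hS⟩ := isPanelDir_of_wall_mem_facet hpanel hβ hp hM
  obtain ⟨A', f', hf', he', hA'⟩ :=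
    exists_chart_of_dominates hf hS (wall_eq_wall hx ▸ hp) hC hdom
  rw [half_eq_half hx] at he'
  exact ⟨A', hf'.1, image_subset_iff.2 (hf'.subset_preimage_of_eqOn he'), hA'⟩

theorem preimage_mem_chimneyGerm_of_half_subset (hf : 𝓘.IsChart A f) (hA' : A' ∈ 𝓘.apartments)
    (hS : 𝔸.IsPanelDir S β) (hx : wall β x ∈ 𝔸.walls) (hhalf : half β x ⊆ f ⁻¹' A')
    (hz : f z ∈ A') : f ⁻¹' A' ∈ 𝔸.chimneyGerm (𝔸.facet z S) S := by
  obtain ⟨Q, hQ⟩ := hS.exists_isSide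
  -- The facet `F(z, F^v(I))` is the smallest one at `z`: all roots vanish on `F^v(I)`.
  have hzF : f ⁻¹' A' ∈ 𝔸.facet z (𝔸.stdFacet univ) := by
    obtain ⟨g, hg, T, hT, hzT, he⟩ := exists_chart_of_mem hf hA' hz
    refine mem_of_superset (hT.mem_facet (Eventually.of_forall fun v hv => ?_))
      (hg.subset_preimage_of_eqOn he)
    exact hT.mem_of_forall_exists_nonneg fun α hα =>
      ⟨z, hzT, by rw [vadd_vsub, eq_zero_of_mem_stdFacet_univ hα hv]⟩
  have hR : f ⁻¹' A' ∈ 𝔸.chimneyGerm (𝔸.facet x Q) Q :=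
    mem_of_superset (half_mem_chimneyGerm hS.real hx hQ.chamber.isVFacet
      fun q hq => (hQ.pos q hq).le) hhalf
  obtain ⟨g, hg, T, hT, hTR, hTF, he⟩ := exists_chart_of_germs hf hA'
    (Model.isSplayedChimneyGerm hQ.chamber.isVFacet hQ.chamber.isSphericalVFacet x)
    (Or.inl ⟨z, _, isVFacet_stdFacet univ, rfl⟩) hR hzF
  obtain ⟨q, -, hqT⟩ := exists_vadd_of_mem_chimneyGerm hQ.chamber.isVFacet hTR
  have hzT : z ∈ T := hT.mem_of_mem_facet (isVFacet_stdFacet univ) hTF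
  exact mem_of_superset (hT.mem_chimneyGerm_facet hS.isVFacet
    fun s hs => hS.vadd_mem_of_isSide hQ hT hqT hzT hs) (hg.subset_preimage_of_eqOn he)

theorem exists_isEnclosed_between_of_half_subset (hf : 𝓘.IsChart A f) (hA' : A' ∈ 𝓘.apartments)
    (hS : 𝔸.IsPanelDir S β) (hx : wall β x ∈ 𝔸.walls) (hhalf : half β x ⊆ f ⁻¹' A')
    (hz : f z ∈ A') :
    ∃ g, 𝓘.IsChart A' g ∧ ∃ T, 𝔸.IsEnclosed T ∧ EqOn f g T ∧
      ∀ u, β (z -ᵥ x) ≤ β (u -ᵥ x) → β (u -ᵥ x) ≤ 0 → u ∈ T := by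
  obtain ⟨g, hg, T, hT, he, hmem⟩ := exists_chart_strip hf hA' hS.neg_root
    (preimage_mem_chimneyGerm_of_half_subset hf hA' hS hx hhalf hz)
    (mem_of_superset (hS.neg_dir.wall_mem_chimneyGerm hx) ((wall_subset_half β x).trans hhalf))
  refine ⟨g, hg, T, hT, he, fun u hzu hux => hmem u ?_ ?_⟩
  · rw [← vsub_sub_vsub_cancel_right u z x, LinearMap.neg_apply, map_sub]
    linarith
  · rwa [LinearMap.neg_apply, neg_nonneg]

theorem exists_mem_facet_eqOn_of_mem (hf : 𝓘.IsChart A f) (hf' : 𝓘.IsChart A' f')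
    (hS : 𝔸.IsPanelDir S β) (hx : wall β x ∈ 𝔸.walls) (he : EqOn f f' (half β x))
    (hz : f z ∈ A') (hneg : β (z -ᵥ x) < 0) (hQ : 𝔸.IsSide S (-β) Q) :
    ∃ T ∈ 𝔸.facet x Q, EqOn f f' T := by
  obtain ⟨g, hg, T, hT, heT, hmem⟩ := exists_isEnclosed_between_of_half_subset hf hf'.1 hS hx
    (hf'.subset_preimage_of_eqOn he) hz
  have hwall : EqOn f' g (wall β x) := fun u hu =>
    (he (wall_subset_half β x hu)).symm.trans (heT (hmem u (hneg.le.trans (ge_of_eq hu)) hu.le))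
  rcases hf'.eq_or_reflect_of_eqOn_wall hg hS hwall with rfl | ⟨t, rfl, ht⟩
  · refine ⟨T, hT.mem_facet ?_, heT⟩
    have hnear : ∀ᶠ v in 𝓝 (0 : V), β (z -ᵥ x) < β v :=
      (β.continuous_of_finiteDimensional.tendsto' 0 0 (map_zero β)).eventually (lt_mem_nhds hneg)
    filter_upwards [hnear] with v hv hvQ
    have hvneg : β v < 0 := neg_pos.1 (hQ.pos v hvQ)
    exact hmem _ (by rw [vadd_vsub]; exact hv.le) (by rw [vadd_vsub]; exact hvneg.le)
  · have hpos : 0 < β (t z -ᵥ x) := by rw [ht]; exact neg_pos.2 hneg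
    have hfz : f z = f (t z) := (heT (hmem z le_rfl hneg.le)).trans (he hpos.le).symm
    rw [← hf.injective hfz] at hpos
    exact absurd hpos hneg.not_gt

theorem IsThick.eq_inter (hthick : 𝓘.IsThick) {D M : Set X} (hD : 𝓘.IsHalfApartment D M) :
    ∃ A₁ ∈ 𝓘.apartments, ∃ A₂ ∈ 𝓘.apartments, D = A₁ ∩ A₂ := by
  obtain ⟨A, f, hf, β, hβ, x, hx, rfl, rfl⟩ := hD
  obtain ⟨S, hS⟩ := exists_isPanelDir hβ
  obtain ⟨Q₁, hQ₁⟩ := hS.exists_isSide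
  obtain ⟨Q₂, hQ₂⟩ := hS.neg_root.exists_isSide
  have hpanel : 𝓘.IsPanel ((𝔸.facet x S).map f) :=
    ⟨A, f, hf, _, ⟨x, S, hS.panel, ⟨β, hβ, hx, hS.span_eq_ker⟩, rfl⟩, rfl⟩
  obtain ⟨C, hC, hdom, hne₁, hne₂⟩ := hthick.exists_isChamber_ne hpanel
    ((𝔸.facet x Q₁).map f) ((𝔸.facet x Q₂).map f)
  obtain ⟨A', f', hf', he, hA'⟩ := exists_chart_of_dominates hf hS hx hC hdom
  refine ⟨A, hf.1, A', hf'.1, Subset.antisymm ?_ ?_⟩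
  · exact subset_inter ((image_subset_range f _).trans_eq hf.range_eq)
      (image_subset_iff.2 (hf'.subset_preimage_of_eqOn he))
  · rintro y ⟨hy, hy'⟩
    obtain ⟨z, rfl⟩ := hf.range_eq ▸ hy
    by_contra hz
    have hneg : β (z -ᵥ x) < 0 := not_le.1 fun h => hz (mem_image_of_mem f h)
    obtain ⟨T, hT, heT⟩ := exists_mem_facet_eqOn_of_mem hf hf' hS hx he hy' hneg hQ₂
    rw [map_eq_of_eqOn (half_mem_facet hβ hx fun s hs => (hS.vanish s hs).ge) he] at hdom
    rw [map_eq_of_eqOn (half_mem_facet hβ hx fun q hq => (hQ₁.pos q hq).le) he] at hne₁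
    rw [map_eq_of_eqOn hT heT] at hne₂
    exact (Dominates.eq_or_eq hC hf' hA' hS hQ₁ hQ₂ hx hdom).elim hne₁ hne₂

end HalfApartments

end Hovel

/-! ### Gluing two half-apartments along their wall -/

section Levels

variable {V P : Type*} [NormedAddCommGroup V] [NormedSpace ℝ V] [MetricSpace P]
  [NormedAddTorsor V P]

theorem apply_vsub_eq_sub (β : Dual ℝ V) (z a x : P) : β (z -ᵥ a) = β (z -ᵥ x) - β (a -ᵥ x) := by
  rw [← map_sub, vsub_sub_vsub_cancel_right]

theorem mem_half_neg_iff {β : Dual ℝ V} {a z : P} : z ∈ half (-β) a ↔ β (z -ᵥ a) ≤ 0 :=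
  neg_nonneg (a := β (z -ᵥ a))

theorem half_union_half_neg (β : Dual ℝ V) (a : P) : half β a ∪ half (-β) a = univ :=
  eq_univ_of_forall fun z => (le_total 0 (β (z -ᵥ a))).imp_right mem_half_neg_iff.2

end Levels

namespace VectorialData

variable {I V P : Type*} [Fintype I] [NormedAddCommGroup V] [NormedSpace ℝ V]
  [MetricSpace P] [NormedAddTorsor V P] {D : VectorialData I V}

theorem eq_or_eq_neg_of_wall_subset {β γ : Dual ℝ V} (hβ : β ∈ D.realRoots)
    (hγ : γ ∈ D.realRoots) {x y : P} (h : wall β x ⊆ wall γ y) : γ = β ∨ γ = -β := by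
  obtain ⟨S, hS⟩ := exists_isPanelDir hβ
  obtain ⟨s, hs⟩ := hS.isVFacet.nonempty
  have hγs : γ s = 0 := by
    have hx : γ (x -ᵥ y) = 0 := h (by simp [wall])
    have hsx : γ ((s +ᵥ x) -ᵥ y) = 0 := h (by simp [wall, hS.vanish s hs])
    rwa [vadd_vsub_assoc, map_add, hx, add_zero] at hsx
  rcases hS.eq_or_eq_neg_or_pos_or_neg (Or.inl hγ) with heq | heq | hpos | hneg
  · exact Or.inl heq
  · exact Or.inr heq
  · exact absurd hγs (hpos s hs).ne'
  · exact absurd hγs (hneg s hs).ne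

end VectorialData

namespace Hovel

open Model SimpleRootData VectorialData ApartmentSystem

section Gluing

variable {V P X : Type*} [NormedAddCommGroup V] [NormedSpace ℝ V] [MetricSpace P]
  [NormedAddTorsor V P]

/-- The map `h` glues `f₁` on the half-space `β ≤ β(x)` and `f` on the strip
`β(x) ≤ β ≤ β(x) + c`. -/
structure IsGluing (β : Dual ℝ V) (x : P) (f f₁ h : P → X) (c : ℝ) : Prop where
  eq_of_nonpos : ∀ z, β (z -ᵥ x) ≤ 0 → h z = f₁ z
  eq_of_nonneg_of_le : ∀ z, 0 ≤ β (z -ᵥ x) → β (z -ᵥ x) ≤ c → h z = f z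

variable {f f₁ h : P → X} {β : Dual ℝ V} {x : P} {c : ℝ}

theorem IsGluing.wall_eqOn (hg : IsGluing β x f f₁ h c) (hc : 0 ≤ c) {a : P}
    (ha : β (a -ᵥ x) = c) : EqOn f h (wall β a) := fun z hz => by
  have hzc : β (z -ᵥ x) = c := by
    have hza : β (z -ᵥ a) = 0 := hz
    rwa [apply_vsub_eq_sub β z a x, ha, sub_eq_zero] at hza
  exact (hg.eq_of_nonneg_of_le z (hzc ▸ hc) hzc.le).symm

theorem IsGluing.of_eqOn_half (hg : IsGluing β x f f₁ h c) (hc : 0 ≤ c) {a : P}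
    (ha : β (a -ᵥ x) = c) {h' : P → X} (he : EqOn h h' (half (-β) a)) :
    IsGluing β x f f₁ h' c := by
  have hmem : ∀ z, β (z -ᵥ x) ≤ c → z ∈ half (-β) a := fun z hz => by
    rwa [mem_half_neg_iff, apply_vsub_eq_sub β z a x, ha, sub_nonpos]
  exact ⟨fun z hz => by rw [← he (hmem z (hz.trans hc)), hg.eq_of_nonpos z hz],
    fun z hz hz' => by rw [← he (hmem z hz'), hg.eq_of_nonneg_of_le z hz hz']⟩

end Gluing

section HalfApartments

variable {I V P X : Type*} [Fintype I] [NormedAddCommGroup V] [NormedSpace ℝ V]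
  [FiniteDimensional ℝ V] [MetricSpace P] [NormedAddTorsor V P] {𝔸 : Model I V P}
  {𝓘 : Hovel 𝔸 X} {A A₁ A' : Set X} {f f₁ h : P → X} {S Q : Set V} {β : Dual ℝ V}
  {x a b : P} {c : ℝ}

theorem exists_chart_eqOn_wall (hf : 𝓘.IsChart A f) (hA₁ : A₁ ∈ 𝓘.apartments)
    (hβ : β ∈ 𝔸.realRoots) (hx : wall β x ∈ 𝔸.walls) (h : wall β x ⊆ f ⁻¹' A₁) :
    ∃ f₁, 𝓘.IsChart A₁ f₁ ∧ EqOn f f₁ (wall β x) := by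
  obtain ⟨S, hS⟩ := exists_isPanelDir hβ
  obtain ⟨f₁, hf₁, T, -, he, hT⟩ := exists_chart_strip hf hA₁ hS
    (mem_of_superset (hS.wall_mem_chimneyGerm hx) h)
    (mem_of_superset (hS.neg_dir.wall_mem_chimneyGerm hx) h)
  exact ⟨f₁, hf₁, fun z hz => he (hT z (le_of_eq hz) (ge_of_eq hz))⟩

theorem IsHalfApartment.exists_chart {D : Set X} (hf : 𝓘.IsChart A f) (hβ : β ∈ 𝔸.realRoots)
    (hx : wall β x ∈ 𝔸.walls) (hD : 𝓘.IsHalfApartment D (f '' wall β x)) :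
    ∃ A₁ f₁, 𝓘.IsChart A₁ f₁ ∧ EqOn f f₁ (wall β x) ∧ D = f₁ '' half (-β) x := by
  obtain ⟨A₁, f₀, hf₀, γ, hγ, y, -, rfl, hM⟩ := hD
  have hsub : wall β x ⊆ f ⁻¹' A₁ := by
    rw [← image_subset_iff, hM]
    exact (image_subset_range f₀ _).trans_eq hf₀.range_eq
  obtain ⟨f₁, hf₁, he⟩ := exists_chart_eqOn_wall hf hf₀.1 hβ hx hsub
  obtain ⟨w, hw, rfl⟩ := hf₁.exists_comp hf₀
  rw [he.image_eq, image_comp, image_eq_image hf₁.injective, image_wall] at hM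
  rw [image_comp, image_half]
  have hxy : act w.linear γ (x -ᵥ w y) = 0 := hM.le (by simp [wall])
  rw [← half_eq_half hxy]
  rcases eq_or_eq_neg_of_wall_subset hβ (act_mem_realRoots (linear_mem_weyl hw) hγ) hM.le with
    heq | heq <;> rw [heq]
  · obtain ⟨r, hr, hrβ, hrfix⟩ := exists_reflection hβ hx
    refine ⟨A₁, f₁ ∘ r, hf₁.comp hr, fun z hz => ?_, ?_⟩
    · rw [Function.comp_apply, hrfix z hz]
      exact he hz
    · rw [image_comp, image_eq_of_forall_mem_iff r (B := half β x) fun z => ?_]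
      rw [mem_half_neg_iff, ← neg_nonneg, ← hrβ]
      rfl
  · exact ⟨A₁, f₁, hf₁, he, rfl⟩

theorem IsGluing.exists_isGluing_of_germs (hh : 𝓘.IsChart A h) (hg : IsGluing β x f f₁ h c)
    (hc : 0 ≤ c) (hS : 𝔸.IsPanelDir S β) (hx : wall β x ∈ 𝔸.walls) (hQ : 𝔸.IsSide S β Q)
    (ha : β (a -ᵥ x) = c) (haw : wall β a ∈ 𝔸.walls) (hA' : A' ∈ 𝓘.apartments)
    (hm : f ⁻¹' A' ∈ 𝔸.chimneyGerm (𝔸.facet a S) S)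
    (hm₁ : f₁ ⁻¹' A' ∈ 𝔸.chimneyGerm (𝔸.facet x (Neg.neg ⁻¹' Q)) (Neg.neg ⁻¹' Q)) :
    ∃ h', 𝓘.IsChart A' h' ∧ IsGluing β x f f₁ h' c := by
  have hnQ : 𝔸.IsVFacet (Neg.neg ⁻¹' Q) := hQ.chamber.isVFacet.neg
  have hhm : h ⁻¹' A' ∈ 𝔸.chimneyGerm (𝔸.facet a S) S := by
    filter_upwards [hm, hS.wall_mem_chimneyGerm haw] with z hz hza
    rwa [mem_preimage, ← hg.wall_eqOn hc ha hza]
  have hhm₁ : h ⁻¹' A' ∈ 𝔸.chimneyGerm (𝔸.facet x (Neg.neg ⁻¹' Q)) (Neg.neg ⁻¹' Q) := by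
    have hhalf := half_mem_chimneyGerm (𝔸 := 𝔸) (a := x) (neg_mem_realRoots hS.real)
      (by rwa [wall_neg]) hnQ fun q hq => by simpa using (hQ.pos (-q) hq).le
    filter_upwards [hm₁, hhalf] with z hz hzx
    rwa [mem_preimage, hg.eq_of_nonpos z (mem_half_neg_iff.1 hzx)]
  obtain ⟨h', hh', he⟩ := exists_chart_half hh hA' hS.neg_root (by rwa [neg_neg]) hhm hhm₁
  exact ⟨h', hh', hg.of_eqOn_half hc ha he⟩

theorem IsGluing.extend (hg : IsGluing β x f f₁ h c) (hf : 𝓘.IsChart A f)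
    (hh : 𝓘.IsChart A' h) (hdisj : Disjoint (f '' openHalf β x) (f₁ '' half (-β) x))
    (hc : 0 ≤ c) (hS : 𝔸.IsPanelDir S β) (ha : β (a -ᵥ x) = c) (haw : wall β a ∈ 𝔸.walls)
    (hb : c < β (b -ᵥ x)) (hm : f ⁻¹' A' ∈ 𝔸.chimneyGerm (𝔸.facet b S) S) :
    IsGluing β x f f₁ h (β (b -ᵥ x)) := by
  have hwall : wall β a ⊆ f ⁻¹' A' := hh.subset_preimage_of_eqOn (hg.wall_eqOn hc ha)
  obtain ⟨f', hf', T, -, heT, hT⟩ := exists_chart_strip hf hh.1 hS hm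
    (mem_of_superset (hS.neg_dir.wall_mem_chimneyGerm haw) hwall)
  have hstrip : ∀ z, c ≤ β (z -ᵥ x) → β (z -ᵥ x) ≤ β (b -ᵥ x) → f z = f' z := fun z hcz hzb =>
    heT (hT z (by rwa [apply_vsub_eq_sub β z b x, sub_nonpos])
      (by rwa [apply_vsub_eq_sub β z a x, ha, sub_nonneg]))
  have hwall' : EqOn h f' (wall β a) := fun z hz => by
    have hza : β (z -ᵥ a) = 0 := hz
    rw [apply_vsub_eq_sub β z a x, ha, sub_eq_zero] at hza
    rw [← hg.wall_eqOn hc ha hz, hstrip z hza.ge (hza.trans_le hb.le)]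
  have heq : f' = h := by
    refine (hh.eq_or_reflect_of_eqOn_wall hf' hS hwall').resolve_right ?_
    rintro ⟨t, rfl, ht⟩
    have hfb : f b = h (t b) := hstrip b hb.le le_rfl
    have htb : β (t b -ᵥ x) < c := by
      have htba := ht b
      rw [apply_vsub_eq_sub β (t b) a x, apply_vsub_eq_sub β b a x, ha] at htba
      linarith
    rcases le_total (β (t b -ᵥ x)) 0 with hle | hge
    · exact hdisj.ne_of_mem (mem_image_of_mem f (hc.trans_lt hb))
        (mem_image_of_mem f₁ (mem_half_neg_iff.2 hle)) (hfb.trans (hg.eq_of_nonpos _ hle))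
    · have hbt : b = t b := hf.injective (hfb.trans (hg.eq_of_nonneg_of_le _ hge htb.le))
      exact (htb.trans hb).ne (by rw [← hbt])
  refine ⟨hg.eq_of_nonpos, fun z hz hzb => ?_⟩
  rcases le_total (β (z -ᵥ x)) c with hzc | hzc
  · exact hg.eq_of_nonneg_of_le z hz hzc
  · rw [← heq, hstrip z hzc hzb]

theorem exists_wall_gt (hf : 𝓘.IsChart A f) (hA' : A' ∈ 𝓘.apartments)
    (hS : 𝔸.IsPanelDir S β) (hQ : 𝔸.IsSide S β Q)
    (hm : f ⁻¹' A' ∈ 𝔸.chimneyGerm (𝔸.facet a S) S) (hmQ : f ⁻¹' A' ∈ 𝔸.facet a Q) :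
    ∃ b : P, wall β b ∈ 𝔸.walls ∧ 0 < β (b -ᵥ a) ∧
      f ⁻¹' A' ∈ 𝔸.chimneyGerm (𝔸.facet b S) S := by
  obtain ⟨g, hg, T, hT, hTS, hTQ, he⟩ := exists_chart_of_germs hf hA'
    (hS.isSplayedChimneyGerm a) (Or.inl ⟨a, Q, hQ.chamber.isVFacet, rfl⟩) hm hmQ
  obtain ⟨s₀, hs₀, hsT⟩ := exists_vadd_of_mem_chimneyGerm hS.isVFacet hTS
  obtain ⟨b, hbw, hbT, hb⟩ := hS.exists_wall_above hT hsT 1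
  refine ⟨b, hbw, ?_, mem_of_superset (hT.mem_chimneyGerm_facet hS.isVFacet hbT)
    (hg.subset_preimage_of_eqOn he)⟩
  rcases hb with hb | hb
  · rw [vsub_vadd_eq_vsub_sub, map_sub, hS.vanish s₀ hs₀, sub_zero] at hb
    exact one_pos.trans_le hb
  · obtain ⟨q, hq, -, hqT⟩ := exists_mem_of_mem_facet hQ.chamber.isVFacet hTQ univ_mem
    have hqb := hb _ hqT
    rw [apply_vsub_eq_sub β _ b a, vadd_vsub, sub_nonpos] at hqb
    exact (hQ.pos q hq).trans_le hqb

theorem IsGluing.exists_gt (hg : IsGluing β x f f₁ h c) (hf : 𝓘.IsChart A f)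
    (hh : 𝓘.IsChart A' h) (hdisj : Disjoint (f '' openHalf β x) (f₁ '' half (-β) x))
    (hc : 0 ≤ c) (hS : 𝔸.IsPanelDir S β) (ha : β (a -ᵥ x) = c) (haw : wall β a ∈ 𝔸.walls) :
    ∃ b : P, wall β b ∈ 𝔸.walls ∧ c < β (b -ᵥ x) ∧ ∃ A'' h', 𝓘.IsChart A'' h' ∧
      IsGluing β x f f₁ h' (β (b -ᵥ x)) := by
  obtain ⟨Q, hQ⟩ := hS.exists_isSide
  have hF : (𝔸.facet a S).map h = (𝔸.facet a S).map f :=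
    (map_eq_of_eqOn (hS.wall_mem_facet haw) (hg.wall_eqOn hc ha)).symm
  have hdom : 𝓘.Dominates ((𝔸.facet a Q).map f) ((𝔸.facet a S).map h) :=
    ⟨A, f, hf, _, _, ⟨a, Q, hQ.chamber.isVFacet, rfl⟩, ⟨a, S, hS.isVFacet, rfl⟩, rfl, hF,
      facet_le_adherence_of_isSide hQ a⟩
  obtain ⟨A'', h', hh', he, hA''⟩ := exists_chart_of_dominates hh hS.neg_root
    (by rwa [wall_neg]) ⟨A, f, hf, _, ⟨a, Q, hQ.chamber, rfl⟩, rfl⟩ hdom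
  have hg' := hg.of_eqOn_half hc ha he
  obtain ⟨b, hbw, hba, hm⟩ := exists_wall_gt hf hh'.1 hS hQ
    (mem_of_superset (hS.wall_mem_chimneyGerm haw)
      (hh'.subset_preimage_of_eqOn (hg'.wall_eqOn hc ha))) hA''
  have hcb : c < β (b -ᵥ x) := by
    rwa [apply_vsub_eq_sub β b a x, ha, sub_pos] at hba
  exact ⟨b, hbw, hcb, A'', h', hh', hg'.extend hf hh' hdisj hc hS ha haw hcb hm⟩

end HalfApartments

end Hovel

/-! ### The union of two half-apartments -/

namespace Model

open SimpleRootData VectorialData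

section Levels

variable {I V P : Type*} [Fintype I] [NormedAddCommGroup V] [NormedSpace ℝ V]
  [FiniteDimensional ℝ V] [MetricSpace P] [NormedAddTorsor V P] {𝔸 : Model I V P}
  {S Q : Set V} {β : Dual ℝ V} {a : P} {U : Set P}

theorem eventually_atTop_exists_mem_chimneyGerm (hS : 𝔸.IsVFacet S) (hQ : 𝔸.IsSide S β Q)
    (hU : U ∈ 𝔸.chimneyGerm (𝔸.facet a Q) Q) :
    ∀ᶠ c in atTop, ∃ b, β (b -ᵥ a) = c ∧ U ∈ 𝔸.chimneyGerm (𝔸.facet b S) S := by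
  obtain ⟨T, hT, hTU, hTQ, -⟩ := exists_isEnclosed_of_mem_chimneyGerm hQ.chamber.isVFacet hU
  obtain ⟨q, hq, hqT⟩ := exists_vadd_of_mem_chimneyGerm hQ.chamber.isVFacet hTQ
  have hβq : 0 < β q := hQ.pos q hq
  filter_upwards [eventually_gt_atTop (β q)] with c hc
  set t := (c - β q) / β q
  have htQ : t • q ∈ Q := hQ.chamber.isVFacet.smul_mem hq (div_pos (sub_pos.2 hc) hβq)
  refine ⟨t • q +ᵥ (q +ᵥ a), ?_, mem_of_superset (hT.mem_chimneyGerm_facet hS fun s hs => ?_) hTU⟩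
  · rw [vadd_vsub_assoc, vadd_vsub, map_add, map_smul, smul_eq_mul, div_mul_cancel₀ _ hβq.ne',
      sub_add_cancel]
  · rw [vadd_vadd]
    exact hqT _ (hQ.add_mem s hs _ htQ)

theorem eventually_nhdsGT_exists_mem_chimneyGerm (hS : 𝔸.IsPanelDir S β) (hQ : 𝔸.IsSide S β Q)
    (hU : U ∈ 𝔸.chimneyGerm (𝔸.facet a Q) S) :
    ∀ᶠ t in 𝓝[>] (0 : ℝ), ∃ b, β (b -ᵥ a) = t ∧ U ∈ 𝔸.chimneyGerm (𝔸.facet b S) S := by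
  obtain ⟨T, hT, hTU, -, ξ, hξ, W, hW, hadd⟩ := exists_isEnclosed_of_mem_chimneyGerm hS.isVFacet hU
  obtain ⟨q, hq⟩ := hQ.chamber.isVFacet.nonempty
  have hβq : 0 < β q := hQ.pos q hq
  have hcont : Continuous fun t : ℝ => (t / β q) • q := by fun_prop
  have hlim : Tendsto (fun t : ℝ => (t / β q) • q) (𝓝[>] 0) (𝓝 0) :=
    (hcont.tendsto' 0 0 (by rw [zero_div, zero_smul])).mono_left nhdsWithin_le_nhds
  filter_upwards [hlim.eventually (mem_localFacet.1 (mem_localFacet_of_mem_facet hW)),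
    self_mem_nhdsWithin] with t htW ht
  replace ht : 0 < t := ht
  refine ⟨ξ +ᵥ ((t / β q) • q +ᵥ a), ?_, mem_of_superset (hT.mem_chimneyGerm_facet hS.isVFacet
    (hadd _ (htW (hQ.chamber.isVFacet.smul_mem hq (div_pos ht hβq))))) hTU⟩
  rw [vadd_vsub_assoc, vadd_vsub, map_add, hS.vanish_closure hξ, zero_add, map_smul, smul_eq_mul,
    div_mul_cancel₀ _ hβq.ne']

theorem exists_wall_ge_mem_chimneyGerm (hS : 𝔸.IsPanelDir S β) (hQ : 𝔸.IsSide S (-β) Q)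
    (hU : U ∈ 𝔸.chimneyGerm (𝔸.facet a Q) S) :
    ∃ b, wall β b ∈ 𝔸.walls ∧ 0 ≤ β (b -ᵥ a) ∧ U ∈ 𝔸.chimneyGerm (𝔸.facet b S) S := by
  obtain ⟨T, hT, hTU, hTS, -⟩ := exists_isEnclosed_of_mem_chimneyGerm hS.isVFacet hU
  have hpoints : ∀ᶠ t in 𝓝[>] (0 : ℝ), ∃ p, β (p -ᵥ a) = -t ∧ ∀ s ∈ S, s +ᵥ p ∈ T := by
    filter_upwards [eventually_nhdsGT_exists_mem_chimneyGerm hS.neg_root hQ hTS]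
    rintro t ⟨p, hp, hpT⟩
    obtain ⟨s₀, hs₀, hsT⟩ := exists_vadd_of_mem_chimneyGerm hS.isVFacet hpT
    refine ⟨s₀ +ᵥ p, ?_, hsT⟩
    rw [vadd_vsub_assoc, map_add, hS.vanish s₀ hs₀, zero_add, ← hp, LinearMap.neg_apply, neg_neg]
  obtain ⟨t, p, hp, hpT⟩ := hpoints.exists
  obtain ⟨b, hbw, hbT, hb⟩ := hS.exists_wall_above hT hpT t
  refine ⟨b, hbw, ?_, mem_of_superset (hT.mem_chimneyGerm_facet hS.isVFacet hbT) hTU⟩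
  rcases hb with hb | hb
  · rw [apply_vsub_eq_sub β b p a, hp] at hb
    linarith
  · have hlim : Tendsto (fun t : ℝ => -t) (𝓝[>] 0) (𝓝 0) :=
      (continuous_neg.tendsto' 0 0 neg_zero).mono_left nhdsWithin_le_nhds
    refine le_of_tendsto hlim (hpoints.mono ?_)
    rintro τ ⟨u, hu, huT⟩
    obtain ⟨s, hs⟩ := hS.isVFacet.nonempty
    have hsb := hb _ (huT s hs)
    rwa [apply_vsub_eq_sub β _ b a, vadd_vsub_assoc, map_add, hS.vanish s hs, zero_add, hu,
      sub_nonpos] at hsb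

end Levels

end Model

namespace Hovel

open Model SimpleRootData VectorialData ApartmentSystem

section Union

variable {I V P X : Type*} [Fintype I] [NormedAddCommGroup V] [NormedSpace ℝ V]
  [MetricSpace P] [NormedAddTorsor V P] {𝔸 : Model I V P}

/-- The levels, relative to `x`, of the walls `β = const` up to which `f` and `f₁` can be glued
into a chart. -/
def gluingLevels (𝓘 : Hovel 𝔸 X) (β : Dual ℝ V) (x : P) (f f₁ : P → X) : Set ℝ :=
  {c | 0 ≤ c ∧ (∃ a, wall β a ∈ 𝔸.walls ∧ β (a -ᵥ x) = c) ∧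
    ∃ A h, 𝓘.IsChart A h ∧ IsGluing β x f f₁ h c}

variable [FiniteDimensional ℝ V] {𝓘 : Hovel 𝔸 X} {A A₁ : Set X} {f f₁ : P → X} {S : Set V}
  {β : Dual ℝ V} {x : P}

theorem exists_ge_mem_gluingLevels (hf : 𝓘.IsChart A f) (hf₁ : 𝓘.IsChart A₁ f₁)
    (hdisj : Disjoint (f '' openHalf β x) (f₁ '' half (-β) x)) (hS : 𝔸.IsPanelDir S β)
    (hx : wall β x ∈ 𝔸.walls) {m : ℝ}
    (happrox : ∀ u < m, ∃ c ∈ 𝓘.gluingLevels β x f f₁, u < c ∧ c < m) :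
    ∃ k ∈ 𝓘.gluingLevels β x f f₁, m ≤ k := by
  obtain ⟨Q₁, hQ₁⟩ := hS.exists_isSide
  obtain ⟨Q₂, hQ₂⟩ := hS.neg_root.exists_isSide
  have hnQ : 𝔸.IsVChamber (Neg.neg ⁻¹' Q₁) := IsVFacetOfType.neg hQ₁.chamber
  obtain ⟨a, ha⟩ := exists_apply_vsub_eq (ne_zero_of_mem_realRoots hS.real) x m
  obtain ⟨A', hA', hR, hR₁⟩ := 𝓘.ma3 ((𝔸.chimneyGerm (𝔸.facet a Q₂) S).map f)
    ((𝔸.chimneyGerm (𝔸.facet x (Neg.neg ⁻¹' Q₁)) (Neg.neg ⁻¹' Q₁)).map f₁)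
    ⟨A, f, hf, _, Model.isSplayedChimneyGerm hQ₂.chamber.isVFacet hS.panel.isSphericalVFacet a, rfl⟩
    (Or.inr ⟨A₁, f₁, hf₁, _, isSolidChimneyGerm_of_isVChamber hnQ x, rfl⟩)
  obtain ⟨δ, hδ, hbelow⟩ := mem_nhdsGT_iff_exists_Ioo_subset.1
    (eventually_nhdsGT_exists_mem_chimneyGerm hS.neg_root hQ₂ hR)
  obtain ⟨c, ⟨hc, ⟨p, hpw, hpc⟩, A₀, h, hh, hg⟩, hδc, hcm⟩ :=
    happrox (m - δ) (sub_lt_self m hδ)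
  obtain ⟨b, hb, hbA'⟩ := hbelow ⟨sub_pos.2 hcm, sub_lt_comm.1 hδc⟩
  have hbc : β (b -ᵥ x) = c := by
    rw [LinearMap.neg_apply, apply_vsub_eq_sub β b a x, ha] at hb
    linarith
  have hbw : wall β b ∈ 𝔸.walls := by
    rwa [wall_eq_wall (q := p) (by rw [apply_vsub_eq_sub β b p x, hbc, hpc, sub_self])]
  obtain ⟨h', hh', hg'⟩ := hg.exists_isGluing_of_germs hh hc hS hx hQ₁ hbc hbw hA' hbA' hR₁
  obtain ⟨z, hzw, hz, hzA'⟩ := exists_wall_ge_mem_chimneyGerm hS hQ₂ hR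
  have hmz : m ≤ β (z -ᵥ x) := by rwa [apply_vsub_eq_sub β z a x, ha, sub_nonneg] at hz
  have hcz : c < β (z -ᵥ x) := hcm.trans_le hmz
  exact ⟨β (z -ᵥ x), ⟨hc.trans hcz.le, ⟨z, hzw, rfl⟩, A', h', hh',
    hg'.extend hf hh' hdisj hc hS hbc hbw hcz hzA'⟩, hmz⟩

theorem exists_gt_mem_gluingLevels (hf : 𝓘.IsChart A f) (hf₁ : 𝓘.IsChart A₁ f₁)
    (he : EqOn f f₁ (wall β x)) (hdisj : Disjoint (f '' openHalf β x) (f₁ '' half (-β) x))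
    (hS : 𝔸.IsPanelDir S β) (hx : wall β x ∈ 𝔸.walls) (K : ℝ) :
    ∃ c ∈ 𝓘.gluingLevels β x f f₁, K < c := by
  by_contra! hK
  have hzero : (0 : ℝ) ∈ 𝓘.gluingLevels β x f f₁ :=
    ⟨le_rfl, ⟨x, hx, by simp⟩, A₁, f₁, hf₁, fun _ _ => rfl, fun _ h₁ h₂ =>
      (he (le_antisymm h₂ h₁)).symm⟩
  have hlub := isLUB_csSup ⟨0, hzero⟩ ⟨K, hK⟩
  set m := sSup (𝓘.gluingLevels β x f f₁)
  have hm : m ∉ 𝓘.gluingLevels β x f f₁ := by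
    rintro ⟨hm₀, ⟨a, haw, ham⟩, A', h, hh, hg⟩
    obtain ⟨b, hbw, hlt, hb⟩ := hg.exists_gt hf hh hdisj hm₀ hS ham haw
    exact hlt.not_ge (hlub.1 ⟨hm₀.trans hlt.le, ⟨b, hbw, rfl⟩, hb⟩)
  obtain ⟨k, hk, hmk⟩ := exists_ge_mem_gluingLevels hf hf₁ hdisj hS hx fun u hu => by
    obtain ⟨c, hc, huc, hcm⟩ := hlub.exists_between hu
    exact ⟨c, hc, huc, lt_of_le_of_ne hcm fun h => hm (h ▸ hc)⟩
  exact hm (le_antisymm (hlub.1 hk) hmk ▸ hk)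

theorem exists_apartment_forall_isGluing (hf : 𝓘.IsChart A f) (hf₁ : 𝓘.IsChart A₁ f₁)
    (he : EqOn f f₁ (wall β x)) (hdisj : Disjoint (f '' openHalf β x) (f₁ '' half (-β) x))
    (hS : 𝔸.IsPanelDir S β) (hx : wall β x ∈ 𝔸.walls) :
    ∃ A', ∀ K : ℝ, ∃ c ≥ K, ∃ h, 𝓘.IsChart A' h ∧ IsGluing β x f f₁ h c := by
  obtain ⟨Q, hQ⟩ := hS.exists_isSide
  have hnQ : 𝔸.IsVChamber (Neg.neg ⁻¹' Q) := IsVFacetOfType.neg hQ.chamber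
  obtain ⟨A', hA', hR, hR₁⟩ := 𝓘.ma3 ((𝔸.chimneyGerm (𝔸.facet x Q) Q).map f)
    ((𝔸.chimneyGerm (𝔸.facet x (Neg.neg ⁻¹' Q)) (Neg.neg ⁻¹' Q)).map f₁)
    ⟨A, f, hf, _, Model.isSplayedChimneyGerm hQ.chamber.isVFacet hQ.chamber.isSphericalVFacet x,
      rfl⟩
    (Or.inr ⟨A₁, f₁, hf₁, _, isSolidChimneyGerm_of_isVChamber hnQ x, rfl⟩)
  obtain ⟨K₀, hK₀⟩ := eventually_atTop.1
    (eventually_atTop_exists_mem_chimneyGerm hS.isVFacet hQ hR)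
  refine ⟨A', fun K => ?_⟩
  obtain ⟨c, ⟨hc, ⟨p, hpw, hpc⟩, A₀, h, hh, hg⟩, hKc⟩ :=
    exists_gt_mem_gluingLevels hf hf₁ he hdisj hS hx (max K K₀)
  obtain ⟨a, hac, haA'⟩ := hK₀ c ((le_max_right _ _).trans hKc.le)
  have haw : wall β a ∈ 𝔸.walls := by
    rwa [wall_eq_wall (q := p) (by rw [apply_vsub_eq_sub β a p x, hac, hpc, sub_self])]
  exact ⟨c, (le_max_left _ _).trans hKc.le,
    hg.exists_isGluing_of_germs hh hc hS hx hQ hac haw hA' haA' hR₁⟩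

theorem exists_chart_eqOn_half_eqOn_half_neg (hf : 𝓘.IsChart A f) (hf₁ : 𝓘.IsChart A₁ f₁)
    (he : EqOn f f₁ (wall β x)) (hdisj : Disjoint (f '' openHalf β x) (f₁ '' half (-β) x))
    (hβ : β ∈ 𝔸.realRoots) (hx : wall β x ∈ 𝔸.walls) :
    ∃ A' h, 𝓘.IsChart A' h ∧ EqOn f h (half β x) ∧ EqOn f₁ h (half (-β) x) := by
  obtain ⟨S, hS⟩ := exists_isPanelDir hβ
  obtain ⟨A', hA'⟩ := exists_apartment_forall_isGluing hf hf₁ he hdisj hS hx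
  obtain ⟨_, -, h, hh, hg⟩ := hA' 0
  refine ⟨A', h, hh, fun z hz => ?_, fun z hz => (hg.eq_of_nonpos z (mem_half_neg_iff.1 hz)).symm⟩
  obtain ⟨c, hc, h', hh', hg'⟩ := hA' (β (z -ᵥ x))
  have heq : h = h' := by
    have hopen : IsOpen {z : P | β (z -ᵥ x) < 0} :=
      isOpen_Iio.preimage (continuous_apply_vsub β x)
    obtain ⟨u, hu⟩ := exists_apply_vsub_eq (ne_zero_of_mem_realRoots hβ) x (-1)
    refine hh.eq_of_eqOn_isOpen hh' hopen ⟨u, hu.trans_lt neg_one_lt_zero⟩ fun v hv => ?_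
    rw [hg.eq_of_nonpos v (le_of_lt hv), hg'.eq_of_nonpos v (le_of_lt hv)]
  rw [heq, hg'.eq_of_nonneg_of_le z hz hc]

theorem union_mem_apartments {D D₁ M : Set X} (hD : 𝓘.IsHalfApartment D M)
    (hD₁ : 𝓘.IsHalfApartment D₁ M) (hM : D ∩ D₁ = M) : D ∪ D₁ ∈ 𝓘.apartments := by
  obtain ⟨A, f, hf, β, hβ, x, hx, rfl, rfl⟩ := hD
  obtain ⟨A₁, f₁, hf₁, he, rfl⟩ := hD₁.exists_chart hf hβ hx
  have hdisj : Disjoint (f '' openHalf β x) (f₁ '' half (-β) x) := by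
    rw [Set.disjoint_left]
    rintro _ ⟨z, hz, rfl⟩ hz₁
    have hz' : 0 < β (z -ᵥ x) := hz
    have hzM : f z ∈ f '' wall β x := hM.subset ⟨mem_image_of_mem f hz'.le, hz₁⟩
    exact hz'.ne' (hf.injective.mem_set_image.1 hzM)
  obtain ⟨A', h, hh, heh, heh₁⟩ := exists_chart_eqOn_half_eqOn_half_neg hf hf₁ he hdisj hβ hx
  rw [heh.image_eq, heh₁.image_eq, ← image_union, half_union_half_neg, image_univ, hh.range_eq]
  exact hh.1

end Union

end Hovel

end AffineHovel

theorem proposition2p9 {I V P X : Type*} [Fintype I] [NormedAddCommGroup V] [NormedSpace ℝ V]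
    [FiniteDimensional ℝ V] [MetricSpace P] [NormedAddTorsor V P]
    (𝔸 : AffineHovel.Model I V P) (𝓘 : AffineHovel.Hovel 𝔸 X) :
    (∀ (D M : Set X) (F C : Filter X), 𝓘.IsHalfApartment D M →
      𝓘.IsPanel F → M ∈ F → 𝓘.IsChamber C → 𝓘.Dominates C F →
      ∃ A ∈ 𝓘.apartments, D ⊆ A ∧ A ∈ C) ∧
    (∀ D D₁ M : Set X, 𝓘.IsHalfApartment D M → 𝓘.IsHalfApartment D₁ M →
      D ∩ D₁ = M → D ∪ D₁ ∈ 𝓘.apartments) ∧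
    (𝓘.IsThick → ∀ D M : Set X, 𝓘.IsHalfApartment D M →
      ∃ A₁ ∈ 𝓘.apartments, ∃ A₂ ∈ 𝓘.apartments, D = A₁ ∩ A₂) :=
  ⟨fun _ _ _ _ hD hF hM hC hdom =>
      AffineHovel.Hovel.exists_apartment_of_dominates hD hF hM hC hdom,
    fun _ _ _ hD hD₁ hM => AffineHovel.Hovel.union_mem_apartments hD hD₁ hM,
    fun hthick _ _ hD => hthick.eq_inter hD⟩
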